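/- **Setting.** Let $\gamma\in\mathbb R$, let $J=[x^+,x^-]\subset\mathbb R$ be bounded with $x^+<x^-$, let $N\ge 0$, and put $\mathfrak h_N=L^2(J^N)$ (Lebesgue measure; $\mathfrak h_0=\mathbb C$). The symmetric group acts by $(wx)_{w(j)}=x_j$ on $\mathbb R^N$ and by $(wf)(x)=f(w^{-1}x)$ on functions; $s_j$ swaps $j$ and $j+1$. *Wavefunctions.* For continuous $f$ on $\mathbb R^N$ put $(s_j^\gamma f)(x)=f(s_jx)+\gamma\int_0^{x_j-x_{j+1}}f(x-y(e_j-e_{j+1}))\,dy$, and $w^\gamma=s_{i_1}^\gamma\cdots s_{i_l}^\gamma$ for $w=s_{i_1}\cdots s_{i_l}\in S_N$ (this does not depend on the decomposition). For $\lambda\in\mathbb C^N$ let $\psi_\lambda(x)=(w^\gamma e^{i\lambda})(wx)$ whenever $(wx)_1\ge\dots\ge(wx)_N$, where $e^{i\lambda}(x)=e^{i\sum_j\lambda_jx_j}$. Let $\bar{\mathfrak z}_N\subset\mathfrak h_N$ be the closure of the linear span of the restrictions $\psi_\lambda|_{J^N}$, $\lambda\in\mathbb C^N$. *Operators.* For $\mu\in\mathbb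 C$, real numbers $p_0,\dots,p_n$ and a function $g$ of $n$ variables, put $$E_\mu(p_0,\dots,p_n;g)=\int_{p_1}^{p_0}\!dy_1\cdots\int_{p_n}^{p_{n-1}}\!dy_n\;e^{i\mu\left(\sum_{m=0}^n p_m-\sum_{m=1}^n y_m\right)}g(y_1,\dots,y_n)$$ if $p_0>\dots>p_n$, and $0$ otherwise. Let $\mathfrak i^n_N$ be the set of $n$-tuples of distinct elements of $\{1,\dots,N\}$. For $z\in\mathbb R^N$, $\mathbf i\in\mathfrak i^n_N$ and $y\in\mathbb R^n$ let $z[\mathbf i\to y]$ be $z$ with $z_{i_m}$ replaced by $y_m$ for each $m$. For $x\in J^{N+1}$ put $x'=(x_2,\dots,x_{N+1})$ and $x''=(x_1,\dots,x_N)$. The following formulas define bounded operators $b^\pm_\mu:\mathfrak h_N\to\mathfrak h_{N+1}$, $a^\pm_\mu:\mathfrak h_N\to\mathfrak h_N$, $c^\pm_\mu:\mathfrak h_{N+1}\to\mathfrak h_N$: $$(b^+_\mu f)(x)=\sum_{n=0}^N\gamma^n\sum_{\mathbf i\in\mathfrak i^n_N}E_\mu\bigl(x'_{i_1},\dots,x'_{i_n},x_1;\;y\mapsto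 f(x'[\mathbf i\to y])\bigr),$$ $$(b^-_\mu f)(x)=\sum_{n=0}^N\gamma^n\sum_{\mathbf i\in\mathfrak i^n_N}E_\mu\bigl(x_{N+1},x''_{i_1},\dots,x''_{i_n};\;y\mapsto f(x''[\mathbf i\to y])\bigr),$$ $$(a^+_\mu f)(x)=(b^+_\mu f)(x^+,x),\qquad (a^-_\mu f)(x)=(b^-_\mu f)(x,x^-)\qquad(x\in J^N),$$ $$(c^+_\mu f)(x)=\sum_{n=0}^N\gamma^{n+1}\sum_{\mathbf i\in\mathfrak i^n_N}E_\mu\bigl(x^-,x_{i_1},\dots,x_{i_n},x^+;\;(y_1,\dots,y_{n+1})\mapsto f(x[\mathbf i\to(y_2,\dots,y_{n+1})],\,y_1)\bigr),$$ $$(c^-_\mu f)(x)=\sum_{n=0}^N\gamma^{n+1}\sum_{\mathbf i\in\mathfrak i^n_N}E_\mu\bigl(x^-,x_{i_1},\dots,x_{i_n},x^+;\;(y_1,\dots,y_{n+1})\mapsto f(y_{n+1},\,x[\mathbf i\to(y_1,\dots,y_n)])\bigr)$$ (in the formulas for $a^\pm_\mu$, the expressions for $b^\pm_\mu$ are evaluated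 pointwise at the indicated argument; in those for $c^\pm_\mu$, $x\in J^N$). **Theorem.** Let $N\ge0$, $\epsilon=\pm$ (that is, $\epsilon=\pm1$) and $\mu,\nu\in\mathbb C$. Then $b^\epsilon_\mu$ maps $\bar{\mathfrak z}_N$ into $\bar{\mathfrak z}_{N+1}$, $a^\epsilon_\mu$ maps $\bar{\mathfrak z}_N$ into $\bar{\mathfrak z}_N$, and $c^\epsilon_\mu$ maps $\bar{\mathfrak z}_{N+1}$ into $\bar{\mathfrak z}_N$. If $\mu\neq\nu$, then $$a^\epsilon_\mu b^\epsilon_\nu=\frac{\mu-\nu+\epsilon i\gamma}{\mu-\nu}\,b^\epsilon_\nu a^\epsilon_\mu-\frac{\epsilon i\gamma}{\mu-\nu}\,b^\epsilon_\mu a^\epsilon_\nu\quad\text{on }\bar{\mathfrak z}_N,$$ $$c^\epsilon_\mu a^\epsilon_\nu=\frac{\mu-\nu-\epsilon i\gamma}{\mu-\nu}\,a^\epsilon_\nu c^\epsilon_\mu+\frac{\epsilon i\gamma}{\mu-\nu}\,a^\epsilon_\mu c^\epsilon_\nu\quad\text{on }\bar{\mathfrak z}_{N+1}.$$ For $\mu=\nu$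 both relations hold with the right-hand side interpreted as the limit $\nu\to\mu$, $\nu\ne\mu$ (applied to any fixed vector, in the $L^2$-norm). -/

import Mathlib

open MeasureTheory Set Filter Topology
open scoped ENNReal

noncomputable section

namespace QNLS

/-! ### Bounded operators on `L²` given by formulas on functions -/

section L2

variable {X Z : Type*} [MeasurableSpace X] [MeasurableSpace Z]

/-- The formula `T`, applied to functions, respects almost everywhere equality and induces a
bounded linear operator `L²(μZ) → L²(μX)`. -/
structure IsL2Operator (μZ : Measure Z) (μX : Measure X) (T : (Z → ℂ) → (X → ℂ)) : Prop where
  congr : ∀ f g : Z → ℂ, f =ᵐ[μZ] g → T f =ᵐ[μX] T g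
  add : ∀ f g : Z → ℂ, MemLp f 2 μZ → MemLp g 2 μZ → T (f + g) =ᵐ[μX] T f + T g
  smul : ∀ (c : ℂ) (f : Z → ℂ), T (c • f) =ᵐ[μX] c • T f
  bound : ∃ C : ℝ≥0∞, C ≠ ∞ ∧ ∀ f : Z → ℂ, MemLp f 2 μZ →
    AEStronglyMeasurable (T f) μX ∧ eLpNorm (T f) 2 μX ≤ C * eLpNorm f 2 μZ

variable {μZ : Measure Z} {μX : Measure X}

theorem IsL2Operator.memLp {T : (Z → ℂ) → (X → ℂ)} (h : IsL2Operator μZ μX T) {f : Z → ℂ}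
    (hf : MemLp f 2 μZ) : MemLp (T f) 2 μX := by
  obtain ⟨C, hC, hb⟩ := h.bound
  exact ⟨(hb f hf).1, (hb f hf).2.trans_lt (ENNReal.mul_lt_top hC.lt_top hf.2)⟩

/-- The bounded operator on `L²` induced by the formula `T`. -/
def IsL2Operator.toCLM {T : (Z → ℂ) → (X → ℂ)} (h : IsL2Operator μZ μX T) :
    Lp ℂ 2 μZ →L[ℂ] Lp ℂ 2 μX :=
  LinearMap.mkContinuousOfExistsBound
    { toFun := fun f => (h.memLp (Lp.memLp f)).toLp (T f)
      map_add' := by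
        intro f g
        rw [← MemLp.toLp_add]
        refine MemLp.toLp_congr _ _ ?_
        exact (h.congr _ _ (Lp.coeFn_add f g)).trans (h.add _ _ (Lp.memLp f) (Lp.memLp g))
      map_smul' := by
        intro c f
        rw [RingHom.id_apply, ← MemLp.toLp_const_smul]
        refine MemLp.toLp_congr _ _ ?_
        exact (h.congr _ _ (Lp.coeFn_smul c f)).trans (h.smul c _) }
    (by
      obtain ⟨C, hC, hb⟩ := h.bound
      refine ⟨C.toReal, fun f => ?_⟩
      simp only [LinearMap.coe_mk, AddHom.coe_mk]
      rw [Lp.norm_toLp, Lp.norm_def, ← ENNReal.toReal_mul]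
      exact ENNReal.toReal_mono (ENNReal.mul_ne_top hC (Lp.memLp f).2.ne) (hb _ (Lp.memLp f)).2)

/-- The operator `h.toCLM` is given by the formula `T`. -/
theorem IsL2Operator.toCLM_coeFn {T : (Z → ℂ) → (X → ℂ)} (h : IsL2Operator μZ μX T)
    (f : Lp ℂ 2 μZ) : (h.toCLM f : X → ℂ) =ᵐ[μX] T f :=
  MemLp.coeFn_toLp (h.memLp (Lp.memLp f))

theorem IsL2Operator.of_ae_eq {T U : (Z → ℂ) → (X → ℂ)} (hU : IsL2Operator μZ μX U)
    (h : ∀ f, T f =ᵐ[μX] U f) : IsL2Operator μZ μX T where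
  congr f g hfg := (h f).trans ((hU.congr f g hfg).trans (h g).symm)
  add f g hf hg := (h _).trans ((hU.add f g hf hg).trans ((h f).add (h g)).symm)
  smul c f := (h _).trans ((hU.smul c f).trans ((h f).const_smul c).symm)
  bound := by
    obtain ⟨C, hC, hb⟩ := hU.bound
    refine ⟨C, hC, fun f hf => ⟨(hb f hf).1.congr (h f).symm, ?_⟩⟩
    rw [eLpNorm_congr_ae (h f)]
    exact (hb f hf).2

theorem IsL2Operator.const_mul {T : (Z → ℂ) → (X → ℂ)} (hT : IsL2Operator μZ μX T) (a : ℂ) :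
    IsL2Operator μZ μX (fun f x => a * T f x) where
  congr f g hfg := by filter_upwards [hT.congr f g hfg] with x hx; simp [hx]
  add f g hf hg := by
    filter_upwards [hT.add f g hf hg] with x hx
    simp only [Pi.add_apply] at hx ⊢
    rw [hx, mul_add]
  smul c f := by
    filter_upwards [hT.smul c f] with x hx
    simp only [Pi.smul_apply, smul_eq_mul] at hx ⊢
    rw [hx]; ring
  bound := by
    obtain ⟨C, hC, hb⟩ := hT.bound
    refine ⟨‖a‖ₑ * C, ENNReal.mul_ne_top (by simp) hC, fun f hf => ⟨?_, ?_⟩⟩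
    · exact (hb f hf).1.const_mul a
    · have : (fun x => a * T f x) = a • T f := rfl
      rw [this, eLpNorm_const_smul, mul_assoc]
      gcongr
      exact (hb f hf).2

theorem IsL2Operator.zero : IsL2Operator μZ μX (fun _ _ => 0) where
  congr _ _ _ := Filter.EventuallyEq.rfl
  add _ _ _ _ := by filter_upwards with x; simp
  smul _ _ := by filter_upwards with x; simp
  bound := ⟨0, by simp, fun f _ => ⟨aestronglyMeasurable_const, by simp⟩⟩

theorem IsL2Operator.add' {T U : (Z → ℂ) → (X → ℂ)} (hT : IsL2Operator μZ μX T)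
    (hU : IsL2Operator μZ μX U) : IsL2Operator μZ μX (fun f x => T f x + U f x) where
  congr f g hfg := by
    filter_upwards [hT.congr f g hfg, hU.congr f g hfg] with x hx hx'; simp [hx, hx']
  add f g hf hg := by
    filter_upwards [hT.add f g hf hg, hU.add f g hf hg] with x hx hx'
    simp only [Pi.add_apply] at hx hx' ⊢
    rw [hx, hx']; ring
  smul c f := by
    filter_upwards [hT.smul c f, hU.smul c f] with x hx hx'
    simp only [Pi.smul_apply, smul_eq_mul] at hx hx' ⊢
    rw [hx, hx']; ring
  bound := by
    obtain ⟨C, hC, hb⟩ := hT.bound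
    obtain ⟨D, hD, hd⟩ := hU.bound
    refine ⟨C + D, by simp [hC, hD], fun f hf => ⟨(hb f hf).1.add (hd f hf).1, ?_⟩⟩
    refine (eLpNorm_add_le (hb f hf).1 (hd f hf).1 (by norm_num)).trans ?_
    rw [add_mul]
    exact add_le_add (hb f hf).2 (hd f hf).2

theorem IsL2Operator.sum {ι : Type*} (s : Finset ι) {T : ι → (Z → ℂ) → (X → ℂ)}
    (hT : ∀ i ∈ s, IsL2Operator μZ μX (T i)) :
    IsL2Operator μZ μX (fun f x => ∑ i ∈ s, T i f x) := by
  classical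
  induction s using Finset.induction_on with
  | empty => simpa using IsL2Operator.zero
  | insert a s ha ih =>
    simp only [Finset.sum_insert ha]
    exact (hT a (by simp)).add' (ih fun i hi => hT i (by simp [hi]))

theorem eLpNorm_two_eq {W : Type*} [MeasurableSpace W] (m : Measure W) (g : W → ℂ) :
    eLpNorm g 2 m = (∫⁻ w, ‖g w‖ₑ ^ (2 : ℝ) ∂m) ^ (1 / 2 : ℝ) := by
  rw [eLpNorm_eq_lintegral_rpow_enorm_toReal (by norm_num) (by norm_num)]
  simp

/-- Boundedness of an integral operator `f ↦ (x ↦ ∫ K(x,y) f(φ(x,y)) dy)` with bounded kernel. -/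
theorem isL2Operator_kernel {Y : Type*} [MeasurableSpace Y] {μY : Measure Y}
    [IsFiniteMeasure μX] [IsFiniteMeasure μY] {φ : X × Y → Z} (hφ : Measurable φ) {c : ℝ≥0∞}
    (hc : c ≠ ∞) (hmap : (μX.prod μY).map φ = c • μZ) {K : X × Y → ℂ} (hK : Measurable K)
    {C : ℝ} (hKC : ∀ z, ‖K z‖ ≤ C) :
    IsL2Operator μZ μX (fun f x => ∫ y, K (x, y) * f (φ (x, y)) ∂μY) := by
  have hac : (μX.prod μY).map φ ≪ μZ := by
    rw [hmap]; exact Measure.smul_absolutelyContinuous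
  have hq : Measure.QuasiMeasurePreserving φ (μX.prod μY) μZ := ⟨hφ, hac⟩
  have hcomp : ∀ f : Z → ℂ, MemLp f 2 μZ → MemLp (f ∘ φ) 2 (μX.prod μY) := by
    intro f hf
    refine MemLp.comp_of_map ?_ hφ.aemeasurable
    rw [hmap]; exact hf.smul_measure hc
  have hmul : ∀ f : Z → ℂ, MemLp f 2 μZ →
      MemLp (fun z => K z * f (φ z)) 2 (μX.prod μY) := by
    intro f hf
    exact MemLp.of_le_mul (c := C) (hcomp f hf) (hK.aestronglyMeasurable.mul (hcomp f hf).1)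
      (Filter.Eventually.of_forall fun z => by
        rw [norm_mul]
        exact mul_le_mul_of_nonneg_right (hKC z) (norm_nonneg _))
  have hint : ∀ f : Z → ℂ, MemLp f 2 μZ →
      ∀ᵐ x ∂μX, Integrable (fun y => K (x, y) * f (φ (x, y))) μY := by
    intro f hf
    exact ((hmul f hf).integrable (by norm_num)).prod_right_ae
  refine ⟨?_, ?_, ?_, ?_⟩
  · intro f g hfg
    have h1 := Measure.ae_ae_of_ae_prod (hq.ae_eq_comp hfg)
    filter_upwards [h1] with x hx
    refine integral_congr_ae ?_
    filter_upwards [hx] with y hy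
    simp only [Function.comp_apply] at hy
    simp only [hy]
  · intro f g hf hg
    filter_upwards [hint f hf, hint g hg] with x hx hx'
    simp only [Pi.add_apply, mul_add]
    exact integral_add hx hx'
  · intro a f
    filter_upwards with x
    simp only [Pi.smul_apply, smul_eq_mul]
    rw [← integral_const_mul]
    congr 1; ext y; ring
  · set B : ℝ≥0∞ := (μY univ) * (ENNReal.ofReal C ^ 2 * c) with hB
    have hBt : B ≠ ∞ := by
      refine ENNReal.mul_ne_top (measure_ne_top _ _) (ENNReal.mul_ne_top ?_ hc)
      exact ENNReal.pow_ne_top ENNReal.ofReal_ne_top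
    refine ⟨B ^ (1 / 2 : ℝ), ENNReal.rpow_ne_top_of_nonneg (by norm_num) hBt, fun f hf => ?_⟩
    refine ⟨(hmul f hf).1.integral_prod_right', ?_⟩
    rw [eLpNorm_two_eq μX, eLpNorm_two_eq μZ, ← ENNReal.mul_rpow_of_nonneg _ _ (by norm_num)]
    refine ENNReal.rpow_le_rpow ?_ (by norm_num)
    have hfm : AEStronglyMeasurable f ((μX.prod μY).map φ) := by
      rw [hmap]; exact hf.1.mono_ac Measure.smul_absolutelyContinuous
    have hpt : ∀ᵐ x ∂μX, ‖∫ y, K (x, y) * f (φ (x, y)) ∂μY‖ₑ ^ (2 : ℝ) ≤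
        μY univ * ∫⁻ y, ENNReal.ofReal C ^ 2 * ‖f (φ (x, y))‖ₑ ^ (2 : ℝ) ∂μY := by
      filter_upwards [hint f hf] with x hx
      have h1 : ‖∫ y, K (x, y) * f (φ (x, y)) ∂μY‖ₑ ≤
          eLpNorm (fun y => K (x, y) * f (φ (x, y))) 1 μY := by
        rw [eLpNorm_one_eq_lintegral_enorm]
        exact enorm_integral_le_lintegral_enorm _
      have h2 := eLpNorm_le_eLpNorm_mul_rpow_measure_univ (p := 1) (q := 2) (μ := μY)
        (by norm_num) hx.1
      have h3 := h1.trans h2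
      rw [eLpNorm_two_eq μY] at h3
      have h4 := ENNReal.rpow_le_rpow h3 (z := 2) (by norm_num)
      refine h4.trans ?_
      rw [ENNReal.mul_rpow_of_nonneg _ _ (by norm_num), ← ENNReal.rpow_mul, ← ENNReal.rpow_mul]
      norm_num
      rw [mul_comm]
      gcongr with y
      rw [mul_pow]
      gcongr
      rw [← ofReal_norm]
      exact ENNReal.ofReal_le_ofReal (hKC _)
    refine (lintegral_mono_ae hpt).trans ?_
    have hae : AEMeasurable (fun z => ‖f (φ z)‖ₑ ^ (2 : ℝ)) (μX.prod μY) :=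
      ((hcomp f hf).1.enorm).pow_const _
    rw [lintegral_const_mul' _ _ (measure_ne_top _ _), hB, mul_assoc]
    gcongr
    rw [lintegral_congr (fun x => lintegral_const_mul' _ _
      (ENNReal.pow_ne_top ENNReal.ofReal_ne_top))]
    rw [lintegral_const_mul' _ _ (ENNReal.pow_ne_top ENNReal.ofReal_ne_top), mul_assoc]
    gcongr
    rw [← lintegral_prod (fun z : X × Y => ‖f (φ z)‖ₑ ^ (2 : ℝ)) hae]
    rw [← lintegral_map' (f := fun z => ‖f z‖ₑ ^ (2 : ℝ)) (hfm.enorm.pow_const _)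
      hφ.aemeasurable, hmap, lintegral_smul_measure]
    simp

end L2

/-! ### The configuration space `J^N` with `J = [xp, xm]` -/

/-- Lebesgue measure on the cube `[xp, xm]^N`. -/
def cube (xp xm : ℝ) (N : ℕ) : Measure (Fin N → ℝ) :=
  volume.restrict (univ.pi fun _ => Icc xp xm)

/-- The Hilbert space `L²(J^N)`, `J = [xp, xm]`. -/
abbrev H (xp xm : ℝ) (N : ℕ) : Type := Lp ℂ 2 (cube xp xm N)

theorem cube_eq_pi (xp xm : ℝ) (N : ℕ) :
    cube xp xm N = Measure.pi (fun _ => (volume : Measure ℝ).restrict (Icc xp xm)) := by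
  rw [cube, volume_pi, Measure.restrict_pi_pi]

instance (xp xm : ℝ) (N : ℕ) : IsFiniteMeasure (cube xp xm N) := by
  rw [cube_eq_pi]; infer_instance

theorem cube_ae_mem (xp xm : ℝ) (N : ℕ) :
    ∀ᵐ x ∂(cube xp xm N), ∀ k, x k ∈ Icc xp xm := by
  have : MeasurableSet (univ.pi fun _ : Fin N => Icc xp xm) :=
    MeasurableSet.univ_pi fun _ => measurableSet_Icc
  filter_upwards [ae_restrict_mem this] with x hx k
  exact hx k (mem_univ k)

/-- Selecting distinct coordinates out of a point of `J^M × J^n` maps Lebesgue measure to a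
multiple of Lebesgue measure. -/
theorem map_select (xp xm : ℝ) {M n N : ℕ} (s : Fin N → Fin M ⊕ Fin n)
    (hs : Function.Injective s) : ∃ c : ℝ≥0∞, c ≠ ∞ ∧
    ((cube xp xm M).prod (cube xp xm n)).map (fun z k => Sum.elim z.1 z.2 (s k)) =
      c • cube xp xm N := by
  classical
  set ν := (volume : Measure ℝ).restrict (Icc xp xm) with hν
  have hmeas : Measurable (fun (z : (Fin M → ℝ) × (Fin n → ℝ)) (k : Fin N) =>
      Sum.elim z.1 z.2 (s k)) := by
    refine measurable_pi_lambda _ fun k => ?_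
    rcases s k with j | j
    · exact (measurable_pi_apply j).comp measurable_fst
    · exact (measurable_pi_apply j).comp measurable_snd
  set c : ℝ≥0∞ := ∏ _t ∈ (Finset.univ.image s)ᶜ, ν univ with hcdef
  have hc : c ≠ ∞ := ENNReal.prod_ne_top fun _ _ => measure_ne_top _ _
  have hbox : ∀ S : Fin N → Set ℝ, (∀ k, MeasurableSet (S k)) →
      ((cube xp xm M).prod (cube xp xm n)).map (fun z k => Sum.elim z.1 z.2 (s k)) (univ.pi S) =
        (c • cube xp xm N) (univ.pi S) := by
    intro S hS
    rw [Measure.map_apply hmeas (MeasurableSet.univ_pi hS)]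
    set C : Fin M ⊕ Fin n → Set ℝ := Function.extend s S (fun _ => univ) with hC
    have hCs : ∀ k, C (s k) = S k := fun k => hs.extend_apply _ _ _
    have hpre : (fun (z : (Fin M → ℝ) × (Fin n → ℝ)) k => Sum.elim z.1 z.2 (s k)) ⁻¹' (univ.pi S)
        = (univ.pi fun j => C (Sum.inl j)) ×ˢ (univ.pi fun j => C (Sum.inr j)) := by
      ext z
      simp only [mem_preimage, Set.mem_pi, mem_univ, true_imp_iff, mem_prod]
      constructor
      · intro h
        have key : ∀ t, Sum.elim z.1 z.2 t ∈ C t := by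
          intro t
          by_cases ht : ∃ k, s k = t
          · obtain ⟨k, rfl⟩ := ht
            rw [hCs]; exact h k
          · rw [hC, Function.extend_apply' _ _ _ ht]; exact mem_univ _
        exact ⟨fun j => key (Sum.inl j), fun j => key (Sum.inr j)⟩
      · intro h k
        rw [← hCs]
        rcases s k with j | j
        · exact h.1 j
        · exact h.2 j
    rw [hpre, Measure.prod_prod, Measure.smul_apply, cube_eq_pi, cube_eq_pi, cube_eq_pi,
      Measure.pi_pi, Measure.pi_pi, Measure.pi_pi, smul_eq_mul, ← hν,
      ← Fintype.prod_sum_type (fun t => ν (C t)), ← Finset.prod_mul_prod_compl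
        (Finset.univ.image s), Finset.prod_image fun a _ b _ h => hs h, mul_comm]
    congr 1
    · refine Finset.prod_congr rfl fun t ht => ?_
      have : ¬ ∃ k, s k = t := by simpa using ht
      rw [hC, Function.extend_apply' _ _ _ this]
    · exact Finset.prod_congr rfl fun k _ => by rw [hCs]
  refine ⟨c, hc, ?_⟩
  have hfin : IsFiniteMeasure (c • cube xp xm N) :=
    ⟨by rw [Measure.smul_apply, smul_eq_mul]
        exact ENNReal.mul_lt_top hc.lt_top (measure_lt_top _ _)⟩
  refine MeasureTheory.ext_of_generate_finite _ generateFrom_pi.symm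
    (isPiSystem_pi (α := fun _ : Fin N => ℝ)) ?_ ?_
  · rintro _ ⟨S, hS, rfl⟩
    exact hbox S fun k => hS k (mem_univ k)
  · have := hbox (fun _ => univ) fun _ => MeasurableSet.univ
    simpa using this

/-! ### Integral operators attached to decreasing chains of points -/

open Classical in
/-- For `p₀ > p₁ > ⋯ > pₙ` this is
`∫_{p₁}^{p₀} dy₁ ⋯ ∫_{pₙ}^{pₙ₋₁} dyₙ exp (i μ (∑ₘ pₘ - ∑ₘ yₘ)) g(y₁, …, yₙ)`, and `0` if the `pₘ` are
not strictly decreasing (step operator). -/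
def chainIntegral (μ : ℂ) {n : ℕ} (p : Fin (n + 1) → ℝ) (g : (Fin n → ℝ) → ℂ) : ℂ :=
  if StrictAnti p then
    ∫ y in univ.pi (fun m : Fin n => Ioc (p m.succ) (p m.castSucc)),
      Complex.exp (Complex.I * μ * ((∑ m, p m : ℝ) - (∑ m, y m : ℝ))) * g y
  else 0

theorem isL2Operator_chain (xp xm : ℝ) (μ : ℂ) {M n N : ℕ} (p : (Fin M → ℝ) → Fin (n + 1) → ℝ)
    (hp : Measurable p)
    (hpJ : ∀ x : Fin M → ℝ, (∀ k, x k ∈ Icc xp xm) → ∀ m, p x m ∈ Icc xp xm)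
    (s : Fin N → Fin M ⊕ Fin n) (hs : Function.Injective s) :
    IsL2Operator (cube xp xm N) (cube xp xm M)
      (fun f x => chainIntegral μ (p x) (fun y => f (fun k => Sum.elim x y (s k)))) := by
  classical
  obtain ⟨c, hc, hmap⟩ := map_select xp xm s hs
  have hpm : ∀ m, Measurable fun z : (Fin M → ℝ) × (Fin n → ℝ) => p z.1 m := fun m =>
    ((measurable_pi_apply m).comp hp).comp measurable_fst
  have hym : ∀ m, Measurable fun z : (Fin M → ℝ) × (Fin n → ℝ) => z.2 m := fun m =>
    (measurable_pi_apply m).comp measurable_snd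
  have hmeas : Measurable (fun (z : (Fin M → ℝ) × (Fin n → ℝ)) (k : Fin N) =>
      Sum.elim z.1 z.2 (s k)) := by
    refine measurable_pi_lambda _ fun k => ?_
    rcases s k with j | j
    · exact (measurable_pi_apply j).comp measurable_fst
    · exact (measurable_pi_apply j).comp measurable_snd
  set D : Set ((Fin M → ℝ) × (Fin n → ℝ)) :=
    (⋂ m, {z | p z.1 m ∈ Icc xp xm}) ∩ ((⋂ a, ⋂ b, ⋂ _ : a < b, {z | p z.1 b < p z.1 a}) ∩
      ⋂ m : Fin n, {z | z.2 m ∈ Ioc (p z.1 m.succ) (p z.1 m.castSucc)}) with hD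
  have hDm : MeasurableSet D := by
    refine MeasurableSet.inter ?_ (MeasurableSet.inter ?_ ?_)
    · exact MeasurableSet.iInter fun m => (hpm m) measurableSet_Icc
    · exact MeasurableSet.iInter fun a => MeasurableSet.iInter fun b => MeasurableSet.iInter
        fun _ => measurableSet_lt (hpm b) (hpm a)
    · exact MeasurableSet.iInter fun m =>
        (measurableSet_lt (hpm _) (hym m)).inter (measurableSet_le (hym m) (hpm _))
  have hDmem : ∀ z, z ∈ D ↔ (∀ m, p z.1 m ∈ Icc xp xm) ∧
      (∀ a b, a < b → p z.1 b < p z.1 a) ∧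
      ∀ m : Fin n, z.2 m ∈ Ioc (p z.1 m.succ) (p z.1 m.castSucc) := by
    intro z
    simp only [hD, mem_inter_iff, mem_iInter]
    rfl
  set E : (Fin M → ℝ) × (Fin n → ℝ) → ℂ := fun z =>
    Complex.exp (Complex.I * μ * ((∑ m, p z.1 m : ℝ) - (∑ m, z.2 m : ℝ))) with hE
  have hEm : Measurable E := by
    refine Complex.measurable_exp.comp (Measurable.const_mul (Measurable.sub ?_ ?_) _)
    · exact Complex.measurable_ofReal.comp (Finset.measurable_sum _ fun m _ => hpm m)
    · exact Complex.measurable_ofReal.comp (Finset.measurable_sum _ fun m _ => hym m)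
  set R : ℝ := |xp| + |xm| with hR
  have hJR : ∀ t ∈ Icc xp xm, |t| ≤ R := by
    intro t ht
    rw [abs_le]
    have h1 := neg_abs_le xp
    have h2 := le_abs_self xm
    have h3 := abs_nonneg xp
    have h4 := abs_nonneg xm
    constructor <;> linarith [ht.1, ht.2]
  have hKC : ∀ z, ‖D.indicator E z‖ ≤ Real.exp (‖μ‖ * ((n + 1 : ℕ) * R + n * R)) := by
    intro z
    by_cases hz : z ∈ D
    · rw [indicator_of_mem hz, hE]
      rw [hDmem] at hz
      refine (Complex.norm_exp_le_exp_norm _).trans (Real.exp_le_exp.2 ?_)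
      rw [norm_mul, norm_mul, Complex.norm_I, one_mul]
      refine mul_le_mul_of_nonneg_left ?_ (norm_nonneg _)
      refine (norm_sub_le _ _).trans (add_le_add ?_ ?_)
      · rw [Complex.norm_real, Real.norm_eq_abs]
        refine (Finset.abs_sum_le_sum_abs _ _).trans ?_
        refine (Finset.sum_le_card_nsmul _ _ R fun m _ => hJR _ (hz.1 m)).trans ?_
        simp
      · rw [Complex.norm_real, Real.norm_eq_abs]
        refine (Finset.abs_sum_le_sum_abs _ _).trans ?_
        refine (Finset.sum_le_card_nsmul _ _ R fun m _ => hJR _ ?_).trans ?_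
        · exact ⟨(hz.1 _).1.trans (hz.2.2 m).1.le, (hz.2.2 m).2.trans (hz.1 _).2⟩
        · simp
    · rw [indicator_of_notMem hz, norm_zero]; exact (Real.exp_pos _).le
  refine (isL2Operator_kernel (μY := cube xp xm n) hmeas hc hmap
    (K := D.indicator E) (hEm.indicator hDm) hKC).of_ae_eq ?_
  intro f
  filter_upwards [cube_ae_mem xp xm M] with x hx
  have hpx := hpJ x hx
  unfold chainIntegral
  split_ifs with hanti
  · set B : Set (Fin n → ℝ) := univ.pi (fun m : Fin n => Ioc (p x m.succ) (p x m.castSucc))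
      with hB
    have hBm : MeasurableSet B := MeasurableSet.univ_pi fun _ => measurableSet_Ioc
    have hsub : B ⊆ univ.pi fun _ => Icc xp xm := fun y hy m _ =>
      ⟨(hpx _).1.trans (hy m (mem_univ m)).1.le, (hy m (mem_univ m)).2.trans (hpx _).2⟩
    have hind : (fun y => D.indicator E (x, y) * f (fun k => Sum.elim x y (s k))) =
        B.indicator (fun y => E (x, y) * f (fun k => Sum.elim x y (s k))) := by
      ext y
      have hiff : (x, y) ∈ D ↔ y ∈ B := by
        rw [hDmem]
        simp only [hB, Set.mem_pi, mem_univ, true_imp_iff]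
        exact ⟨fun h => h.2.2, fun h => ⟨hpx, fun a b hab => hanti hab, h⟩⟩
      by_cases hy : y ∈ B
      · rw [indicator_of_mem hy, indicator_of_mem (hiff.2 hy)]
      · rw [indicator_of_notMem hy, indicator_of_notMem (fun h => hy (hiff.1 h)), zero_mul]
    rw [hind, integral_indicator hBm, cube, Measure.restrict_restrict hBm,
      inter_eq_self_of_subset_left hsub]
  · have : ∀ y, (x, y) ∉ D := fun y hy => hanti fun a b hab => ((hDmem _).1 hy).2.1 a b hab
    simp [indicator_of_notMem (this _)]

/-! ### The operators `b`, `a`, `c` -/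

/-- The two signs `ε = ±`. -/
inductive Sgn
  | plus
  | minus

/-- The sign as a complex number `±1`. -/
def Sgn.val : Sgn → ℂ
  | .plus => 1
  | .minus => -1

/-- The end point `x^ε` of `J = [x⁺, x⁻] = [xp, xm]`. -/
def Sgn.endpoint (xp xm : ℝ) : Sgn → ℝ
  | .plus => xp
  | .minus => xm

/-- `(t, x)` for `ε = +` and `(x, t)` for `ε = -`. -/
def adjoin {N : ℕ} : Sgn → ℝ → (Fin N → ℝ) → (Fin (N + 1) → ℝ)
  | .plus, t, x => Fin.cons t x
  | .minus, t, x => Fin.snoc x t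

/-- The elementary creation operators: functions of `N` variables to functions of `N + 1` variables,
for an `n`-tuple `i` of distinct labels. `Function.extend i y z` is `z` with `zᵢₘ` replaced by `yₘ`.
-/
def creationElem (μ : ℂ) {n N : ℕ} (i : Fin n ↪ Fin N) :
    Sgn → ((Fin N → ℝ) → ℂ) → (Fin (N + 1) → ℝ) → ℂ
  | .plus, f, x =>
      chainIntegral μ (Fin.snoc (fun m => x (i m).succ) (x 0) : Fin (n + 1) → ℝ)
        (fun y => f (Function.extend i y (fun k => x k.succ)))
  | .minus, f, x =>
      chainIntegral μ (Fin.cons (x (Fin.last N)) (fun m => x (i m).castSucc) : Fin (n + 1) → ℝ)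
        (fun y => f (Function.extend i y (fun k => x k.castSucc)))

/-- The non-symmetric creation operator `b^ε_μ` on functions. -/
def creation (γ : ℝ) (μ : ℂ) (ε : Sgn) {N : ℕ} (f : (Fin N → ℝ) → ℂ) (x : Fin (N + 1) → ℝ) : ℂ :=
  ∑ n ∈ Finset.range (N + 1), (γ : ℂ) ^ n * ∑ i : Fin n ↪ Fin N, creationElem μ i ε f x

/-- The operator `a^ε_μ` on functions: `b^ε_μ` followed by setting the new variable equal to the
end point `x^ε` of `J`. -/
def preserving (xp xm γ : ℝ) (μ : ℂ) (ε : Sgn) {N : ℕ} (f : (Fin N → ℝ) → ℂ)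
    (x : Fin N → ℝ) : ℂ :=
  creation γ μ ε f (adjoin ε (ε.endpoint xp xm) x)

/-- The elementary annihilation operators: functions of `N + 1` variables to functions of `N`
variables; the chain is `x⁻ > xᵢ₁ > ⋯ > xᵢₙ > x⁺`. -/
def annihilationElem (xp xm : ℝ) (μ : ℂ) {n N : ℕ} (i : Fin n ↪ Fin N) :
    Sgn → ((Fin (N + 1) → ℝ) → ℂ) → (Fin N → ℝ) → ℂ
  | .plus, f, x =>
      chainIntegral μ (Fin.cons xm (Fin.snoc (fun m => x (i m)) xp : Fin (n + 1) → ℝ) :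
          Fin (n + 2) → ℝ)
        (fun y => f (adjoin .minus (y 0) (Function.extend i (fun m => y m.succ) x)))
  | .minus, f, x =>
      chainIntegral μ (Fin.cons xm (Fin.snoc (fun m => x (i m)) xp : Fin (n + 1) → ℝ) :
          Fin (n + 2) → ℝ)
        (fun y => f (adjoin .plus (y (Fin.last n)) (Function.extend i (fun m => y m.castSucc) x)))

/-- The operator `c^ε_μ` on functions. -/
def annihilation (xp xm γ : ℝ) (μ : ℂ) (ε : Sgn) {N : ℕ} (f : (Fin (N + 1) → ℝ) → ℂ)
    (x : Fin N → ℝ) : ℂ :=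
  ∑ n ∈ Finset.range (N + 1), (γ : ℂ) ^ (n + 1) *
    ∑ i : Fin n ↪ Fin N, annihilationElem xp xm μ i ε f x

theorem exists_select {n N M : ℕ} (i : Fin n ↪ Fin N) (e : Fin N → Fin M)
    (he : Function.Injective e) : ∃ s : Fin N → Fin M ⊕ Fin n, Function.Injective s ∧
      ∀ (x : Fin M → ℝ) (y : Fin n → ℝ) (k : Fin N),
        Function.extend i y (fun k => x (e k)) k = Sum.elim x y (s k) := by
  classical
  refine ⟨fun k => Function.extend i (fun m => Sum.inr m) (fun k => Sum.inl (e k)) k, ?_, ?_⟩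
  · intro k l hkl
    simp only at hkl
    by_cases hk : ∃ m, i m = k <;> by_cases hl : ∃ m, i m = l
    · obtain ⟨m, rfl⟩ := hk
      obtain ⟨m', rfl⟩ := hl
      rw [i.injective.extend_apply, i.injective.extend_apply] at hkl
      rw [Sum.inr.inj hkl]
    · obtain ⟨m, rfl⟩ := hk
      rw [i.injective.extend_apply, Function.extend_apply' _ _ _ hl] at hkl
      exact absurd hkl (by simp)
    · obtain ⟨m, rfl⟩ := hl
      rw [i.injective.extend_apply, Function.extend_apply' _ _ _ hk] at hkl
      exact absurd hkl (by simp)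
    · rw [Function.extend_apply' _ _ _ hk, Function.extend_apply' _ _ _ hl] at hkl
      exact he (Sum.inl.inj hkl)
  · intro x y k
    by_cases hk : ∃ m, i m = k
    · obtain ⟨m, rfl⟩ := hk
      simp [i.injective.extend_apply]
    · simp [Function.extend_apply' _ _ _ hk]

theorem isL2Operator_creation (xp xm γ : ℝ) (μ : ℂ) (ε : Sgn) (N : ℕ) :
    IsL2Operator (cube xp xm N) (cube xp xm (N + 1)) (creation γ μ ε (N := N)) := by
  unfold creation
  refine IsL2Operator.sum _ fun n _ => IsL2Operator.const_mul (IsL2Operator.sum _ fun i _ => ?_) _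
  cases ε
  · obtain ⟨s, hs, hsel⟩ := exists_select i Fin.succ (Fin.succ_injective N)
    have := isL2Operator_chain xp xm μ
      (fun x : Fin (N + 1) → ℝ => (Fin.snoc (fun m => x (i m).succ) (x 0) : Fin (n + 1) → ℝ))
      (by
        refine measurable_pi_lambda _ fun m => ?_
        refine Fin.lastCases ?_ (fun m => ?_) m
        · simpa using measurable_pi_apply _
        · simpa using measurable_pi_apply _)
      (by
        intro x hx m
        refine Fin.lastCases ?_ (fun m => ?_) m
        · simpa using hx 0
        · simpa using hx _) s hs
    simp only [← hsel] at this
    exact this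
  · obtain ⟨s, hs, hsel⟩ := exists_select i Fin.castSucc (Fin.castSucc_injective N)
    have := isL2Operator_chain xp xm μ
      (fun x : Fin (N + 1) → ℝ =>
        (Fin.cons (x (Fin.last N)) (fun m => x (i m).castSucc) : Fin (n + 1) → ℝ))
      (by
        refine measurable_pi_lambda _ fun m => ?_
        refine Fin.cases ?_ (fun m => ?_) m
        · simpa using measurable_pi_apply _
        · simpa using measurable_pi_apply _)
      (by
        intro x hx m
        refine Fin.cases ?_ (fun m => ?_) m
        · simpa using hx (Fin.last N)
        · simpa using hx _) s hs
    simp only [← hsel] at this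
    exact this

theorem isL2Operator_preserving {xp xm : ℝ} (hJ : xp < xm) (γ : ℝ) (μ : ℂ) (ε : Sgn) (N : ℕ) :
    IsL2Operator (cube xp xm N) (cube xp xm N) (preserving xp xm γ μ ε (N := N)) := by
  unfold preserving creation
  refine IsL2Operator.sum _ fun n _ => IsL2Operator.const_mul (IsL2Operator.sum _ fun i _ => ?_) _
  obtain ⟨s, hs, hsel⟩ := exists_select i id Function.injective_id
  simp only [id] at hsel
  cases ε
  · have := isL2Operator_chain xp xm μ
      (fun x : Fin N → ℝ => (Fin.snoc (fun m => x (i m)) xp : Fin (n + 1) → ℝ))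
      (by
        refine measurable_pi_lambda _ fun m => ?_
        refine Fin.lastCases ?_ (fun m => ?_) m
        · simp
        · simpa using measurable_pi_apply _)
      (by
        intro x hx m
        refine Fin.lastCases ?_ (fun m => ?_) m
        · simpa using hJ.le
        · simpa using hx _) s hs
    simp only [← hsel] at this
    simpa [creationElem, adjoin, Sgn.endpoint] using this
  · have := isL2Operator_chain xp xm μ
      (fun x : Fin N → ℝ => (Fin.cons xm (fun m => x (i m)) : Fin (n + 1) → ℝ))
      (by
        refine measurable_pi_lambda _ fun m => ?_
        refine Fin.cases ?_ (fun m => ?_) m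
        · simp
        · simpa using measurable_pi_apply _)
      (by
        intro x hx m
        refine Fin.cases ?_ (fun m => ?_) m
        · simpa using hJ.le
        · simpa using hx _) s hs
    simp only [← hsel] at this
    simpa [creationElem, adjoin, Sgn.endpoint] using this

theorem isL2Operator_annihilation {xp xm : ℝ} (hJ : xp < xm) (γ : ℝ) (μ : ℂ) (ε : Sgn) (N : ℕ) :
    IsL2Operator (cube xp xm (N + 1)) (cube xp xm N) (annihilation xp xm γ μ ε (N := N)) := by
  unfold annihilation
  refine IsL2Operator.sum _ fun n _ => IsL2Operator.const_mul (IsL2Operator.sum _ fun i _ => ?_) _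
  obtain ⟨s, hs, hsel⟩ := exists_select i id Function.injective_id
  simp only [id] at hsel
  have hm : Measurable (fun x : Fin N → ℝ =>
      (Fin.cons xm (Fin.snoc (fun m => x (i m)) xp : Fin (n + 1) → ℝ) : Fin (n + 2) → ℝ)) := by
    refine measurable_pi_lambda _ fun m => ?_
    refine Fin.cases ?_ (fun m => ?_) m
    · simp
    · refine Fin.lastCases ?_ (fun m => ?_) m
      · simp
      · simpa using measurable_pi_apply _
  have hmem : ∀ x : Fin N → ℝ, (∀ k, x k ∈ Icc xp xm) → ∀ m,
      (Fin.cons xm (Fin.snoc (fun m => x (i m)) xp : Fin (n + 1) → ℝ) : Fin (n + 2) → ℝ) m ∈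
        Icc xp xm := by
    intro x hx m
    refine Fin.cases ?_ (fun m => ?_) m
    · simpa using hJ.le
    · refine Fin.lastCases ?_ (fun m => ?_) m
      · simpa using hJ.le
      · simpa using hx _
  have hrw : ∀ (g : Fin n → Fin (n + 1)) (k : Fin N) (x : Fin N → ℝ) (y : Fin (n + 1) → ℝ),
      Sum.elim x y (Sum.map id g (s k)) = Function.extend i (fun m => y (g m)) x k := by
    intro g k x y
    rw [hsel]
    rcases s k with j | j <;> simp
  cases ε
  · have := isL2Operator_chain xp xm μ _ hm hmem
      (Fin.snoc (α := fun _ => Fin N ⊕ Fin (n + 1))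
        (fun k => Sum.map id Fin.succ (s k)) (Sum.inr 0))
      (by
        rw [Fin.snoc_injective_iff]
        refine ⟨fun a b hab => hs ?_, ?_⟩
        · exact (Function.injective_id.sumMap (Fin.succ_injective n)) hab
        · rintro ⟨k, hk⟩
          rcases hsk : s k with j | j <;> simp [hsk] at hk)
    refine this.of_ae_eq fun f => ?_
    filter_upwards with x
    simp only [annihilationElem, adjoin]
    congr 1
    ext y
    congr 1
    ext k
    refine Fin.lastCases ?_ (fun k => ?_) k
    · simp
    · simp [hrw]
  · have := isL2Operator_chain xp xm μ _ hm hmem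
      (Fin.cons (α := fun _ => Fin N ⊕ Fin (n + 1)) (Sum.inr (Fin.last n))
        (fun k => Sum.map id Fin.castSucc (s k)))
      (by
        rw [Fin.cons_injective_iff]
        refine ⟨?_, fun a b hab => hs ?_⟩
        · rintro ⟨k, hk⟩
          rcases hsk : s k with j | j <;> simp [hsk, Fin.ext_iff] at hk
          omega
        · exact (Function.injective_id.sumMap (Fin.castSucc_injective n)) hab)
    refine this.of_ae_eq fun f => ?_
    filter_upwards with x
    simp only [annihilationElem, adjoin]
    congr 1
    ext y
    congr 1
    ext k
    refine Fin.cases ?_ (fun k => ?_) k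
    · simp
    · simp [hrw]

/-- `b^ε_μ : L²(J^N) → L²(J^(N+1))`. -/
def bOp (xp xm γ : ℝ) (N : ℕ) (ε : Sgn) (μ : ℂ) : H xp xm N →L[ℂ] H xp xm (N + 1) :=
  (isL2Operator_creation xp xm γ μ ε N).toCLM

/-- `a^ε_μ : L²(J^N) → L²(J^N)`. -/
def aOp {xp xm : ℝ} (hJ : xp < xm) (γ : ℝ) (N : ℕ) (ε : Sgn) (μ : ℂ) :
    H xp xm N →L[ℂ] H xp xm N :=
  (isL2Operator_preserving hJ γ μ ε N).toCLM

/-- `c^ε_μ : L²(J^(N+1)) → L²(J^N)`. -/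
def cOp {xp xm : ℝ} (hJ : xp < xm) (γ : ℝ) (N : ℕ) (ε : Sgn) (μ : ℂ) :
    H xp xm (N + 1) →L[ℂ] H xp xm N :=
  (isL2Operator_annihilation hJ γ μ ε N).toCLM

/-! ### The propagation operator and the non-symmetric wavefunctions -/

/-- Pairs `(j, j + 1)`, the labels of the simple transpositions `s_j`. -/
abbrev AdjPair (N : ℕ) : Type := {p : Fin N × Fin N // (p.1 : ℕ) + 1 = p.2}

/-- The simple transposition `s_j`. -/
def AdjPair.swap {N : ℕ} (p : AdjPair N) : Equiv.Perm (Fin N) := Equiv.swap p.1.1 p.1.2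

/-- The integral-reflection operator `s_j^γ = s_j + γ I_{j,j+1}`, where
`(I_{j,k} f)(x) = ∫_0^{x_j - x_k} f(x - y (e_j - e_k)) dy`. -/
def integralReflection (γ : ℝ) {N : ℕ} (p : AdjPair N) (f : (Fin N → ℝ) → ℂ) (x : Fin N → ℝ) : ℂ :=
  f (x ∘ p.swap) + γ * ∫ y in (0 : ℝ)..(x p.1.1 - x p.1.2),
    f (x - y • (Pi.single p.1.1 1 - Pi.single p.1.2 1))

theorem exists_word {N : ℕ} (w : Equiv.Perm (Fin N)) :
    ∃ l : List (AdjPair N), (l.map AdjPair.swap).prod = w := by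
  cases N with
  | zero => exact ⟨[], Subsingleton.elim _ _⟩
  | succ n =>
    have hw : w ∈ Submonoid.closure (Set.range fun i : Fin n => Equiv.swap i.castSucc i.succ) := by
      rw [Equiv.Perm.mclosure_swap_castSucc_succ]; trivial
    obtain ⟨l, hl, rfl⟩ := Submonoid.exists_list_of_mem_closure hw
    clear hw
    induction l with
    | nil => exact ⟨[], rfl⟩
    | cons a l ih =>
      obtain ⟨l', hl'⟩ := ih fun y hy => hl y (List.mem_cons_of_mem _ hy)
      obtain ⟨i, rfl⟩ := hl a List.mem_cons_self
      exact ⟨⟨(i.castSucc, i.succ), by simp⟩ :: l', by simp [hl', AdjPair.swap]⟩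

/-- A decomposition `w = s_{i₁} ⋯ s_{iₗ}` of a permutation into simple transpositions. -/
def word {N : ℕ} (w : Equiv.Perm (Fin N)) : List (AdjPair N) := (exists_word w).choose

/-- The operator `w^γ = s_{i₁}^γ ⋯ s_{iₗ}^γ`, for a decomposition `w = s_{i₁} ⋯ s_{iₗ}`; on continuous
functions it does not depend on the decomposition. -/
def permGamma (γ : ℝ) {N : ℕ} (w : Equiv.Perm (Fin N)) (f : (Fin N → ℝ) → ℂ) : (Fin N → ℝ) → ℂ :=
  (word w).foldr (fun p g => integralReflection γ p g) f

/-- The propagation operator: `P^γ f = w⁻¹ w^γ f`, that is `(P^γ f)(x) = (w^γ f)(w x)`, where `w` is a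
permutation for which `w x = x ∘ w⁻¹` is decreasing (for regular `x` it is unique). -/
def propagation (γ : ℝ) {N : ℕ} (f : (Fin N → ℝ) → ℂ) (x : Fin N → ℝ) : ℂ :=
  permGamma γ (Tuple.sort fun j => -x j)⁻¹ f (x ∘ Tuple.sort fun j => -x j)

/-- The plane wave `exp (i ⟨lam, x⟩)`. -/
def planeWave {N : ℕ} (lam : Fin N → ℂ) (x : Fin N → ℝ) : ℂ :=
  Complex.exp (Complex.I * ∑ j, lam j * x j)

/-- The non-symmetric wavefunction `ψ_lam`. -/
def psi (γ : ℝ) {N : ℕ} (lam : Fin N → ℂ) : (Fin N → ℝ) → ℂ :=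
  propagation γ (planeWave lam)

theorem continuous_integralReflection (γ : ℝ) {N : ℕ} (p : AdjPair N) {f : (Fin N → ℝ) → ℂ}
    (hf : Continuous f) : Continuous (integralReflection γ p f) := by
  unfold integralReflection
  refine Continuous.add ?_ (continuous_const.mul ?_)
  · exact hf.comp (continuous_pi fun k => continuous_apply _)
  · refine intervalIntegral.continuous_parametric_intervalIntegral_of_continuous ?_ ?_
    · refine hf.comp ?_
      fun_prop
    · fun_prop

theorem continuous_permGamma (γ : ℝ) {N : ℕ} (w : Equiv.Perm (Fin N)) {f : (Fin N → ℝ) → ℂ}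
    (hf : Continuous f) : Continuous (permGamma γ w f) := by
  unfold permGamma
  induction word w with
  | nil => exact hf
  | cons p l ih => exact continuous_integralReflection γ p ih

theorem continuous_planeWave {N : ℕ} (lam : Fin N → ℂ) : Continuous (planeWave lam) := by
  unfold planeWave
  fun_prop

theorem memLp_psi (xp xm γ : ℝ) {N : ℕ} (lam : Fin N → ℂ) :
    MemLp (psi γ lam) 2 (cube xp xm N) := by
  set F : Equiv.Perm (Fin N) → (Fin N → ℝ) → ℂ := fun σ x =>
    permGamma γ σ⁻¹ (planeWave lam) (x ∘ σ) with hF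
  have hFc : ∀ σ, Continuous (F σ) := fun σ =>
    (continuous_permGamma γ σ⁻¹ (continuous_planeWave lam)).comp
      (continuous_pi fun k => continuous_apply _)
  have hset : ∀ σ : Equiv.Perm (Fin N),
      MeasurableSet {x : Fin N → ℝ | σ = Tuple.sort fun j => -x j} := by
    intro σ
    have : {x : Fin N → ℝ | σ = Tuple.sort fun j => -x j} =
        (⋂ a, ⋂ b, ⋂ _ : a ≤ b, {x | -x (σ a) ≤ -x (σ b)}) ∩
          ⋂ i, ⋂ j, ⋂ _ : i < j, {x | -x (σ i) = -x (σ j) → σ i < σ j} := by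
      ext x
      simp only [mem_inter_iff, mem_iInter]
      exact Tuple.eq_sort_iff
    rw [this]
    refine MeasurableSet.inter ?_ ?_
    · exact MeasurableSet.iInter fun a => MeasurableSet.iInter fun b => MeasurableSet.iInter
        fun _ => measurableSet_le (by fun_prop) (by fun_prop)
    · refine MeasurableSet.iInter fun a => MeasurableSet.iInter fun b => MeasurableSet.iInter
        fun _ => ?_
      by_cases h : σ a < σ b
      · simp [h]
      · have : {x : Fin N → ℝ | -x (σ a) = -x (σ b) → σ a < σ b} =
            {x : Fin N → ℝ | -x (σ a) = -x (σ b)}ᶜ := by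
          ext x; simp [h]
        rw [this]
        exact (measurableSet_eq_fun (by fun_prop) (by fun_prop)).compl
  have hpsi : psi γ lam = fun x => ∑ σ : Equiv.Perm (Fin N),
      {x : Fin N → ℝ | σ = Tuple.sort fun j => -x j}.indicator (F σ) x := by
    ext x
    rw [Finset.sum_eq_single (Tuple.sort fun j => -x j)]
    · have hx : x ∈ {y : Fin N → ℝ | (Tuple.sort fun j => -x j) = Tuple.sort fun j => -y j} := rfl
      rw [indicator_of_mem hx]; rfl
    · intro σ _ hσ
      exact indicator_of_notMem (s := {x : Fin N → ℝ | σ = Tuple.sort fun j => -x j})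
        (by simpa using hσ) _
    · simp
  rw [hpsi]
  refine memLp_finsetSum _ fun σ _ => MemLp.indicator (hset σ) ?_
  obtain ⟨C, hC⟩ := (isCompact_univ_pi fun _ : Fin N => isCompact_Icc (a := xp) (b := xm)
    ).exists_bound_of_continuousOn (hFc σ).continuousOn
  refine MemLp.of_bound (hFc σ).aestronglyMeasurable C ?_
  filter_upwards [cube_ae_mem xp xm N] with x hx
  exact hC x fun k _ => hx k

/-- The restriction of `ψ_lam` to `J^N`, as an element of `L²(J^N)`. -/
def psiL2 (xp xm γ : ℝ) {N : ℕ} (lam : Fin N → ℂ) : H xp xm N :=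
  (memLp_psi xp xm γ lam).toLp (psi γ lam)

/-- The closure in `L²(J^N)` of the span of the `ψ_lam|_{J^N}`, `lam ∈ ℂ^N`. -/
def zbar (xp xm γ : ℝ) (N : ℕ) : Submodule ℂ (H xp xm N) :=
  (Submodule.span ℂ (Set.range fun lam : Fin N → ℂ => psiL2 xp xm γ lam)).topologicalClosure

end QNLS

end

/-! For continuous $f$ let $Pf$ be its propagation, $(Pf)(x)=(w^\gamma f)(wx)$ with $wx$ decreasing.
At points with distinct coordinates $P$ turns the deformed action into the ordinary one, $P(v^\gamma
f)(x)=(Pf)(x\circ v)$ (`propagation_reflHom`). The wavefunctions are the images of plane waves under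
$P$. Each of the operators $b,a,c$ has a counterpart on continuous functions which $P$ intertwines
with it, and the relations are proved for these counterparts.

Let $\epsilon=+$. The counterpart of $b_\mu$ is $(B_\mu g)(t,x)=e^{i\mu t}g(x)$
(`creation_propagation`). Both $F=b_\mu Pg$ and $F=P(B_\mu g)$ satisfy $F(t,x)=e^{i\mu
t}\bigl(Pg(x)+\gamma\sum_{x_k>t}\int_t^{x_k}e^{-i\mu y}F(x_k,x[k\to y])\,dy\bigr)$. On the right
fewer coordinates exceed the first one, so induction on their number gives uniqueness. For $b_\mu$
the equation results from splitting off the last integral of each chain. For $P(B_\mu g)$ it results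
from differentiating in $t$ with the commutation rule
$\partial_{j+1}s_j^\gamma=s_j^\gamma\partial_j-\gamma$ (`HasPartial.reflOp`).

At $t=x^+$ the new variable is the smallest one, and a cycle moves it to the last place; hence the
counterpart of $a_\mu$ is $A_\mu$: apply $B_\mu$, then the deformed cycle, then evaluate the last
variable at $x^+$. Computing $b_\mu f$ at $(x^+,x,x^-)$ in two ways identifies the counterpart of
$c_\mu$ as the commutator of $A_\mu$ with the operator that evaluates the last variable at $x^-$
(`annihilation_propagation_ae`).

All coefficients come from the two-term formula for $s_1^\gamma B_\mu B_\nu$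
(`reflOp_createOp_createOp`). It gives the relation of $a$ and $b$ at once, since the cycle on $N+2$
variables contains $s_1$ as a factor. The relation of $c$ and $a$ needs in addition the classical
Yang-Baxter equation $I_{jk}I_{kl}=I_{jl}I_{jk}+I_{kl}I_{jl}$. The same equation gives the braid
relations for the $s_j^\gamma$, so that $w\mapsto w^\gamma$ is a homomorphism.

The case $\epsilon=-$ follows by the reflection $x\mapsto(-x_N,\dots,-x_1)$, which replaces $\mu$ by
$-\mu$ and $J$ by $-J$. Every $Pg$ lies in $\bar{\mathfrak z}$ by Stone-Weierstrass and a sup-norm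
bound for $P$ (`propL2_mem_zbar`). For $\mu=\nu$ the operators $b_\kappa$ and $a_\kappa$ are
strongly continuous in $\kappa$, so the relations for $\kappa\ne\mu$ pass to the limit. -/

noncomputable section

namespace QNLS

/-! ### The symmetric group as a Coxeter group -/

section Coxeter

variable {M : Type*} [Monoid M]

/-- The product `σₖ σₖ₊₁ ⋯ σₖ₊ₘ₋₁`. -/
def ascProd (σ : ℕ → M) : ℕ → ℕ → M
  | _, 0 => 1
  | k, m + 1 => σ k * ascProd σ (k + 1) m

/-- The Coxeter relations of type `A` for `σ₀, …, σₙ₋₁`. -/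
structure IsCoxeterA (σ : ℕ → M) (n : ℕ) : Prop where
  sq : ∀ i < n, σ i * σ i = 1
  braid : ∀ i, i + 1 < n → σ i * σ (i + 1) * σ i = σ (i + 1) * σ i * σ (i + 1)
  comm : ∀ i j, i + 1 < j → j < n → σ i * σ j = σ j * σ i

theorem IsCoxeterA.mono {σ : ℕ → M} {n m : ℕ} (h : IsCoxeterA σ n) (hm : m ≤ n) :
    IsCoxeterA σ m where
  sq i hi := h.sq i (hi.trans_le hm)
  braid i hi := h.braid i (hi.trans_le hm)
  comm i j hij hj := h.comm i j hij (hj.trans_le hm)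

theorem IsCoxeterA.comm_ascProd {σ : ℕ → M} {n : ℕ} (h : IsCoxeterA σ n) {j : ℕ} :
    ∀ {k m : ℕ}, j + 1 < k → k + m ≤ n → σ j * ascProd σ k m = ascProd σ k m * σ j
  | _, 0, _, _ => by simp [ascProd]
  | k, m + 1, hj, hk => by
    have ih := h.comm_ascProd (j := j) (k := k + 1) (m := m) (by omega) (by omega)
    rw [ascProd, ← mul_assoc, h.comm j k hj (by omega), mul_assoc, ih, mul_assoc]

/-- Far commutation brings $\sigma_{j+1}$ up to the factors $\sigma_j\sigma_{j+1}$; there the braid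
relation turns it into $\sigma_j$, which commutes with all later factors. -/
theorem IsCoxeterA.shift_ascProd {σ : ℕ → M} {n : ℕ} (h : IsCoxeterA σ n) {j : ℕ} :
    ∀ {k m : ℕ}, k ≤ j → j + 1 < k + m → k + m ≤ n →
      σ (j + 1) * ascProd σ k m = ascProd σ k m * σ j
  | _, 0, _, _, _ => by omega
  | _, 1, _, _, _ => by omega
  | k, m + 2, hkj, hj, hk => by
    rcases hkj.eq_or_lt with rfl | hlt
    · have ih := h.comm_ascProd (j := k) (k := k + 1 + 1) (m := m) (by omega) (by omega)
      rw [ascProd, ascProd]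
      calc σ (k + 1) * (σ k * (σ (k + 1) * ascProd σ (k + 1 + 1) m))
          = σ (k + 1) * σ k * σ (k + 1) * ascProd σ (k + 1 + 1) m := by simp only [mul_assoc]
        _ = σ k * σ (k + 1) * (σ k * ascProd σ (k + 1 + 1) m) := by
            rw [← h.braid k (by omega)]; simp only [mul_assoc]
        _ = _ := by rw [ih]; simp only [mul_assoc]
    · have ih := h.shift_ascProd (j := j) (k := k + 1) (m := m + 1) (by omega) (by omega) (by omega)
      rw [ascProd, ← mul_assoc, ← h.comm k (j + 1) (by omega) (by omega), mul_assoc, ih, mul_assoc]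

/-- The products $\sigma_k\cdots\sigma_n$ play the role of coset representatives of the subgroup
generated by $\sigma_0,\dots,\sigma_{n-1}$, with $k=n+1$, $m=0$ for the trivial coset. Left
multiplication by $\sigma_j$ commutes past the representative ($j<k-1$), lengthens it ($j=k-1$),
shortens it ($j=k$), or passes through as $\sigma_{j-1}$ ($j>k$). -/
theorem IsCoxeterA.exists_normalForm {σ : ℕ → M} {n : ℕ} (h : IsCoxeterA σ (n + 1))
    (l : List ℕ) (hl : ∀ i ∈ l, i < n + 1) :
    ∃ k m : ℕ, k + m = n + 1 ∧ ∃ l' : List ℕ, (∀ i ∈ l', i < n) ∧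
      (l.map σ).prod = ascProd σ k m * (l'.map σ).prod := by
  induction l with
  | nil => exact ⟨n + 1, 0, rfl, [], by simp, by simp [ascProd]⟩
  | cons j l ih =>
    obtain ⟨k, m, hkm, l', hl', heq⟩ := ih fun i hi => hl i (List.mem_cons_of_mem _ hi)
    have hj := hl j List.mem_cons_self
    rw [List.map_cons, List.prod_cons, heq, ← mul_assoc]
    rcases lt_trichotomy j k with hjk | rfl | hjk
    · rcases (Nat.succ_le_of_lt hjk).eq_or_lt with rfl | hlt
      · exact ⟨j, m + 1, by omega, l', hl', rfl⟩
      · refine ⟨k, m, hkm, j :: l', ?_, ?_⟩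
        · intro i hi
          rcases List.mem_cons.1 hi with rfl | hi
          · omega
          · exact hl' i hi
        · rw [h.comm_ascProd hlt (by omega), List.map_cons, List.prod_cons, mul_assoc]
    · obtain ⟨m, rfl⟩ : ∃ m', m = m' + 1 := ⟨m - 1, by omega⟩
      refine ⟨j + 1, m, by omega, l', hl', ?_⟩
      rw [ascProd, ← mul_assoc (σ j), h.sq j hj, one_mul]
    · obtain ⟨j, rfl⟩ : ∃ j', j = j' + 1 := ⟨j - 1, by omega⟩
      refine ⟨k, m, hkm, j :: l', ?_, ?_⟩
      · intro i hi
        rcases List.mem_cons.1 hi with rfl | hi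
        · omega
        · exact hl' i hi
      · rw [h.shift_ascProd (by omega) (by omega) (by omega), List.map_cons, List.prod_cons,
          mul_assoc]

/-- The simple transposition of `i` and `i + 1` in the group of permutations of `ℕ`. -/
def natSwap (i : ℕ) : Equiv.Perm ℕ := Equiv.swap i (i + 1)

theorem natSwap_apply (i x : ℕ) :
    natSwap i x = if x = i then i + 1 else if x = i + 1 then i else x :=
  Equiv.swap_apply_def _ _ _

theorem isCoxeterA_natSwap (n : ℕ) : IsCoxeterA natSwap n where
  sq i _ := Equiv.swap_mul_self _ _
  braid i _ := by
    ext x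
    simp only [Equiv.Perm.mul_apply, natSwap_apply]
    split_ifs <;> omega
  comm i j _ _ := by
    ext x
    simp only [Equiv.Perm.mul_apply, natSwap_apply]
    split_ifs <;> omega

/-- The coset representative can thus be read off from the image of the largest point. -/
theorem ascProd_natSwap : ∀ k m : ℕ, ascProd natSwap k m (k + m) = k
  | k, 0 => rfl
  | k, m + 1 => by
    have ih := ascProd_natSwap (k + 1) m
    rw [ascProd, Equiv.Perm.mul_apply, show k + (m + 1) = k + 1 + m by ring, ih, natSwap_apply]
    simp

theorem ascProd_prodMk {M' : Type*} [Monoid M'] (σ : ℕ → M) (τ : ℕ → M') (k m : ℕ) :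
    ascProd (fun i => (τ i, σ i)) k m = (ascProd τ k m, ascProd σ k m) := by
  induction m generalizing k with
  | zero => rfl
  | succ m ih => simp only [ascProd, ih, Prod.mk_mul_mk]

theorem prod_map_prodMk {M' : Type*} [Monoid M'] (σ : ℕ → M) (τ : ℕ → M') (l : List ℕ) :
    (l.map fun i => (τ i, σ i)).prod = ((l.map τ).prod, (l.map σ).prod) := by
  induction l with
  | nil => rfl
  | cons a l ih => simp [ih]

theorem prod_natSwap_apply_of_lt (l : List ℕ) {n x : ℕ} (hl : ∀ i ∈ l, i < n) (hx : n < x) :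
    (l.map natSwap).prod x = x := by
  induction l with
  | nil => rfl
  | cons a l ih =>
    have ha := hl a List.mem_cons_self
    rw [List.map_cons, List.prod_cons, Equiv.Perm.mul_apply,
      ih fun i hi => hl i (List.mem_cons_of_mem _ hi), natSwap_apply]
    split_ifs <;> omega

/-- By induction on the number of generators. If the permutation is trivial, it fixes $n+1$; this
forces the trivial coset in the normal form, and a word in fewer generators is left. -/
theorem IsCoxeterA.prod_eq_one {σ : ℕ → M} {n : ℕ} (h : IsCoxeterA σ n) (l : List ℕ)
    (hl : ∀ i ∈ l, i < n) (h1 : (l.map natSwap).prod = 1) : (l.map σ).prod = 1 := by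
  induction n generalizing l with
  | zero =>
    cases l with
    | nil => rfl
    | cons a l => exact absurd (hl a List.mem_cons_self) (by omega)
  | succ n ih =>
    -- Working in the product monoid makes one normal form valid for the permutation and for the
    -- product in `M` simultaneously.
    have hprod : IsCoxeterA (fun i => (natSwap i, σ i)) (n + 1) :=
      { sq := fun i hi => Prod.ext ((isCoxeterA_natSwap _).sq i hi) (h.sq i hi)
        braid := fun i hi => Prod.ext ((isCoxeterA_natSwap _).braid i hi) (h.braid i hi)
        comm := fun i j hi hj =>
          Prod.ext ((isCoxeterA_natSwap _).comm i j hi hj) (h.comm i j hi hj) }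
    obtain ⟨k, m, hkm, l', hl', heq⟩ := hprod.exists_normalForm l hl
    rw [prod_map_prodMk, prod_map_prodMk, ascProd_prodMk, Prod.mk_mul_mk, Prod.mk.injEq] at heq
    have hk : k = n + 1 := by
      have := congrArg (fun π : Equiv.Perm ℕ => π (n + 1)) (heq.1.symm.trans h1)
      simp only [Equiv.Perm.mul_apply, Equiv.Perm.one_apply] at this
      have e := ascProd_natSwap k m
      rw [hkm] at e
      rwa [prod_natSwap_apply_of_lt l' hl' (by omega : n < n + 1), e] at this
    obtain rfl : m = 0 := by omega
    rw [heq.2, ascProd, one_mul]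
    refine ih (h.mono (by omega)) l' hl' ?_
    rw [← h1, heq.1, ascProd, one_mul]

/-! ### From words in natural numbers to permutations of `Fin N`. -/

theorem AdjPair.swap_apply_val {N : ℕ} (p : AdjPair N) (x : Fin N) :
    ((p.swap x : Fin N) : ℕ) = natSwap p.1.1 x := by
  have hp := p.2
  rw [AdjPair.swap, Equiv.swap_apply_def, natSwap_apply]
  simp only [Fin.ext_iff]
  split_ifs <;> omega

theorem prod_natSwap_apply {N : ℕ} (l : List (AdjPair N)) (x : Fin N) :
    ((l.map fun p => (p.1.1 : ℕ)).map natSwap).prod x = ((l.map AdjPair.swap).prod x : Fin N) := by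
  induction l with
  | nil => rfl
  | cons p l ih =>
    simp only [List.map_cons, List.prod_cons, Equiv.Perm.mul_apply, ih, AdjPair.swap_apply_val]

/-- Operators indexed by the simple transpositions which satisfy the Coxeter relations define a
homomorphism on the symmetric group. -/
theorem exists_monoidHom_perm {N : ℕ} (σ : AdjPair N → M) (hsq : ∀ p, σ p * σ p = 1)
    (hbraid : ∀ p q : AdjPair N, p.1.2 = q.1.1 → σ p * σ q * σ p = σ q * σ p * σ q)
    (hcomm : ∀ p q : AdjPair N, (p.1.2 : ℕ) < q.1.1 → σ p * σ q = σ q * σ p) :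
    ∃ φ : Equiv.Perm (Fin N) →* M, ∀ p, φ p.swap = σ p := by
  classical
  set s : ℕ → M := fun i => if h : i + 1 < N then
    σ ⟨(⟨i, (Nat.lt_succ_self i).trans h⟩, ⟨i + 1, h⟩), rfl⟩ else 1 with hs
  have hσs : ∀ p : AdjPair N, σ p = s p.1.1 := by
    rintro ⟨⟨⟨i, hi⟩, ⟨j, hj⟩⟩, hp⟩
    simp only at hp
    subst hp
    simp [hs, hj]
  have hcox : IsCoxeterA s (N - 1) := by
    refine ⟨fun i hi => ?_, fun i hi => ?_, fun i j hij hj => ?_⟩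
    · simp only [hs, dif_pos (show i + 1 < N by omega), hsq]
    · simp only [hs, dif_pos (show i + 1 < N by omega), dif_pos (show i + 1 + 1 < N by omega)]
      exact hbraid _ _ rfl
    · simp only [hs, dif_pos (show i + 1 < N by omega), dif_pos (show j + 1 < N by omega)]
      exact hcomm _ _ hij
  have hone : ∀ l : List (AdjPair N), (l.map AdjPair.swap).prod = 1 → (l.map σ).prod = 1 := by
    intro l hl
    have h1 : l.map σ = (l.map fun p => (p.1.1 : ℕ)).map s := by
      rw [List.map_map]
      exact List.map_congr_left fun p _ => hσs p
    have hlt : ∀ i ∈ l.map fun p => (p.1.1 : ℕ), i < N - 1 := by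
      intro i hi
      obtain ⟨p, _, rfl⟩ := List.mem_map.1 hi
      have := p.2
      have := p.1.2.2
      omega
    rw [h1]
    refine hcox.prod_eq_one _ hlt ?_
    -- For `N = 0` the truncated bound `N - 1 = 0` would not exclude the point `0`; but then there
    -- are no letters at all.
    rcases N.eq_zero_or_pos with rfl | hN
    · rcases l with _ | ⟨p, l⟩
      · rfl
      · exact p.1.1.elim0
    ext x
    by_cases hx : x < N
    · have := prod_natSwap_apply l ⟨x, hx⟩
      rw [hl] at this
      exact this
    · refine prod_natSwap_apply_of_lt (n := N - 1) _ hlt ?_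
      omega
  -- `M` is only a monoid. Since the generators are involutions, the reversed word provides the
  -- inverse.
  have hrev : ∀ l : List (AdjPair N), (l.map σ).prod * (l.reverse.map σ).prod = 1 := by
    intro l
    induction l with
    | nil => simp
    | cons p l ih =>
      simp only [List.map_cons, List.prod_cons, List.reverse_cons, List.map_append,
        List.prod_append,
        List.map_nil, List.prod_nil, mul_one]
      calc σ p * (l.map σ).prod * ((l.reverse.map σ).prod * σ p)
          = σ p * ((l.map σ).prod * (l.reverse.map σ).prod) * σ p := by simp only [mul_assoc]
        _ = 1 := by rw [ih, mul_one, hsq]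
  have hrevs : ∀ l : List (AdjPair N),
      (l.map AdjPair.swap).prod * (l.reverse.map AdjPair.swap).prod = 1 := by
    intro l
    induction l with
    | nil => simp
    | cons p l ih =>
      simp only [List.map_cons, List.prod_cons, List.reverse_cons, List.map_append,
        List.prod_append,
        List.map_nil, List.prod_nil, mul_one]
      calc p.swap * (l.map AdjPair.swap).prod * ((l.reverse.map AdjPair.swap).prod * p.swap)
          = p.swap * ((l.map AdjPair.swap).prod * (l.reverse.map AdjPair.swap).prod) * p.swap := by
            simp only [mul_assoc]
        _ = 1 := by rw [ih, mul_one]; exact Equiv.swap_mul_self _ _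
  -- Independence of the decomposition reduces to words for the identity: compare `l` with `l'`
  -- through `l` followed by the reverse of `l'`.
  have hwd : ∀ l l' : List (AdjPair N), (l.map AdjPair.swap).prod = (l'.map AdjPair.swap).prod →
      (l.map σ).prod = (l'.map σ).prod := by
    intro l l' hll
    have h1 : (l.map σ).prod * (l'.reverse.map σ).prod = 1 := by
      rw [← List.prod_append, ← List.map_append]
      refine hone _ ?_
      rw [List.map_append, List.prod_append, hll, hrevs]
    have h2 := hrev l'.reverse
    rw [List.reverse_reverse] at h2
    calc (l.map σ).prod = (l.map σ).prod * ((l'.reverse.map σ).prod * (l'.map σ).prod) := by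
          rw [h2, mul_one]
      _ = (l'.map σ).prod := by rw [← mul_assoc, h1, one_mul]
  have hword : ∀ w : Equiv.Perm (Fin N), ((word w).map AdjPair.swap).prod = w := fun w =>
    (exists_word w).choose_spec
  refine ⟨{ toFun := fun w => ((word w).map σ).prod, map_one' := ?_, map_mul' := ?_ }, ?_⟩
  · exact hone _ (hword 1)
  · intro v w
    rw [← List.prod_append, ← List.map_append]
    refine hwd _ _ ?_
    rw [List.map_append, List.prod_append, hword, hword, hword]
  · intro p
    have := hwd (word p.swap) [p] (by rw [hword]; simp)
    simpa using this

end Coxeter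

/-! ### Integrals depending on a parameter -/

section Leibniz

/-- Leibniz' rule for an integral whose integrand and upper bound depend on a parameter. -/
theorem hasDerivAt_integral_zero {K K' : ℝ → ℝ → ℂ} {u : ℝ → ℝ} {u' v₀ : ℝ}
    (hK : Continuous (Function.uncurry K)) (hK' : Continuous (Function.uncurry K'))
    (hder : ∀ v y, HasDerivAt (fun v => K v y) (K' v y) v) (hu : HasDerivAt u u' v₀) :
    HasDerivAt (fun v => ∫ y in (0 : ℝ)..u v, K v y)
      (u' • K v₀ (u v₀) + ∫ y in (0 : ℝ)..u v₀, K' v₀ y) v₀ := by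
  have h1 : ∀ v a : ℝ, HasDerivAt (fun v => ∫ y in (0 : ℝ)..a, K v y)
      (∫ y in (0 : ℝ)..a, K' v y) v := by
    intro v a
    obtain ⟨C, hC⟩ := ((isCompact_closedBall v 1).prod (isCompact_uIcc (a := (0 : ℝ)) (b := a))
      ).exists_bound_of_continuousOn hK'.continuousOn
    refine (intervalIntegral.hasDerivAt_integral_of_dominated_loc_of_deriv_le
      (F := K) (F' := K') (bound := fun _ => C) (Metric.closedBall_mem_nhds v one_pos)
      ?_ ?_ ?_ ?_ ?_ ?_).2
    · exact Eventually.of_forall fun w =>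
        (hK.comp (Continuous.prodMk_right w)).aestronglyMeasurable
    · exact (hK.comp (Continuous.prodMk_right v)).intervalIntegrable _ _
    · exact (hK'.comp (Continuous.prodMk_right v)).aestronglyMeasurable
    · exact Eventually.of_forall fun t ht w hw => hC (w, t) ⟨hw, uIoc_subset_uIcc ht⟩
    · exact intervalIntegrable_const
    · exact Eventually.of_forall fun t _ w _ => hder w t
  have h2 : ∀ v a : ℝ, HasDerivAt (fun a => ∫ y in (0 : ℝ)..a, K v y) (K v a) a := by
    intro v a
    have hc : Continuous (K v) := hK.comp (Continuous.prodMk_right v)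
    exact intervalIntegral.integral_hasDerivAt_right (hc.intervalIntegrable _ _)
      (hc.stronglyMeasurableAtFilter _ _) hc.continuousAt
  have hI : Continuous (fun p : ℝ × ℝ => ∫ y in (0 : ℝ)..p.2, K' p.1 y) := by
    refine intervalIntegral.continuous_parametric_intervalIntegral_of_continuous ?_ continuous_snd
    exact hK'.comp ((continuous_fst.comp continuous_fst).prodMk continuous_snd)
  -- The two partial derivatives in the parameter and in the upper bound are jointly continuous, so
  -- the integral is differentiable in both together; the chain rule along `v ↦ (v, u v)` then
  -- applies.
  have hstrict := hasStrictFDerivAt_uncurry_coprod (𝕜 := ℝ) (u := (v₀, u v₀))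
    (f := fun v a => ∫ y in (0 : ℝ)..a, K v y)
    (f₁ := fun v a => ContinuousLinearMap.toSpanSingleton ℝ (∫ y in (0 : ℝ)..a, K' v y))
    (f₂ := fun v a => ContinuousLinearMap.toSpanSingleton ℝ (K v a))
    (Eventually.of_forall fun p => (h1 p.1 p.2).hasFDerivAt)
    (Eventually.of_forall fun p => (h2 p.1 p.2).hasFDerivAt)
    ((ContinuousLinearMap.toSpanSingletonCLE (𝕜 := ℝ) (E := ℂ)).continuous.comp
      hI).continuousAt
    ((ContinuousLinearMap.toSpanSingletonCLE (𝕜 := ℝ) (E := ℂ)).continuous.comp hK).continuousAt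
  have hcomp := hstrict.hasFDerivAt.comp_hasDerivAt v₀ ((hasDerivAt_id v₀).prodMk hu)
  refine HasDerivAt.congr_deriv hcomp ?_
  change ContinuousLinearMap.coprod (ContinuousLinearMap.toSpanSingleton ℝ _)
    (ContinuousLinearMap.toSpanSingleton ℝ _) (1, u') = _
  simp [add_comm]

theorem continuous_integral_zero {X : Type*} [TopologicalSpace X] (F : X → ℝ → ℂ) (s : X → ℝ)
    (hF : Continuous fun p : X × ℝ => F p.1 p.2) (hs : Continuous s) :
    Continuous fun x => ∫ t in (0 : ℝ)..s x, F x t :=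
  intervalIntegral.continuous_parametric_intervalIntegral_of_continuous hF hs

/-- The device for the identities between iterated integrals below: differentiate both sides in one
endpoint and compare at one value, rather than decompose planar regions. -/
theorem eq_of_hasDerivAt {f g f' : ℝ → ℂ} (hf : ∀ x, HasDerivAt f (f' x) x)
    (hg : ∀ x, HasDerivAt g (f' x) x) {a : ℝ} (h0 : f a = g a) : f = g := by
  have h : ∀ x, HasDerivAt (f - g) 0 x := fun x => by simpa using (hf x).sub (hg x)
  have hc := is_const_of_deriv_eq_zero (fun x => (h x).differentiableAt) fun x => (h x).deriv
  ext x
  have := hc x a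
  simpa [h0, sub_eq_zero] using this

theorem hasDerivAt_integral_upper {g : ℝ → ℂ} (hg : Continuous g) {u : ℝ → ℝ} {u' v : ℝ}
    (hu : HasDerivAt u u' v) :
    HasDerivAt (fun v => ∫ y in (0 : ℝ)..u v, g y) (u' • g (u v)) v := by
  have := hasDerivAt_integral_zero (K := fun _ y => g y) (K' := fun _ _ => 0)
    (hg.comp continuous_snd) continuous_const (fun v y => hasDerivAt_const v (g y)) hu
  simpa using this

theorem integral_integral_comm {φ : ℝ → ℝ → ℂ} (hφ : Continuous (Function.uncurry φ)) (A B : ℝ) :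
    ∫ y in (0 : ℝ)..A, ∫ z in (0 : ℝ)..B, φ y z = ∫ z in (0 : ℝ)..B, ∫ y in (0 : ℝ)..A, φ y z := by
  have hφ' : Continuous fun p : ℝ × ℝ => φ p.1 p.2 := hφ
  refine congrFun (eq_of_hasDerivAt (f := fun A => ∫ y in (0 : ℝ)..A, ∫ z in (0 : ℝ)..B, φ y z)
    (g := fun A => ∫ z in (0 : ℝ)..B, ∫ y in (0 : ℝ)..A, φ y z)
    (f' := fun A => ∫ z in (0 : ℝ)..B, φ A z) (fun v => ?_) (fun v => ?_) (a := 0) (by simp)) A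
  · have := hasDerivAt_integral_upper (g := fun y => ∫ z in (0 : ℝ)..B, φ y z)
      (by fun_prop) (hasDerivAt_id v)
    simpa using this
  · have := hasDerivAt_integral_zero (K := fun A z => ∫ y in (0 : ℝ)..A, φ y z) (K' := φ)
      (u := fun _ => B) (v₀ := v) ?_ hφ (fun w z => ?_) (hasDerivAt_const v B)
    · simpa using this
    · refine intervalIntegral.continuous_parametric_intervalIntegral_of_continuous ?_ continuous_fst
      exact hφ'.comp (continuous_snd.prodMk (continuous_snd.comp continuous_fst))
    · have := hasDerivAt_integral_upper (g := fun y => φ y z)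
        (hφ'.comp (Continuous.prodMk_left z)) (hasDerivAt_id w)
      simpa using this

/-- The integral identity behind the classical Yang-Baxter equation. -/
theorem integral_yangBaxter {φ : ℝ → ℝ → ℂ} (hφ : Continuous (Function.uncurry φ)) (A B : ℝ) :
    ∫ a in (0 : ℝ)..A, ∫ b in (0 : ℝ)..(B + a), φ a b =
      (∫ y in (0 : ℝ)..(A + B), ∫ z in (0 : ℝ)..(A - y), φ (y + z) y) +
        ∫ y in (0 : ℝ)..B, ∫ z in (0 : ℝ)..(A + B - y), φ z (y + z) := by
  have hφ' : Continuous fun p : ℝ × ℝ => φ p.1 p.2 := hφ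
  have hφ2 : ∀ {X : Type} [TopologicalSpace X] {f g : X → ℝ}, Continuous f → Continuous g →
      Continuous fun x => φ (f x) (g x) := fun hf hg => hφ'.comp (hf.prodMk hg)
  have c1 : ∀ A : ℝ, Continuous fun y => ∫ z in (0 : ℝ)..(A - y), φ (y + z) y := fun A =>
    continuous_integral_zero (fun y z => φ (y + z) y) (fun y => A - y)
      (hφ2 (by fun_prop) (by fun_prop)) (by fun_prop)
  -- Both sides have the same derivative in `B`, namely the integral of `φ` along the moving edge `b
  -- = B + a`.
  refine congrFun (eq_of_hasDerivAt (f := fun B => ∫ a in (0 : ℝ)..A, ∫ b in (0 : ℝ)..(B + a), φ a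
    b)
    (g := fun B => (∫ y in (0 : ℝ)..(A + B), ∫ z in (0 : ℝ)..(A - y), φ (y + z) y) +
        ∫ y in (0 : ℝ)..B, ∫ z in (0 : ℝ)..(A + B - y), φ z (y + z))
    (f' := fun B => ∫ a in (0 : ℝ)..A, φ a (B + a)) (fun B => ?_) (fun B => ?_) (a := 0) ?_) B
  · have := hasDerivAt_integral_zero (K := fun B a => ∫ b in (0 : ℝ)..(B + a), φ a b)
      (K' := fun B a => φ a (B + a)) (u := fun _ => A) (v₀ := B)
      (continuous_integral_zero (fun p b => φ p.2 b) (fun p : ℝ × ℝ => p.1 + p.2)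
        (hφ2 (by fun_prop) (by fun_prop)) (by fun_prop))
      (hφ2 (by fun_prop) (by fun_prop)) (fun w a => ?_) (hasDerivAt_const B A)
    · simpa using this
    · simpa using hasDerivAt_integral_upper (g := fun b => φ a b)
        (hφ2 (by fun_prop) (by fun_prop)) ((hasDerivAt_id w).add_const a)
  · have h1 := hasDerivAt_integral_upper (c1 A) ((hasDerivAt_id B).const_add A)
    have h2 := hasDerivAt_integral_zero
      (K := fun B y => ∫ z in (0 : ℝ)..(A + B - y), φ z (y + z))
      (K' := fun B y => φ (A + B - y) (A + B)) (u := fun B => B) (v₀ := B)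
      (continuous_integral_zero (fun p z => φ z (p.2 + z)) (fun p : ℝ × ℝ => A + p.1 - p.2)
        (hφ2 (by fun_prop) (by fun_prop)) (by fun_prop))
      (hφ2 (by fun_prop) (by fun_prop)) (fun w y => ?_) (hasDerivAt_id B)
    · refine (h1.add h2).congr_deriv ?_
      -- The boundary term of the first summand at `y = A + B` cancels the integral over `y` of the
      -- derivative of the inner integral in the second.
      have e : ∫ z in (0 : ℝ)..(-B), φ (A + B + z) (A + B) =
          -∫ y in (0 : ℝ)..B, φ (A + B - y) (A + B) := by
        have := intervalIntegral.integral_comp_neg (a := 0) (b := B)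
          (fun z => φ (A + B + z) (A + B))
        simp only [neg_zero, ← sub_eq_add_neg] at this
        rw [this, intervalIntegral.integral_symm]
      simp only [id, one_smul, sub_add_cancel_left, add_sub_cancel_right, e]
      ring
    · have := hasDerivAt_integral_upper (g := fun z => φ z (y + z))
        (hφ2 (by fun_prop) (by fun_prop)) (((hasDerivAt_id w).const_add A).sub_const y)
      simpa using this
  -- At `B = 0` both sides are integrals over the triangle `0 ≤ b ≤ a ≤ A` (when `0 ≤ A`); they are
  -- compared by differentiating in `A`.
  · simp only [zero_add, add_zero, intervalIntegral.integral_same]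
    refine congrFun (eq_of_hasDerivAt (f := fun A => ∫ a in (0 : ℝ)..A, ∫ b in (0 : ℝ)..a, φ a b)
      (g := fun A => ∫ y in (0 : ℝ)..A, ∫ z in (0 : ℝ)..(A - y), φ (y + z) y)
      (f' := fun A => ∫ b in (0 : ℝ)..A, φ A b) (fun A => ?_) (fun A => ?_) (a := 0) (by simp)) A
    · have := hasDerivAt_integral_upper (g := fun a => ∫ b in (0 : ℝ)..a, φ a b)
        (continuous_integral_zero φ (fun a => a) (hφ2 (by fun_prop) (by fun_prop))
          (by fun_prop)) (hasDerivAt_id A)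
      simpa using this
    · have := hasDerivAt_integral_zero
        (K := fun A y => ∫ z in (0 : ℝ)..(A - y), φ (y + z) y)
        (K' := fun A y => φ A y) (u := fun A => A) (v₀ := A)
        (continuous_integral_zero (fun p z => φ (p.2 + z) p.2) (fun p : ℝ × ℝ => p.1 - p.2)
          (hφ2 (by fun_prop) (by fun_prop)) (by fun_prop))
        (hφ2 (by fun_prop) (by fun_prop)) (fun w y => ?_) (hasDerivAt_id A)
      · simpa using this
      · simpa using hasDerivAt_integral_upper (g := fun z => φ (y + z) y)
          (hφ2 (by fun_prop) (by fun_prop)) ((hasDerivAt_id w).sub_const y)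

end Leibniz

/-! ### Integral-reflection operators on continuous functions -/

/-- The continuous functions on `ℝ^N`. -/
abbrev CF (N : ℕ) : Type := C(Fin N → ℝ, ℂ)

section Operators

variable {N : ℕ}

/-- The action `(w f)(x) = f (w⁻¹ x)` of the symmetric group. -/
def permOp : Equiv.Perm (Fin N) →* Module.End ℂ (CF N) where
  toFun w :=
    { toFun := fun f => ⟨fun x => f (x ∘ w), by fun_prop⟩
      map_add' := fun _ _ => rfl
      map_smul' := fun _ _ => rfl }
  map_one' := rfl
  map_mul' _ _ := rfl

theorem permOp_apply (w : Equiv.Perm (Fin N)) (f : CF N) (x : Fin N → ℝ) :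
    permOp w f x = f (x ∘ w) := rfl

/-- The point `x - y (e_j - e_k)`. -/
def shift (j k : Fin N) (x : Fin N → ℝ) (y : ℝ) : Fin N → ℝ :=
  x - y • (Pi.single j 1 - Pi.single k 1)

@[fun_prop]
theorem continuous_shift {X : Type*} [TopologicalSpace X] (j k : Fin N) {x : X → Fin N → ℝ}
    {y : X → ℝ} (hx : Continuous x) (hy : Continuous y) :
    Continuous fun t => shift j k (x t) (y t) := by
  unfold shift; fun_prop

theorem shift_apply (j k l : Fin N) (x : Fin N → ℝ) (y : ℝ) :
    shift j k x y l = x l - y * ((if l = j then 1 else 0) - (if l = k then 1 else 0)) := by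
  simp [shift, Pi.single_apply]

/-- The operator `(I_{jk} f)(x) = ∫_0^{x_j - x_k} f (x - y (e_j - e_k)) dy`. -/
def intOp (j k : Fin N) : Module.End ℂ (CF N) where
  toFun f :=
    { toFun := fun x => ∫ y in (0 : ℝ)..(x j - x k), f (shift j k x y)
      continuous_toFun := continuous_integral_zero _ _ (by fun_prop) (by fun_prop) }
  map_add' f g := by
    ext x
    simp only [ContinuousMap.coe_mk, ContinuousMap.add_apply]
    exact intervalIntegral.integral_add
      (Continuous.intervalIntegrable (by fun_prop) _ _)
      (Continuous.intervalIntegrable (by fun_prop) _ _)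
  map_smul' c f := by
    ext x
    simp

theorem intOp_apply (j k : Fin N) (f : CF N) (x : Fin N → ℝ) :
    intOp j k f x = ∫ y in (0 : ℝ)..(x j - x k), f (shift j k x y) := rfl

theorem permOp_mul_intOp (w : Equiv.Perm (Fin N)) (j k : Fin N) :
    permOp w * intOp j k = intOp (w j) (w k) * permOp w := by
  ext f x
  simp only [Module.End.mul_apply, permOp_apply, intOp_apply, Function.comp_apply]
  congr 1
  ext y
  congr 1
  ext l
  simp [shift_apply]

theorem intOp_swap (j k : Fin N) : intOp k j = (-1 : ℂ) • intOp j k := by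
  ext f x
  simp only [LinearMap.smul_apply, intOp_apply, neg_smul, one_smul]
  have := intervalIntegral.integral_comp_neg (a := 0) (b := x j - x k)
    (fun y => f (shift k j x y))
  rw [neg_zero, neg_sub] at this
  rw [intervalIntegral.integral_symm, ← this]
  congr 2
  ext y
  congr 1
  ext l
  simp only [shift_apply]
  ring

/-- The substitution `y ↦ x j - x k - y` traverses the segment from `x` to its reflection in the
opposite direction. -/
theorem intOp_mul_permOp_swap (j k : Fin N) :
    intOp j k * permOp (Equiv.swap j k) = intOp j k := by
  ext f x
  simp only [Module.End.mul_apply, permOp_apply, intOp_apply]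
  have := intervalIntegral.integral_comp_sub_left (a := 0) (b := x j - x k)
    (fun y => f (shift j k x y)) (x j - x k)
  rw [sub_self, sub_zero] at this
  rw [← this]
  congr 1
  ext y
  congr 1
  ext l
  simp only [Function.comp_apply, shift_apply]
  rcases eq_or_ne l j with rfl | hj
  · by_cases h : k = l
    · subst h; simp
    · simp [h, Ne.symm h]; ring
  · rcases eq_or_ne l k with rfl | hk
    · simp [hj, Ne.symm hj]; ring
    · simp [hj, hk, Equiv.swap_apply_of_ne_of_ne]

theorem permOp_swap_mul_intOp (j k : Fin N) :
    permOp (Equiv.swap j k) * intOp j k = (-1 : ℂ) • intOp j k := by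
  rw [permOp_mul_intOp, Equiv.swap_apply_left, Equiv.swap_apply_right, intOp_swap, smul_mul_assoc,
    intOp_mul_permOp_swap]

/-- No integration is needed: with $I=Is$ and $sI=-I$ one has $I^2=IsI=-I^2$. -/
theorem intOp_mul_self (j k : Fin N) : intOp j k * intOp j k = 0 := by
  have h : intOp j k * intOp j k = (-1 : ℂ) • (intOp j k * intOp j k) := by
    conv_lhs => rw [← intOp_mul_permOp_swap j k, mul_assoc, intOp_mul_permOp_swap,
      permOp_swap_mul_intOp, mul_smul_comm]
  have h2 : (2 : ℂ) • (intOp j k * intOp j k) = 0 := by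
    rw [two_smul]; nth_rewrite 1 [h]; module
  exact (smul_eq_zero.1 h2).resolve_left two_ne_zero

theorem intOp_comm {j k l m : Fin N} (hjl : j ≠ l) (hjm : j ≠ m) (hkl : k ≠ l) (hkm : k ≠ m) :
    intOp j k * intOp l m = intOp l m * intOp j k := by
  ext f x
  simp only [Module.End.mul_apply, intOp_apply]
  have e1 : ∀ y, shift j k x y l - shift j k x y m = x l - x m := fun y => by
    simp [shift_apply, hjl.symm, hjm.symm, hkl.symm, hkm.symm]
  have e2 : ∀ y, shift l m x y j - shift l m x y k = x j - x k := fun y => by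
    simp [shift_apply, hjl, hjm, hkl, hkm]
  simp only [e1, e2]
  rw [integral_integral_comm (φ := fun y z => f (shift l m (shift j k x y) z))
    (by simp only [Function.uncurry_def]; fun_prop)]
  congr 1
  ext y
  congr 1
  ext z
  congr 1
  simp only [shift]
  abel

/-- Since $e_j-e_l=(e_j-e_k)+(e_k-e_l)$, all three products integrate the same function
$\varphi(a,b)=f(x-a(e_j-e_k)-b(e_k-e_l))$ over oriented planar regions, and `integral_yangBaxter`
relates these. -/
theorem intOp_yangBaxter {j k l : Fin N} (hjk : j ≠ k) (hjl : j ≠ l) (hkl : k ≠ l) :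
    intOp j k * intOp k l = intOp j l * intOp j k + intOp k l * intOp j l := by
  ext f x
  simp only [Module.End.mul_apply, LinearMap.add_apply, ContinuousMap.add_apply, intOp_apply]
  have e1 : ∀ y, shift j k x y k - shift j k x y l = x k - x l + y := fun y => by
    simp [shift_apply, hjk.symm, hjl.symm, hkl.symm]; ring
  have e2 : ∀ y, shift j l x y j - shift j l x y k = x j - x k - y := fun y => by
    simp [shift_apply, hjk.symm, hjl, hkl]; ring
  have e3 : ∀ y, shift k l x y j - shift k l x y l = x j - x k + (x k - x l) - y := fun y => by
    simp [shift_apply, hjk, hjl, hkl.symm]; ring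
  simp only [e1, e2, e3]
  have := integral_yangBaxter (φ := fun a b => f (shift k l (shift j k x a) b))
    (by simp only [Function.uncurry_def]; fun_prop) (x j - x k) (x k - x l)
  rw [sub_add_sub_cancel] at this ⊢
  rw [this]
  have e4 : ∀ y z, shift k l (shift j k x (y + z)) y = shift j k (shift j l x y) z := by
    intro y z; simp only [shift]; module
  have e5 : ∀ y z, shift k l (shift j k x z) (y + z) = shift j l (shift k l x y) z := by
    intro y z; simp only [shift]; module
  simp only [e4, e5]

variable (γ : ℝ)

/-- The integral-reflection operator `s_j + γ I_{j,j+1}` on continuous functions. -/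
def reflOp (p : AdjPair N) : Module.End ℂ (CF N) :=
  permOp p.swap + (γ : ℂ) • intOp p.1.1 p.1.2

theorem reflOp_apply (p : AdjPair N) (f : CF N) (x : Fin N → ℝ) :
    reflOp γ p f x = integralReflection γ p f x := rfl

theorem AdjPair.ne (p : AdjPair N) : p.1.1 ≠ p.1.2 := by
  have := p.2
  intro h
  rw [h] at this
  omega

/-- The mixed terms cancel because $sI=-I$ and $Is=I$, and $I^2=0$. -/
theorem reflOp_sq (p : AdjPair N) : reflOp γ p * reflOp γ p = 1 := by
  have h1 : permOp p.swap * permOp p.swap = 1 := by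
    rw [← map_mul, AdjPair.swap, Equiv.swap_mul_self, map_one]
  have h2 := permOp_swap_mul_intOp p.1.1 p.1.2
  have h3 := intOp_mul_permOp_swap p.1.1 p.1.2
  have h4 := intOp_mul_self p.1.1 p.1.2
  simp only [reflOp, add_mul, mul_add, smul_mul_assoc, mul_smul_comm, h1, h4, smul_zero, add_zero]
  rw [AdjPair.swap, h2, h3]
  module

theorem commute_reflOp_intOp (p : AdjPair N) {l m : Fin N} (h1 : p.1.1 ≠ l) (h2 : p.1.1 ≠ m)
    (h3 : p.1.2 ≠ l) (h4 : p.1.2 ≠ m) : Commute (reflOp γ p) (intOp l m) := by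
  unfold reflOp
  refine Commute.add_left ?_ (Commute.smul_left (intOp_comm h1 h2 h3 h4) _)
  rw [Commute, SemiconjBy, permOp_mul_intOp, AdjPair.swap,
    Equiv.swap_apply_of_ne_of_ne h1.symm h3.symm, Equiv.swap_apply_of_ne_of_ne h2.symm h4.symm]

theorem commute_reflOp_permOp_swap (p : AdjPair N) {l m : Fin N} (h1 : p.1.1 ≠ l)
    (h2 : p.1.1 ≠ m) (h3 : p.1.2 ≠ l) (h4 : p.1.2 ≠ m) :
    Commute (reflOp γ p) (permOp (Equiv.swap l m)) := by
  unfold reflOp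
  refine Commute.add_left ?_ (Commute.smul_left ?_ _)
  · rw [Commute, SemiconjBy, ← map_mul, ← map_mul, AdjPair.swap]
    congr 1
    refine Equiv.Perm.Disjoint.commute ?_
    intro x
    by_cases hx : x = p.1.1 ∨ x = p.1.2
    · right
      rcases hx with rfl | rfl <;> exact Equiv.swap_apply_of_ne_of_ne ‹_› ‹_›
    · left
      push Not at hx
      exact Equiv.swap_apply_of_ne_of_ne hx.1 hx.2
  · rw [Commute, SemiconjBy, permOp_mul_intOp,
      Equiv.swap_apply_of_ne_of_ne h1 h2, Equiv.swap_apply_of_ne_of_ne h3 h4]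

end Operators

/-! ### The deformed action of the symmetric group and the propagation operator -/

section Hom

/-- Here $X,Y,Z$ stand for $I_{12},I_{23},I_{13}$, and the two sides are compared in each power of
$g$. Order 1 only permutes the three terms. In order 2 both sides reduce to $XZt+YZs$ by the two
Yang-Baxter equations. In order 3 both are $YZX$, because $X^2=Y^2=0$. -/
theorem braid_of_yangBaxter {R : Type*} [Ring R] [Algebra ℂ R] (g : ℂ) {s t X Y Z : R}
    (hs : s * s = 1) (ht : t * t = 1) (hst : s * t * s = t * s * t) (hsX : s * X = (-1 : ℂ) • X)
    (hXs : X * s = X) (htY : t * Y = (-1 : ℂ) • Y) (hYt : Y * t = Y) (hsY : s * Y = Z * s)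
    (hsZ : s * Z = Y * s) (htX : t * X = Z * t) (htZ : t * Z = X * t)
    (h1 : X * Y = Z * X + Y * Z) (h2 : Y * X = Z * Y + X * Z) (hX : X * X = 0) (hY : Y * Y = 0) :
    (s + g • X) * (t + g • Y) * (s + g • X) = (t + g • Y) * (s + g • X) * (t + g • Y) := by
  have a1 : s * t * X = Y * s * t := by rw [mul_assoc, htX, ← mul_assoc, hsZ]
  have a2 : s * Y * s = Z := by rw [hsY, mul_assoc, hs, mul_one]
  have a3 : t * X * t = Z := by rw [htX, mul_assoc, ht, mul_one]
  have a4 : t * s * Y = X * t * s := by rw [mul_assoc, hsY, ← mul_assoc, htZ]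
  have b1 : s * Y * X = (-1 : ℂ) • (Z * X) := by rw [hsY, mul_assoc, hsX, mul_smul_comm]
  have b2 : X * t * X = X * Z * t := by rw [mul_assoc, htX, ← mul_assoc]
  have b3 : X * Y * s = Z * X + Y * Z * s := by rw [h1, add_mul, mul_assoc Z, hXs]
  have b4 : t * X * Y = (-1 : ℂ) • (Z * Y) := by rw [htX, mul_assoc, htY, mul_smul_comm]
  have b5 : Y * s * Y = Y * Z * s := by rw [mul_assoc, hsY, ← mul_assoc]
  have b6 : Y * X * t = Z * Y + X * Z * t := by rw [h2, add_mul, mul_assoc Z, hYt]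
  have c1 : X * Y * X = Y * Z * X := by rw [h1, add_mul, mul_assoc Z, hX, mul_zero, zero_add]
  have c2 : Y * X * Y = Y * Z * X := by
    rw [mul_assoc, h1, mul_add, ← mul_assoc Y Y Z, hY, zero_mul, add_zero, mul_assoc]
  simp only [add_mul, mul_add, smul_mul_assoc, mul_smul_comm, a1, a2, a3, a4, b1, b2, b3, b4, b5,
    b6, c1, c2, hst]
  module

variable (γ : ℝ) {N : ℕ}

theorem reflOp_braid (p q : AdjPair N) (h : p.1.2 = q.1.1) :
    reflOp γ p * reflOp γ q * reflOp γ p = reflOp γ q * reflOp γ p * reflOp γ q := by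
  obtain ⟨⟨a, b⟩, hab⟩ := p
  obtain ⟨⟨b', c⟩, hbc⟩ := q
  simp only at h hab hbc
  subst h
  have nab : a ≠ b := by rintro rfl; omega
  have nbc : b ≠ c := by rintro rfl; omega
  have nac : a ≠ c := by rintro rfl; omega
  have hbc' : Equiv.swap b c a = a := Equiv.swap_apply_of_ne_of_ne nab nac
  have hab' : Equiv.swap a b c = c := Equiv.swap_apply_of_ne_of_ne nac.symm nbc.symm
  refine braid_of_yangBaxter (γ : ℂ) (Z := intOp a c) ?_ ?_ ?_ (permOp_swap_mul_intOp a b)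
    (intOp_mul_permOp_swap a b) (permOp_swap_mul_intOp b c) (intOp_mul_permOp_swap b c) ?_ ?_ ?_ ?_
    (intOp_yangBaxter nab nac nbc) ?_ (intOp_mul_self a b) (intOp_mul_self b c)
  · rw [← map_mul, AdjPair.swap, Equiv.swap_mul_self, map_one]
  · rw [← map_mul, AdjPair.swap, Equiv.swap_mul_self, map_one]
  · rw [← map_mul, ← map_mul, ← map_mul, ← map_mul]
    congr 1
    simp only [AdjPair.swap]
    rw [Equiv.swap_mul_swap_mul_swap nab nac, Equiv.swap_comm b c, Equiv.swap_comm a b,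
      Equiv.swap_mul_swap_mul_swap nbc.symm nac.symm, Equiv.swap_comm]
  · rw [permOp_mul_intOp]
    simp [AdjPair.swap, hab']
  · rw [permOp_mul_intOp]
    simp [AdjPair.swap, hab']
  · rw [permOp_mul_intOp]
    simp [AdjPair.swap, hbc']
  · rw [permOp_mul_intOp]
    simp [AdjPair.swap, hbc']
  -- The second Yang-Baxter equation is the first one for the reversed triple `c, b, a`: each
  -- operator changes sign, and the signs cancel in the products.
  · have := intOp_yangBaxter nbc.symm nac.symm nab.symm
    simpa only [intOp_swap b c, intOp_swap a b, intOp_swap a c, smul_mul_assoc, mul_smul_comm,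
      smul_smul, neg_one_mul, neg_neg, one_smul] using this

theorem reflOp_comm (p q : AdjPair N) (h : (p.1.2 : ℕ) < q.1.1) :
    reflOp γ p * reflOp γ q = reflOp γ q * reflOp γ p := by
  have hp := p.2
  have hq := q.2
  have h1 : p.1.1 ≠ q.1.1 := by intro e; rw [e] at hp; omega
  have h2 : p.1.1 ≠ q.1.2 := by intro e; rw [e] at hp; omega
  have h3 : p.1.2 ≠ q.1.1 := by intro e; rw [e] at h; omega
  have h4 : p.1.2 ≠ q.1.2 := by intro e; rw [e] at h; omega
  exact (commute_reflOp_permOp_swap γ p h1 h2 h3 h4).add_right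
    ((commute_reflOp_intOp γ p h1 h2 h3 h4).smul_right _)

/-- The deformed action `w ↦ w^γ` of the symmetric group on continuous functions. -/
def reflHom (γ : ℝ) (N : ℕ) : Equiv.Perm (Fin N) →* Module.End ℂ (CF N) :=
  (exists_monoidHom_perm (reflOp γ) (reflOp_sq γ) (reflOp_braid γ) (reflOp_comm γ)).choose

theorem reflHom_swap (p : AdjPair N) : reflHom γ N p.swap = reflOp γ p :=
  (exists_monoidHom_perm (reflOp γ) (reflOp_sq γ) (reflOp_braid γ) (reflOp_comm γ)).choose_spec p

/-- A property of permutations which is multiplicative and holds for the simple transpositions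
holds for all permutations. -/
theorem perm_induction {Q : Equiv.Perm (Fin N) → Prop} (h1 : Q 1)
    (hmul : ∀ (p : AdjPair N) w, Q w → Q (p.swap * w)) (w : Equiv.Perm (Fin N)) : Q w := by
  obtain ⟨l, rfl⟩ := exists_word w
  induction l with
  | nil => exact h1
  | cons p l ih => exact hmul p _ ih

/-- Frees the operator from its chosen word, so that `propagation` can be computed with any
factorisation. -/
theorem permGamma_eq (w : Equiv.Perm (Fin N)) (f : CF N) :
    permGamma γ w f = reflHom γ N w f := by
  have hw : ((word w).map AdjPair.swap).prod = w := (exists_word w).choose_spec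
  conv_rhs => rw [← hw]
  unfold permGamma
  induction word w with
  | nil => simp
  | cons p l ih =>
    rw [List.foldr_cons, List.map_cons, List.prod_cons, map_mul, reflHom_swap, ih]
    rfl

theorem propagation_apply (f : CF N) (x : Fin N → ℝ) :
    propagation γ f x = reflHom γ N (Tuple.sort fun j => -x j)⁻¹ f
      (x ∘ Tuple.sort fun j => -x j) := by
  rw [propagation, permGamma_eq]

theorem propagation_eq (f : CF N) {x : Fin N → ℝ} (τ : Equiv.Perm (Fin N))
    (h : StrictAnti (x ∘ τ)) : propagation γ f x = reflHom γ N τ⁻¹ f (x ∘ τ) := by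
  have : τ = Tuple.sort fun j => -x j := by
    rw [Tuple.eq_sort_iff]
    refine ⟨fun i j hij => neg_le_neg (h.antitone hij), fun i j hij he => ?_⟩
    exact absurd (neg_injective he) (h hij).ne'
  rw [propagation_apply, ← this]

theorem exists_strictAnti {x : Fin N → ℝ} (hx : Function.Injective x) :
    ∃ τ : Equiv.Perm (Fin N), StrictAnti (x ∘ τ) := by
  refine ⟨Tuple.sort fun j => -x j, fun i j hij => ?_⟩
  have h := Tuple.monotone_sort (fun j => -x j) hij.le
  refine lt_of_le_of_ne (neg_le_neg_iff.1 h) fun he => ?_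
  exact hij.ne' ((Tuple.sort fun j => -x j).injective (hx he))

/-- If `τ` sorts `x`, then `v⁻¹ * τ` sorts `x ∘ v`, and both sides are $(\tau^{-1}v)^\gamma f$ at
the same decreasing point. Distinct coordinates make the sorting permutation unique. -/
theorem propagation_reflHom (f : CF N) {x : Fin N → ℝ} (hx : Function.Injective x)
    (v : Equiv.Perm (Fin N)) :
    propagation γ (reflHom γ N v f) x = propagation γ f (x ∘ v) := by
  obtain ⟨τ, hτ⟩ := exists_strictAnti hx
  have e : x ∘ τ = (x ∘ v) ∘ (v⁻¹ * τ : Equiv.Perm (Fin N)) := by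
    ext j; simp
  rw [propagation_eq γ _ τ hτ, propagation_eq γ f (x := x ∘ v) (v⁻¹ * τ) (e ▸ hτ), ← e,
    mul_inv_rev, inv_inv, map_mul]
  rfl

end Hom

/-! ### Adjoining a first or a last variable -/

section Adjoin

variable {N : ℕ}

/-- The tuple `(t, x₁, …, x_N)`. -/
def tcons (t : ℝ) (x : Fin N → ℝ) : Fin (N + 1) → ℝ := Fin.cons t x

/-- The tuple `(x₁, …, x_N, t)`. -/
def tsnoc (x : Fin N → ℝ) (t : ℝ) : Fin (N + 1) → ℝ := Fin.snoc x t

@[simp] theorem tcons_zero (t : ℝ) (x : Fin N → ℝ) : tcons t x 0 = t := rfl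

@[simp] theorem tcons_succ (t : ℝ) (x : Fin N → ℝ) (j : Fin N) : tcons t x j.succ = x j := rfl

@[simp] theorem tsnoc_last (x : Fin N → ℝ) (t : ℝ) : tsnoc x t (Fin.last N) = t := by
  simp [tsnoc]

@[simp] theorem tsnoc_castSucc (x : Fin N → ℝ) (t : ℝ) (j : Fin N) :
    tsnoc x t j.castSucc = x j := by
  simp [tsnoc]

theorem exists_eq_tcons (y : Fin (N + 1) → ℝ) : ∃ t x, y = tcons t x :=
  ⟨y 0, fun k => y k.succ, funext fun j => by refine Fin.cases ?_ (fun k => ?_) j <;> rfl⟩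

theorem exists_eq_tsnoc (y : Fin (N + 1) → ℝ) : ∃ x t, y = tsnoc x t :=
  ⟨fun k => y k.castSucc, y (Fin.last N), funext fun j => by
    refine Fin.lastCases ?_ (fun k => ?_) j <;> simp⟩

theorem tcons_tsnoc (a b : ℝ) (x : Fin N → ℝ) : tcons a (tsnoc x b) = tsnoc (tcons a x) b :=
  Fin.cons_snoc_eq_snoc_cons a x b

@[fun_prop]
theorem continuous_tcons {X : Type*} [TopologicalSpace X] {t : X → ℝ} {x : X → Fin N → ℝ}
    (ht : Continuous t) (hx : Continuous x) : Continuous fun s => tcons (t s) (x s) := by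
  refine continuous_pi fun j => ?_
  refine Fin.cases ?_ (fun k => ?_) j
  · simpa using ht
  · have : Continuous fun s => x s k := (continuous_apply k).comp hx
    simpa using this

@[fun_prop]
theorem continuous_tsnoc {X : Type*} [TopologicalSpace X] {t : X → ℝ} {x : X → Fin N → ℝ}
    (ht : Continuous t) (hx : Continuous x) : Continuous fun s => tsnoc (x s) (t s) := by
  refine continuous_pi fun j => ?_
  refine Fin.lastCases ?_ (fun k => ?_) j
  · simpa using ht
  · have : Continuous fun s => x s k := (continuous_apply k).comp hx
    simpa using this

theorem injective_tcons {t : ℝ} {x : Fin N → ℝ} :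
    Function.Injective (tcons t x) ↔ (∀ k, x k ≠ t) ∧ Function.Injective x := by
  rw [tcons, Fin.cons_injective_iff]
  simp

theorem injective_tsnoc {t : ℝ} {x : Fin N → ℝ} :
    Function.Injective (tsnoc x t) ↔ (∀ k, x k ≠ t) ∧ Function.Injective x := by
  rw [tsnoc, Fin.snoc_injective_iff, and_comm]
  simp

/-- The embedding of the permutations of the last `N` out of `N + 1` variables. -/
def liftFirst : Equiv.Perm (Fin N) →* Equiv.Perm (Fin (N + 1)) where
  toFun v :=
    { toFun := Fin.cases 0 fun j => (v j).succ
      invFun := Fin.cases 0 fun j => (v⁻¹ j).succ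
      left_inv := fun j => by refine Fin.cases ?_ (fun k => ?_) j <;> simp
      right_inv := fun j => by refine Fin.cases ?_ (fun k => ?_) j <;> simp }
  map_one' := by ext j; refine Fin.cases ?_ (fun k => ?_) j <;> simp
  map_mul' v w := by ext j; refine Fin.cases ?_ (fun k => ?_) j <;> simp

/-- The embedding of the permutations of the first `N` out of `N + 1` variables. -/
def liftLast : Equiv.Perm (Fin N) →* Equiv.Perm (Fin (N + 1)) where
  toFun v :=
    { toFun := Fin.lastCases (Fin.last N) fun j => (v j).castSucc
      invFun := Fin.lastCases (Fin.last N) fun j => (v⁻¹ j).castSucc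
      left_inv := fun j => by refine Fin.lastCases ?_ (fun k => ?_) j <;> simp
      right_inv := fun j => by refine Fin.lastCases ?_ (fun k => ?_) j <;> simp }
  map_one' := by ext j; refine Fin.lastCases ?_ (fun k => ?_) j <;> simp
  map_mul' v w := by ext j; refine Fin.lastCases ?_ (fun k => ?_) j <;> simp

@[simp] theorem liftFirst_zero (v : Equiv.Perm (Fin N)) : liftFirst v 0 = 0 := rfl

@[simp] theorem liftFirst_succ (v : Equiv.Perm (Fin N)) (j : Fin N) :
    liftFirst v j.succ = (v j).succ := rfl

@[simp] theorem liftLast_last (v : Equiv.Perm (Fin N)) :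
    liftLast v (Fin.last N) = Fin.last N := by simp [liftLast]

@[simp] theorem liftLast_castSucc (v : Equiv.Perm (Fin N)) (j : Fin N) :
    liftLast v j.castSucc = (v j).castSucc := by simp [liftLast]

theorem tcons_comp_liftFirst (t : ℝ) (x : Fin N → ℝ) (v : Equiv.Perm (Fin N)) :
    tcons t x ∘ liftFirst v = tcons t (x ∘ v) := by
  ext j; refine Fin.cases ?_ (fun k => ?_) j <;> simp

theorem tsnoc_comp_liftLast (t : ℝ) (x : Fin N → ℝ) (v : Equiv.Perm (Fin N)) :
    tsnoc x t ∘ liftLast v = tsnoc (x ∘ v) t := by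
  ext j; refine Fin.lastCases ?_ (fun k => ?_) j <;> simp

/-- The cycle which moves the last variable to the first place. -/
def cyc (N : ℕ) : Equiv.Perm (Fin (N + 1)) := (Fin.cycleRange (Fin.last N))⁻¹

theorem tsnoc_comp_cyc (x : Fin N → ℝ) (t : ℝ) : tsnoc x t ∘ cyc N = tcons t x := by
  have := Fin.insertNth_comp_cycleRange_symm (Fin.last N) t x
  rwa [Fin.insertNth_last'] at this

theorem tcons_comp_cyc_inv (x : Fin N → ℝ) (t : ℝ) :
    tcons t x ∘ ((cyc N)⁻¹ : Equiv.Perm (Fin (N + 1))) = tsnoc x t := by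
  rw [← tsnoc_comp_cyc]
  ext j
  simp

theorem perm_ext {π ρ : Equiv.Perm (Fin N)} (h : ∀ y : Fin N → ℝ, y ∘ π = y ∘ ρ) : π = ρ := by
  ext j
  have := congrFun (h fun k => (k : ℕ)) j
  simpa using this

/-- The pair `(j + 1, k + 1)`. -/
def AdjPair.succ (p : AdjPair N) : AdjPair (N + 1) :=
  ⟨(p.1.1.succ, p.1.2.succ), by have := p.2; simp only [Fin.val_succ]; omega⟩

/-- The pair `(j, k)` in a larger set. -/
def AdjPair.castSucc (p : AdjPair N) : AdjPair (N + 1) :=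
  ⟨(p.1.1.castSucc, p.1.2.castSucc), p.2⟩

/-- The first pair. -/
def firstPair (N : ℕ) : AdjPair (N + 2) := ⟨(0, 1), rfl⟩

/-- The last pair. -/
def lastPair (N : ℕ) : AdjPair (N + 2) := ⟨((Fin.last N).castSucc, Fin.last (N + 1)), rfl⟩

theorem liftFirst_swap (p : AdjPair N) : liftFirst p.swap = p.succ.swap := by
  ext j
  refine Fin.cases ?_ (fun k => ?_) j
  · simp [AdjPair.swap, AdjPair.succ, Equiv.swap_apply_of_ne_of_ne, (Fin.succ_ne_zero _).symm]
  · simp [AdjPair.swap, AdjPair.succ, Equiv.swap_apply_def, apply_ite Fin.val]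
    split_ifs <;> simp

theorem liftLast_swap (p : AdjPair N) : liftLast p.swap = p.castSucc.swap := by
  ext j
  refine Fin.lastCases ?_ (fun k => ?_) j
  · simp [AdjPair.swap, AdjPair.castSucc, Equiv.swap_apply_of_ne_of_ne,
      (Fin.castSucc_lt_last _).ne']
  · simp [AdjPair.swap, AdjPair.castSucc, Equiv.swap_apply_def, apply_ite Fin.val]

theorem tcons_tcons_comp_swap (a b : ℝ) (x : Fin N → ℝ) :
    tcons a (tcons b x) ∘ (firstPair N).swap = tcons b (tcons a x) := by
  ext j
  refine Fin.cases ?_ (fun k => ?_) j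
  · simp only [AdjPair.swap, firstPair, Function.comp_apply, Equiv.swap_apply_left]; rfl
  · refine Fin.cases ?_ (fun k => ?_) k
    · simp only [AdjPair.swap, firstPair, Function.comp_apply]
      rw [show (Fin.succ 0 : Fin (N + 2)) = 1 from rfl, Equiv.swap_apply_right]; rfl
    · simp only [AdjPair.swap, firstPair, Function.comp_apply]
      rw [Equiv.swap_apply_of_ne_of_ne (Fin.succ_ne_zero _)]
      · rfl
      · rw [← Fin.succ_zero_eq_one]
        exact fun h => Fin.succ_ne_zero _ (Fin.succ_injective _ h)

theorem tsnoc_tsnoc_comp_swap (a b : ℝ) (x : Fin N → ℝ) :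
    tsnoc (tsnoc x a) b ∘ (lastPair N).swap = tsnoc (tsnoc x b) a := by
  ext j
  refine Fin.lastCases ?_ (fun k => ?_) j
  · simp [AdjPair.swap, lastPair]
  · refine Fin.lastCases ?_ (fun k => ?_) k
    · simp [AdjPair.swap, lastPair]
    · simp only [AdjPair.swap, lastPair, Function.comp_apply]
      rw [Equiv.swap_apply_of_ne_of_ne]
      · simp
      · exact fun h => (Fin.castSucc_lt_last k).ne (Fin.castSucc_injective _ h)
      · exact (Fin.castSucc_lt_last _).ne

/-! ### Evaluating and creating a variable, and their commutation with the deformed action. -/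

variable (γ : ℝ)

/-- Evaluation of the first variable at `t`. -/
def evFirst (t : ℝ) : CF (N + 1) →ₗ[ℂ] CF N where
  toFun f := ⟨fun x => f (tcons t x), by fun_prop⟩
  map_add' _ _ := rfl
  map_smul' _ _ := rfl

/-- Evaluation of the last variable at `t`. -/
def evLast (t : ℝ) : CF (N + 1) →ₗ[ℂ] CF N where
  toFun f := ⟨fun x => f (tsnoc x t), by fun_prop⟩
  map_add' _ _ := rfl
  map_smul' _ _ := rfl

theorem evFirst_apply (t : ℝ) (f : CF (N + 1)) (x : Fin N → ℝ) :
    evFirst t f x = f (tcons t x) := rfl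

theorem evLast_apply (t : ℝ) (f : CF (N + 1)) (x : Fin N → ℝ) :
    evLast t f x = f (tsnoc x t) := rfl

theorem evFirst_evLast (s t : ℝ) (f : CF (N + 2)) :
    evFirst s (evLast t f) = evLast t (evFirst s f) := by
  ext x
  simp only [evFirst_apply, evLast_apply, tcons_tsnoc]

theorem evFirst_permOp (t : ℝ) (v : Equiv.Perm (Fin N)) (f : CF (N + 1)) :
    evFirst t (permOp (liftFirst v) f) = permOp v (evFirst t f) := by
  ext x
  simp only [evFirst_apply, permOp_apply, tcons_comp_liftFirst]

theorem evLast_permOp (t : ℝ) (v : Equiv.Perm (Fin N)) (f : CF (N + 1)) :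
    evLast t (permOp (liftLast v) f) = permOp v (evLast t f) := by
  ext x
  simp only [evLast_apply, permOp_apply, tsnoc_comp_liftLast]

theorem shift_tcons (t : ℝ) (j k : Fin N) (x : Fin N → ℝ) (y : ℝ) :
    shift j.succ k.succ (tcons t x) y = tcons t (shift j k x y) := by
  ext l
  refine Fin.cases ?_ (fun l => ?_) l
  · simp [shift_apply, (Fin.succ_ne_zero _).symm]
  · simp [shift_apply]

theorem shift_tsnoc (t : ℝ) (j k : Fin N) (x : Fin N → ℝ) (y : ℝ) :
    shift j.castSucc k.castSucc (tsnoc x t) y = tsnoc (shift j k x y) t := by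
  ext l
  refine Fin.lastCases ?_ (fun l => ?_) l
  · simp [shift_apply, (Fin.castSucc_lt_last _).ne']
  · simp [shift_apply]

theorem evFirst_intOp (t : ℝ) (j k : Fin N) (f : CF (N + 1)) :
    evFirst t (intOp j.succ k.succ f) = intOp j k (evFirst t f) := by
  ext x
  simp only [evFirst_apply, intOp_apply, tcons_succ, shift_tcons]

theorem evLast_intOp (t : ℝ) (j k : Fin N) (f : CF (N + 1)) :
    evLast t (intOp j.castSucc k.castSucc f) = intOp j k (evLast t f) := by
  ext x
  simp only [evLast_apply, intOp_apply, tsnoc_castSucc, shift_tsnoc]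

/-- The generators in the image of `liftFirst` neither move nor integrate over the first variable,
which is therefore a mere parameter. -/
theorem evFirst_reflHom (t : ℝ) (v : Equiv.Perm (Fin N)) (f : CF (N + 1)) :
    evFirst t (reflHom γ (N + 1) (liftFirst v) f) = reflHom γ N v (evFirst t f) := by
  induction v using perm_induction generalizing f with
  | h1 => rw [map_one, map_one, map_one]; rfl
  | hmul p w ih =>
    rw [map_mul, map_mul, map_mul, liftFirst_swap, reflHom_swap, reflHom_swap, Module.End.mul_apply,
      Module.End.mul_apply, ← ih]
    simp only [reflOp, LinearMap.add_apply, LinearMap.smul_apply, map_add, map_smul]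
    rw [← liftFirst_swap, evFirst_permOp]
    exact congrArg _ (congrArg _ (evFirst_intOp _ _ _ _))

theorem evLast_reflHom (t : ℝ) (v : Equiv.Perm (Fin N)) (f : CF (N + 1)) :
    evLast t (reflHom γ (N + 1) (liftLast v) f) = reflHom γ N v (evLast t f) := by
  induction v using perm_induction generalizing f with
  | h1 => rw [map_one, map_one, map_one]; rfl
  | hmul p w ih =>
    rw [map_mul, map_mul, map_mul, liftLast_swap, reflHom_swap, reflHom_swap, Module.End.mul_apply,
      Module.End.mul_apply, ← ih]
    simp only [reflOp, LinearMap.add_apply, LinearMap.smul_apply, map_add, map_smul]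
    rw [← liftLast_swap, evLast_permOp]
    exact congrArg _ (congrArg _ (evLast_intOp _ _ _ _))

/-- The operator `(B_μ g)(t, x) = exp (i μ t) g(x)`. -/
def createOp (μ : ℂ) : CF N →ₗ[ℂ] CF (N + 1) where
  toFun g := ⟨fun y => Complex.exp (Complex.I * μ * (y 0 : ℝ)) * g fun k => y k.succ, by fun_prop⟩
  map_add' f g := by ext; simp [mul_add]
  map_smul' c f := by ext; simp; ring

theorem createOp_tcons (μ : ℂ) (g : CF N) (t : ℝ) (x : Fin N → ℝ) :
    createOp μ g (tcons t x) = Complex.exp (Complex.I * μ * t) * g x := rfl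

theorem evFirst_createOp (μ : ℂ) (g : CF N) (t : ℝ) :
    evFirst t (createOp μ g) = Complex.exp (Complex.I * μ * t) • g := rfl

theorem ext_evFirst {f g : CF (N + 1)} (h : ∀ t, evFirst t f = evFirst t g) : f = g := by
  ext y
  obtain ⟨t, x, rfl⟩ := exists_eq_tcons y
  exact congrArg (fun F : CF N => F x) (h t)

theorem evLast_createOp (μ : ℂ) (g : CF (N + 1)) (t : ℝ) :
    evLast t (createOp μ g) = createOp μ (evLast t g) := by
  ext y
  obtain ⟨s, x, rfl⟩ := exists_eq_tcons y
  rw [evLast_apply, ← tcons_tsnoc, createOp_tcons, createOp_tcons, evLast_apply]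

theorem evFirst_permOp_createOp (μ : ℂ) (g : CF (N + 1)) (t : ℝ) :
    evFirst t (permOp (firstPair N).swap (createOp μ g)) = createOp μ (evFirst t g) := by
  ext y
  obtain ⟨s, x, rfl⟩ := exists_eq_tcons y
  rw [evFirst_apply, permOp_apply, tcons_tcons_comp_swap, createOp_tcons, createOp_tcons,
    evFirst_apply]

/-- After evaluation at a value of the first variable, `createOp μ g` is a scalar multiple of `g`,
so linearity suffices. -/
theorem reflHom_createOp (μ : ℂ) (g : CF N) (v : Equiv.Perm (Fin N)) :
    reflHom γ (N + 1) (liftFirst v) (createOp μ g) = createOp μ (reflHom γ N v g) := by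
  refine ext_evFirst fun t => ?_
  rw [evFirst_reflHom, evFirst_createOp, evFirst_createOp, map_smul]

theorem intOp_createOp (μ : ℂ) (g : CF N) (j k : Fin N) :
    intOp j.succ k.succ (createOp μ g) = createOp μ (intOp j k g) := by
  refine ext_evFirst fun t => ?_
  rw [evFirst_intOp, evFirst_createOp, evFirst_createOp, map_smul]

theorem permOp_createOp_createOp (μ ν : ℂ) (g : CF N) :
    permOp (firstPair N).swap (createOp μ (createOp ν g)) = createOp ν (createOp μ g) := by
  refine ext_evFirst fun t => ?_
  rw [evFirst_permOp_createOp, evFirst_createOp, map_smul, evFirst_createOp]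

/-- In the first two variables the function is $e^{i\mu s+i\nu t}$, and
$\int_0^{s-t}e^{-i(\mu-\nu)u}\,du$ is elementary: its two boundary values reproduce this exponential
and the one with $\mu,\nu$ exchanged. -/
theorem reflOp_createOp_createOp {μ ν : ℂ} (h : μ ≠ ν) (g : CF N) :
    reflOp γ (firstPair N) (createOp μ (createOp ν g)) =
      ((μ - ν + Complex.I * γ) / (μ - ν)) • createOp ν (createOp μ g) -
        ((Complex.I * γ) / (μ - ν)) • createOp μ (createOp ν g) := by
  have h' : μ - ν ≠ 0 := sub_ne_zero.2 h
  ext y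
  obtain ⟨s, y, rfl⟩ := exists_eq_tcons y
  obtain ⟨t, x, rfl⟩ := exists_eq_tcons y
  simp only [reflOp, LinearMap.add_apply, LinearMap.smul_apply, permOp_createOp_createOp,
    ContinuousMap.add_apply, ContinuousMap.smul_apply, ContinuousMap.sub_apply, createOp_tcons,
    smul_eq_mul]
  have e : ∀ u : ℝ, shift (0 : Fin (N + 2)) 1 (tcons s (tcons t x)) u =
      tcons (s - u) (tcons (t + u) x) := by
    intro u
    ext l
    refine Fin.cases ?_ (fun l => Fin.cases ?_ (fun l => ?_) l) l
    · simp [shift_apply]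
    · have : tcons s (tcons t x) 1 = t := rfl
      have : tcons (s - u) (tcons (t + u) x) 1 = t + u := rfl
      simp [shift_apply, *]
    · have h1 : (l.succ.succ : Fin (N + 2)) ≠ 1 := by
        rw [← Fin.succ_zero_eq_one]
        exact fun h => Fin.succ_ne_zero _ (Fin.succ_injective _ h)
      simp [shift_apply, h1]
  have hI : intOp (firstPair N).1.1 (firstPair N).1.2 (createOp μ (createOp ν g))
      (tcons s (tcons t x)) = Complex.exp (Complex.I * μ * s) * Complex.exp (Complex.I * ν * t) *
        g x * ∫ u in (0 : ℝ)..(s - t), Complex.exp (-(Complex.I * (μ - ν)) * u) := by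
    rw [← intervalIntegral.integral_const_mul]
    change ∫ u in (0 : ℝ)..(s - t), _ = _
    congr 1
    ext u
    simp only [firstPair, e, createOp_tcons]
    rw [show ∀ a b c d : ℂ, a * b * c * d = a * d * b * c by intros; ring, ← Complex.exp_add,
      ← mul_assoc, ← Complex.exp_add, ← Complex.exp_add]
    congr 2
    push_cast
    ring
  have hc : -(Complex.I * (μ - ν)) ≠ 0 := neg_ne_zero.2 (mul_ne_zero Complex.I_ne_zero h')
  rw [hI, integral_exp_mul_complex hc]
  -- At the upper limit `u = s - t` the factor exchanges the roles of `μ` and `ν`.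
  have e2 : Complex.exp (-(Complex.I * (μ - ν)) * ((s - t : ℝ) : ℂ)) *
      (Complex.exp (Complex.I * μ * s) * Complex.exp (Complex.I * ν * t)) =
      Complex.exp (Complex.I * ν * s) * Complex.exp (Complex.I * μ * t) := by
    rw [← Complex.exp_add, ← Complex.exp_add, ← Complex.exp_add]
    congr 1
    push_cast
    ring
  simp only [Complex.ofReal_zero, mul_zero, Complex.exp_zero]
  generalize Complex.exp (-(Complex.I * (μ - ν)) * ((s - t : ℝ) : ℂ)) = c at e2 ⊢
  generalize Complex.exp (Complex.I * μ * s) = a at e2 ⊢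
  generalize Complex.exp (Complex.I * ν * t) = b at e2 ⊢
  generalize Complex.exp (Complex.I * ν * s) = d₁ at e2 ⊢
  generalize Complex.exp (Complex.I * μ * t) = d₂ at e2 ⊢
  field_simp
  linear_combination (-(γ * g x)) * e2 + (γ * g x * (a * b - d₁ * d₂)) * Complex.I_sq

end Adjoin

/-! ### The operators on continuous functions which correspond to `a` and `c` -/

section Symbols

variable (γ : ℝ) {N : ℕ}

theorem cyc_succ_eq (N : ℕ) : cyc (N + 1) = liftFirst (cyc N) * (firstPair N).swap := by
  refine perm_ext fun y => ?_
  obtain ⟨w, t, rfl⟩ := exists_eq_tsnoc y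
  obtain ⟨b, x, rfl⟩ := exists_eq_tcons w
  rw [tsnoc_comp_cyc, Equiv.Perm.coe_mul, ← Function.comp_assoc, ← tcons_tsnoc,
    tcons_comp_liftFirst, tsnoc_comp_cyc, tcons_tcons_comp_swap]

/-- The permutation occurring in `evalOp ∘ presOp` is a conjugate of the first simple transposition.
This lets the commutator `anniOp` be computed in `anniOp_apply`. -/
theorem liftLast_cyc_inv_mul (N : ℕ) : liftLast (cyc N)⁻¹ * cyc (N + 1) =
    liftFirst (cyc N) * (firstPair N).swap * liftFirst (cyc N)⁻¹ := by
  refine perm_ext fun y => ?_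
  obtain ⟨w, t, rfl⟩ := exists_eq_tsnoc y
  obtain ⟨b, x, rfl⟩ := exists_eq_tcons w
  rw [Equiv.Perm.coe_mul, Equiv.Perm.coe_mul, Equiv.Perm.coe_mul, ← Function.comp_assoc,
    ← Function.comp_assoc, ← Function.comp_assoc, tsnoc_comp_liftLast, tcons_comp_cyc_inv,
    tsnoc_comp_cyc, ← tcons_tsnoc, tcons_comp_liftFirst, tsnoc_comp_cyc, tcons_tcons_comp_swap,
    tcons_comp_liftFirst, tcons_comp_cyc_inv]

theorem liftLast_liftFirst (v : Equiv.Perm (Fin N)) :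
    liftLast (liftFirst v) = liftFirst (liftLast v) := by
  refine perm_ext fun y => ?_
  obtain ⟨w, t, rfl⟩ := exists_eq_tsnoc y
  obtain ⟨b, x, rfl⟩ := exists_eq_tcons w
  rw [tsnoc_comp_liftLast, tcons_comp_liftFirst, ← tcons_tsnoc, ← tcons_tsnoc,
    tcons_comp_liftFirst, tsnoc_comp_liftLast]

/-- The permutation in parentheses takes $(a,x,b,c)$ to $(a,b,c,x)$, so exchanging the last two
variables before it amounts to exchanging places two and three after it. -/
theorem lastPair_swap_mul (N : ℕ) :
    (lastPair (N + 1)).swap * (liftLast (liftFirst (cyc N)) * liftFirst (liftFirst (cyc N))) =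
      liftLast (liftFirst (cyc N)) * liftFirst (liftFirst (cyc N)) * (firstPair N).succ.swap := by
  refine perm_ext fun y => ?_
  obtain ⟨w, c, rfl⟩ := exists_eq_tsnoc y
  obtain ⟨w, b, rfl⟩ := exists_eq_tsnoc w
  obtain ⟨a, x, rfl⟩ := exists_eq_tcons w
  have key : ∀ b c : ℝ, tsnoc (tsnoc (tcons a x) b) c ∘
      (liftLast (liftFirst (cyc N)) * liftFirst (liftFirst (cyc N)) : Equiv.Perm (Fin (N + 3))) =
      tcons a (tcons b (tcons c x)) := by
    intro b c
    rw [Equiv.Perm.coe_mul, ← Function.comp_assoc, tsnoc_comp_liftLast, ← tcons_tsnoc,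
      tcons_comp_liftFirst, tsnoc_comp_cyc, ← tcons_tsnoc, ← tcons_tsnoc,
      tcons_comp_liftFirst, tcons_comp_liftFirst, tsnoc_comp_cyc]
  rw [Equiv.Perm.coe_mul, ← Function.comp_assoc, tsnoc_tsnoc_comp_swap, key,
    Equiv.Perm.coe_mul _ (firstPair N).succ.swap, ← Function.comp_assoc, key, ← liftFirst_swap,
    tcons_comp_liftFirst, tcons_tcons_comp_swap]

/-- The operator on continuous functions which the propagation operator intertwines with `a⁺_μ`, if
`t` is the left end point. -/
def presOp (μ : ℂ) (t : ℝ) : CF N →ₗ[ℂ] CF N :=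
  evLast t ∘ₗ reflHom γ (N + 1) (cyc N) ∘ₗ createOp μ

/-- The operator on continuous functions which the propagation operator intertwines with setting
the last variable equal to the right end point `s`. -/
def evalOp (s : ℝ) : CF (N + 1) →ₗ[ℂ] CF N :=
  evFirst s ∘ₗ reflHom γ (N + 1) (cyc N)⁻¹

/-- The operator on continuous functions which the propagation operator intertwines with `c⁺_μ`, if
`t` and `s` are the left and right end points. -/
def anniOp (μ : ℂ) (t s : ℝ) : CF (N + 1) →ₗ[ℂ] CF N :=
  evalOp γ s ∘ₗ presOp γ μ t - presOp γ μ t ∘ₗ evalOp γ s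

theorem presOp_apply (μ : ℂ) (t : ℝ) (g : CF N) :
    presOp γ μ t g = evLast t (reflHom γ (N + 1) (cyc N) (createOp μ g)) := rfl

theorem evalOp_apply (s : ℝ) (g : CF (N + 1)) :
    evalOp γ s g = evFirst s (reflHom γ (N + 1) (cyc N)⁻¹ g) := rfl

/-- The long cycle is the cycle in the last $N+1$ variables times $s_1$. The factor $s_1^\gamma$
acts on $B_\mu B_\nu g$ by the two-term formula; the remaining cycle and the evaluation commute with
the outer $B$. -/
theorem presOp_createOp {μ ν : ℂ} (h : μ ≠ ν) (t : ℝ) (g : CF N) :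
    presOp γ μ t (createOp ν g) =
      ((μ - ν + Complex.I * γ) / (μ - ν)) • createOp ν (presOp γ μ t g) -
        ((Complex.I * γ) / (μ - ν)) • createOp μ (presOp γ ν t g) := by
  have e : ∀ μ ν : ℂ, evLast t (reflHom γ (N + 2) (liftFirst (cyc N)) (createOp μ (createOp ν g))) =
      createOp μ (presOp γ ν t g) := by
    intro μ ν
    rw [reflHom_createOp, evLast_createOp, presOp_apply]
  rw [presOp_apply, cyc_succ_eq, map_mul, reflHom_swap, Module.End.mul_apply,
    reflOp_createOp_createOp γ h, map_sub, map_sub, map_smul, map_smul, map_smul, map_smul, e, e]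

/-- The two compositions in the commutator differ only in the middle factor, which is
$s_1^\gamma=s_1+\gamma I_{12}$ in one and the plain $s_1$ in the other. -/
theorem anniOp_apply (μ : ℂ) (t s : ℝ) (g : CF (N + 1)) :
    anniOp γ μ t s g = evFirst s (evLast t (reflHom γ (N + 2) (liftFirst (cyc N))
      ((γ : ℂ) • intOp 0 1 (reflHom γ (N + 2) (liftFirst (cyc N)⁻¹) (createOp μ g))))) := by
  have h1 : evalOp γ s (presOp γ μ t g) = evFirst s (evLast t (reflHom γ (N + 2)
      (liftFirst (cyc N)) (reflOp γ (firstPair N) (reflHom γ (N + 2) (liftFirst (cyc N)⁻¹)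
        (createOp μ g))))) := by
    rw [evalOp_apply, presOp_apply, ← evLast_reflHom, ← Module.End.mul_apply, ← map_mul,
      liftLast_cyc_inv_mul, map_mul, map_mul, reflHom_swap]
    rfl
  have h2 : presOp γ μ t (evalOp γ s g) = evFirst s (evLast t (reflHom γ (N + 2)
      (liftFirst (cyc N)) (permOp (firstPair N).swap (reflHom γ (N + 2) (liftFirst (cyc N)⁻¹)
        (createOp μ g))))) := by
    rw [reflHom_createOp, evFirst_evLast, evFirst_reflHom, evFirst_permOp_createOp, presOp_apply,
      evalOp_apply]
  rw [anniOp, LinearMap.sub_apply, LinearMap.comp_apply, LinearMap.comp_apply, h1, h2, reflOp,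
    LinearMap.add_apply, map_add, map_add, map_add, add_sub_cancel_left]
  rfl

theorem reflHom_liftFirst_liftFirst_comm {T : Module.End ℂ (CF (N + 2))}
    (hT : ∀ p : AdjPair N, Commute (reflOp γ p.succ.succ) T) (v : Equiv.Perm (Fin N)) :
    Commute (reflHom γ (N + 2) (liftFirst (liftFirst v))) T := by
  induction v using perm_induction with
  | h1 => simp
  | hmul p w ih =>
    rw [map_mul, map_mul, map_mul, liftFirst_swap, liftFirst_swap, reflHom_swap]
    exact (hT p).mul_left ih

theorem commute_liftFirst_liftFirst_intOp (v : Equiv.Perm (Fin N)) :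
    Commute (reflHom γ (N + 2) (liftFirst (liftFirst v))) (intOp 0 1) := by
  refine reflHom_liftFirst_liftFirst_comm γ (fun p => ?_) v
  refine commute_reflOp_intOp γ _ ?_ ?_ ?_ ?_ <;> simp [AdjPair.succ, Fin.ext_iff]

theorem commute_liftFirst_liftFirst_permOp (v : Equiv.Perm (Fin N)) :
    Commute (reflHom γ (N + 2) (liftFirst (liftFirst v))) (permOp (firstPair N).swap) := by
  refine reflHom_liftFirst_liftFirst_comm γ (fun p => ?_) v
  refine commute_reflOp_permOp_swap γ _ ?_ ?_ ?_ ?_ <;>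
    simp [AdjPair.succ, Fin.ext_iff, firstPair]

/-- The instance of the Yang-Baxter equation behind the relations of `c` and `a`. -/
theorem intOp_mul_reflOp_add (N : ℕ) :
    intOp 0 1 * reflOp γ (firstPair N).succ + intOp 0 2 =
      permOp (firstPair (N + 1)).swap * intOp 1 2 * permOp (firstPair (N + 1)).swap *
        reflOp γ (firstPair (N + 1)) * permOp (firstPair (N + 1)).swap +
      reflOp γ (firstPair N).succ * intOp 0 2 := by
  set s : Module.End ℂ (CF (N + 3)) := permOp (firstPair (N + 1)).swap with hs
  set t : Module.End ℂ (CF (N + 3)) := permOp (firstPair N).succ.swap with ht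
  have h01 : (0 : Fin (N + 3)) ≠ 1 := Fin.ne_of_val_ne (by simp)
  have h02 : (0 : Fin (N + 3)) ≠ 2 := Fin.ne_of_val_ne (by rw [Fin.val_two]; simp)
  have h12 : (1 : Fin (N + 3)) ≠ 2 := Fin.ne_of_val_ne (by rw [Fin.val_two]; simp)
  have es : (firstPair (N + 1)).swap = Equiv.swap 0 1 := rfl
  have et : (firstPair N).succ.swap = Equiv.swap 1 2 := rfl
  have hss : s * s = 1 := by rw [hs, ← map_mul, es, Equiv.swap_mul_self, map_one]
  have h1 : s * intOp 1 2 = intOp 0 2 * s := by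
    rw [hs, permOp_mul_intOp, es, Equiv.swap_apply_right,
      Equiv.swap_apply_of_ne_of_ne h02.symm h12.symm]
  have h2 : intOp 0 1 * s = intOp 0 1 := intOp_mul_permOp_swap 0 1
  have h3 : t * intOp 0 2 = intOp 0 1 * t := by
    rw [ht, permOp_mul_intOp, et, Equiv.swap_apply_right, Equiv.swap_apply_of_ne_of_ne h01 h02]
  have h4 := intOp_yangBaxter h01 h02 h12
  have e1 : s * intOp 1 2 * s = intOp 0 2 := by rw [h1, mul_assoc, hss, mul_one]
  change intOp 0 1 * (t + (γ : ℂ) • intOp 1 2) + intOp 0 2 =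
    s * intOp 1 2 * s * (s + (γ : ℂ) • intOp 0 1) * s + (t + (γ : ℂ) • intOp 1 2) * intOp 0 2
  -- What survives on both sides is $I_{01}t+I_{02}$ plus $\gamma$ times a side of the Yang-Baxter
  -- equation for the indices 0, 1, 2.
  rw [e1, mul_assoc (intOp 0 2), add_mul, hss, smul_mul_assoc, h2]
  simp only [mul_add, add_mul, smul_mul_assoc, mul_smul_comm, h3, h4, mul_one]
  module

/-- Where the last two coordinates agree, their exchange does nothing and the integral has length
zero. -/
theorem evLast_evLast_reflOp (t : ℝ) (f : CF (N + 2)) :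
    evLast t (evLast t (reflOp γ (lastPair N) f)) = evLast t (evLast t f) := by
  ext x
  have h : ∀ t : ℝ, tsnoc (tsnoc x t) t (lastPair N).1.1 = t ∧
      tsnoc (tsnoc x t) t (lastPair N).1.2 = t := fun t => by simp [lastPair]
  simp only [evLast_apply, reflOp, LinearMap.add_apply, LinearMap.smul_apply, permOp_apply,
    ContinuousMap.add_apply, ContinuousMap.smul_apply, intOp_apply, tsnoc_tsnoc_comp_swap, (h t).1,
    (h t).2]
  simp

/-- With $k$ the image of $g$ under the deformed inverse cycle, every composition becomes one
functional `X` of an operator applied to $B_\mu B_\nu k$ or $B_\nu B_\mu k$. `X` evaluates two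
variables at the same point `t`, hence absorbs $s_2^\gamma$. Then `intOp_mul_reflOp_add` and the
two-term formula for $s_1^\gamma B_\nu B_\mu$ give the relation. -/
theorem anniOp_presOp {μ ν : ℂ} (h : μ ≠ ν) (t s : ℝ) (g : CF (N + 1)) :
    anniOp γ μ t s (presOp γ ν t g) =
      ((μ - ν - Complex.I * γ) / (μ - ν)) • presOp γ ν t (anniOp γ μ t s g) +
        ((Complex.I * γ) / (μ - ν)) • presOp γ μ t (anniOp γ ν t s g) := by
  set X : CF (N + 3) →ₗ[ℂ] CF N := evFirst s ∘ₗ evLast t ∘ₗ evLast t ∘ₗ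
    reflHom γ (N + 3) (liftLast (liftFirst (cyc N)) * liftFirst (liftFirst (cyc N))) with hX
  set k := reflHom γ (N + 1) (cyc N)⁻¹ g with hk
  have hXσ : ∀ f, X (reflOp γ (firstPair N).succ f) = X f := by
    intro f
    simp only [hX, LinearMap.comp_apply]
    rw [← reflHom_swap, ← Module.End.mul_apply, ← map_mul, ← lastPair_swap_mul, map_mul,
      reflHom_swap, Module.End.mul_apply, evLast_evLast_reflOp]
  have hL : anniOp γ μ t s (presOp γ ν t g) = X ((γ : ℂ) • intOp 0 1
      (reflOp γ (firstPair N).succ (createOp μ (createOp ν k)))) := by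
    have e0 : reflHom γ (N + 3) (liftLast (liftFirst (cyc N)⁻¹))
        (reflHom γ (N + 3) (liftFirst (cyc (N + 1))) (createOp μ (createOp ν g))) =
        reflHom γ (N + 3) (liftFirst (liftFirst (cyc N))) (reflOp γ (firstPair N).succ
          (createOp μ (createOp ν k))) := by
      rw [← Module.End.mul_apply, ← map_mul, liftLast_liftFirst, ← map_mul, liftLast_cyc_inv_mul,
        map_mul liftFirst, map_mul liftFirst, liftFirst_swap, map_mul, map_mul, reflHom_swap,
        Module.End.mul_apply, Module.End.mul_apply, reflHom_createOp, reflHom_createOp]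
    have e1 : createOp μ (presOp γ ν t g) = evLast t (reflHom γ (N + 3) (liftFirst (cyc (N + 1)))
        (createOp μ (createOp ν g))) := by
      rw [presOp_apply, reflHom_createOp, evLast_createOp]
    have e2 : ∀ f : CF (N + 3), intOp 0 1 (evLast t f) = evLast t (intOp 0 1 f) := fun f =>
      (evLast_intOp t 0 1 f).symm
    rw [anniOp_apply, e1, ← evLast_reflHom, e0, e2, ← map_smul, ← evLast_reflHom]
    simp only [hX, LinearMap.comp_apply, map_mul, Module.End.mul_apply]
    rw [← Module.End.mul_apply (intOp 0 1) (reflHom γ (N + 3) (liftFirst (liftFirst (cyc N)))),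
      ← (commute_liftFirst_liftFirst_intOp γ (cyc N)).eq, Module.End.mul_apply, map_smul, map_smul,
      map_smul, map_smul, map_smul, map_smul]
    rfl
  -- The outer creation raises the indices of the integral operator to `1, 2`; exchanging the first
  -- two variables lets the evaluation at `s` pass the outer creation.
  have hR : ∀ μ ν : ℂ, presOp γ ν t (anniOp γ μ t s g) = X ((γ : ℂ) • permOp (firstPair (N +
    1)).swap
      (intOp 1 2 (createOp ν (createOp μ k)))) := by
    intro μ ν
    have e1 : ∀ f : CF (N + 3), permOp (firstPair N).swap (evLast t f) =
        evLast t (permOp (firstPair (N + 1)).swap f) := by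
      intro f
      rw [← evLast_permOp, liftLast_swap]
      rfl
    have e2 : ∀ f : CF (N + 2), createOp ν (intOp 0 1 f) = intOp 1 2 (createOp ν f) := fun f =>
      (intOp_createOp ν f 0 1).symm
    rw [presOp_apply, anniOp_apply, ← evFirst_permOp_createOp, ← evLast_createOp, e1,
      ← evFirst_reflHom, ← evFirst_evLast, ← evLast_reflHom, ← reflHom_createOp, map_smul, e2,
      reflHom_createOp γ μ g]
    have e3 : ∀ f : CF (N + 3), permOp (firstPair (N + 1)).swap
        (reflHom γ (N + 3) (liftFirst (liftFirst (cyc N))) f) =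
        reflHom γ (N + 3) (liftFirst (liftFirst (cyc N))) (permOp (firstPair (N + 1)).swap f) :=
      fun f => congrArg (fun T : Module.End ℂ (CF (N + 3)) => T f)
        (commute_liftFirst_liftFirst_permOp γ (cyc N)).eq.symm
    refine congrArg (evFirst s ∘ₗ evLast t ∘ₗ evLast t ∘ₗ
      reflHom γ (N + 3) (liftLast (liftFirst (cyc N)))) (e3 _) |>.trans ?_
    simp only [hX, LinearMap.comp_apply, map_mul, Module.End.mul_apply, map_smul]
    rw [hk]
  have key := congrArg (fun T : Module.End ℂ (CF (N + 3)) => X (T (createOp μ (createOp ν k))))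
    (intOp_mul_reflOp_add γ N)
  simp only [LinearMap.add_apply, Module.End.mul_apply, map_add, hXσ,
    permOp_createOp_createOp, reflOp_createOp_createOp γ h.symm, map_sub, map_smul] at key
  -- The two terms with $I_{02}$ cancel because `X` absorbs the factor $s_2^\gamma$ in one of them.
  rw [add_left_inj] at key
  have c1 : (μ - ν - Complex.I * γ) / (μ - ν) = (ν - μ + Complex.I * γ) / (ν - μ) := by
    rw [← neg_div_neg_eq]; congr 1 <;> ring
  have c2 : Complex.I * γ / (μ - ν) = -(Complex.I * γ / (ν - μ)) := by
    rw [← neg_sub ν μ, div_neg]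
  rw [hL, hR μ ν, hR ν μ, c1, c2]
  simp only [map_smul]
  rw [key]
  module

/-! ### The propagation operator and the adjunction of a largest or smallest variable -/

/-- Sorting leaves a smallest last variable in place, so only permutations of the other variables
act, and these commute with its evaluation. -/
theorem propagation_tsnoc (f : CF (N + 1)) {x : Fin N → ℝ} (hx : Function.Injective x) {t : ℝ}
    (ht : ∀ k, t < x k) : propagation γ f (tsnoc x t) = propagation γ (evLast t f) x := by
  obtain ⟨τ, hτ⟩ := exists_strictAnti hx
  have h : StrictAnti (tsnoc x t ∘ liftLast τ) := by
    rw [tsnoc_comp_liftLast]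
    intro i j
    refine Fin.lastCases ?_ (fun j => ?_) j
    · refine Fin.lastCases (fun h => absurd h (lt_irrefl _)) (fun i _ => ?_) i
      simpa using ht _
    · refine Fin.lastCases (fun h => absurd h (Fin.castSucc_lt_last j).not_gt) (fun i h => ?_) i
      simpa using hτ (Fin.castSucc_lt_castSucc_iff.1 h)
  rw [propagation_eq γ f _ h, propagation_eq γ _ _ hτ, ← evLast_reflHom, evLast_apply, map_inv
    liftLast,
    tsnoc_comp_liftLast]

theorem propagation_tcons (f : CF (N + 1)) {x : Fin N → ℝ} (hx : Function.Injective x) {t : ℝ}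
    (ht : ∀ k, x k < t) : propagation γ f (tcons t x) = propagation γ (evFirst t f) x := by
  obtain ⟨τ, hτ⟩ := exists_strictAnti hx
  have h : StrictAnti (tcons t x ∘ liftFirst τ) := by
    rw [tcons_comp_liftFirst]
    intro i j
    refine Fin.cases (fun h => absurd h (Fin.not_lt_zero _)) (fun j => ?_) j
    refine Fin.cases (fun _ => ?_) (fun i h => ?_) i
    · simpa using ht _
    · simpa using hτ (Fin.succ_lt_succ_iff.1 h)
  rw [propagation_eq γ f _ h, propagation_eq γ _ _ hτ, ← evFirst_reflHom, evFirst_apply, map_inv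
    liftFirst,
    tcons_comp_liftFirst]

/-- A smallest variable in first position is moved to the last one at the cost of the deformed
cycle; this explains the form of `presOp`. -/
theorem propagation_createOp_tcons (μ : ℂ) (g : CF N) {x : Fin N → ℝ} (hx : Function.Injective x)
    {t : ℝ} (ht : ∀ k, t < x k) :
    propagation γ (createOp μ g) (tcons t x) = propagation γ (presOp γ μ t g) x := by
  have hinj : Function.Injective (tsnoc x t) := injective_tsnoc.2 ⟨fun k => (ht k).ne', hx⟩
  rw [← tsnoc_comp_cyc, ← propagation_reflHom γ _ hinj, propagation_tsnoc γ _ hx ht, presOp_apply]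

theorem propagation_tsnoc_evalOp (g : CF (N + 1)) {x : Fin N → ℝ} (hx : Function.Injective x)
    {s : ℝ} (hs : ∀ k, x k < s) :
    propagation γ g (tsnoc x s) = propagation γ (evalOp γ s g) x := by
  have hinj : Function.Injective (tcons s x) := injective_tcons.2 ⟨fun k => (hs k).ne, hx⟩
  rw [← tcons_comp_cyc_inv, ← propagation_reflHom γ _ hinj, propagation_tcons γ _ hx hs,
    evalOp_apply]

end Symbols

/-! ### Measurable and locally bounded functions -/

section LocBdd

variable {N : ℕ}

/-- Measurable functions which are bounded on bounded sets. -/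
structure LocBdd (f : (Fin N → ℝ) → ℂ) : Prop where
  measurable : Measurable f
  bound : ∀ R : ℝ, ∃ C, ∀ x : Fin N → ℝ, (∀ k, |x k| ≤ R) → ‖f x‖ ≤ C

theorem locBdd_of_continuous {f : (Fin N → ℝ) → ℂ} (hf : Continuous f) : LocBdd f where
  measurable := hf.measurable
  bound R := by
    obtain ⟨C, hC⟩ := (isCompact_univ_pi fun _ : Fin N => isCompact_Icc (a := -R) (b := R)
      ).exists_bound_of_continuousOn hf.continuousOn
    exact ⟨C, fun x hx => hC x fun k _ => abs_le.1 (hx k)⟩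

theorem exists_abs_le_of_isCompact {X : Type*} [TopologicalSpace X] {K : Set X} (hK : IsCompact K)
    {c : X → Fin N → ℝ} (hc : Continuous c) : ∃ R : ℝ, ∀ y ∈ K, ∀ k, |c y k| ≤ R := by
  obtain ⟨R, hR⟩ := hK.exists_bound_of_continuousOn hc.continuousOn
  exact ⟨R, fun y hy k => by
    rw [← Real.norm_eq_abs]; exact (norm_le_pi_norm (c y) k).trans (hR y hy)⟩

theorem LocBdd.intervalIntegrable {f : (Fin N → ℝ) → ℂ} (hf : LocBdd f) {c : ℝ → Fin N → ℝ}
    (hc : Continuous c) {e : ℝ → ℂ} (he : Continuous e) (a b : ℝ) :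
    IntervalIntegrable (fun y => e y * f (c y)) volume a b := by
  obtain ⟨R, hR⟩ := exists_abs_le_of_isCompact (isCompact_uIcc (a := a) (b := b)) hc
  obtain ⟨C, hC⟩ := hf.bound R
  obtain ⟨D, hD⟩ := (isCompact_uIcc (a := a) (b := b)).exists_bound_of_continuousOn he.continuousOn
  rw [intervalIntegrable_iff]
  refine Measure.integrableOn_of_bounded (M := D * C) (by rw [Real.volume_uIoc]; exact
    ENNReal.ofReal_ne_top)
    (he.measurable.mul (hf.measurable.comp hc.measurable)).aestronglyMeasurable ?_
  refine (ae_restrict_iff' measurableSet_uIoc).2 (Eventually.of_forall fun y hy => ?_)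
  have hy' := uIoc_subset_uIcc hy
  rw [norm_mul]
  exact mul_le_mul (hD y hy') (hC _ (hR y hy')) (norm_nonneg _) ((norm_nonneg _).trans (hD y hy'))

theorem measurableSet_sort_eq (σ : Equiv.Perm (Fin N)) :
    MeasurableSet {x : Fin N → ℝ | σ = Tuple.sort fun j => -x j} := by
  have : {x : Fin N → ℝ | σ = Tuple.sort fun j => -x j} =
      (⋂ a, ⋂ b, ⋂ _ : a ≤ b, {x | -x (σ a) ≤ -x (σ b)}) ∩
        ⋂ i, ⋂ j, ⋂ _ : i < j, {x | -x (σ i) = -x (σ j) → σ i < σ j} := by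
    ext x
    simp only [mem_inter_iff, mem_iInter]
    exact Tuple.eq_sort_iff
  rw [this]
  refine MeasurableSet.inter ?_ ?_
  · exact MeasurableSet.iInter fun a => MeasurableSet.iInter fun b => MeasurableSet.iInter
      fun _ => measurableSet_le (by fun_prop) (by fun_prop)
  · refine MeasurableSet.iInter fun a => MeasurableSet.iInter fun b => MeasurableSet.iInter
      fun _ => ?_
    by_cases h : σ a < σ b
    · simp [h]
    · have : {x : Fin N → ℝ | -x (σ a) = -x (σ b) → σ a < σ b} =
          {x : Fin N → ℝ | -x (σ a) = -x (σ b)}ᶜ := by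
        ext x; simp [h]
      rw [this]
      exact (measurableSet_eq_fun (by fun_prop) (by fun_prop)).compl

/-- The sorting permutation takes finitely many values, each on a measurable set, and on each such
set the propagated function is the restriction of a continuous one. -/
theorem locBdd_propagation (γ : ℝ) (f : CF N) : LocBdd (propagation γ f) where
  measurable := by
    have : propagation γ f = fun x => ∑ σ : Equiv.Perm (Fin N),
        {x : Fin N → ℝ | σ = Tuple.sort fun j => -x j}.indicator
          (fun x => reflHom γ N σ⁻¹ f (x ∘ σ)) x := by
      ext x
      rw [Finset.sum_eq_single (Tuple.sort fun j => -x j), propagation_apply]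
      · have hx : x ∈ {y : Fin N → ℝ | (Tuple.sort fun j => -x j) = Tuple.sort fun j => -y j} := rfl
        rw [indicator_of_mem hx]
      · intro σ _ hσ
        exact indicator_of_notMem (s := {x : Fin N → ℝ | σ = Tuple.sort fun j => -x j})
          (by simpa using hσ) _
      · simp
    rw [this]
    refine Finset.measurable_sum _ fun σ _ => Measurable.indicator ?_ (measurableSet_sort_eq σ)
    exact ((reflHom γ N σ⁻¹ f).continuous.comp
      (continuous_pi fun k => continuous_apply _)).measurable
  bound R := by
    choose C hC using fun σ : Equiv.Perm (Fin N) =>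
      (locBdd_of_continuous (reflHom γ N σ⁻¹ f).continuous).bound R
    refine ⟨∑ σ, |C σ|, fun x hx => ?_⟩
    rw [propagation_apply]
    refine (hC _ _ fun k => hx _).trans ((le_abs_self _).trans ?_)
    exact Finset.single_le_sum (f := fun σ => |C σ|) (fun _ _ => abs_nonneg _) (Finset.mem_univ _)

end LocBdd

/-! ### Partial derivatives -/

section Partial

variable {N : ℕ} (γ : ℝ)

/-- The continuous function `g` is the derivative of `f` with respect to the variable `j`. -/
def HasPartial (j : Fin N) (f g : CF N) : Prop :=
  ∀ x : Fin N → ℝ, HasDerivAt (fun v : ℝ => f (x + v • Pi.single j 1)) (g x) 0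

theorem HasPartial.hasDerivAt {j : Fin N} {f g : CF N} (h : HasPartial j f g) (x : Fin N → ℝ)
    (v : ℝ) : HasDerivAt (fun v : ℝ => f (x + v • Pi.single j 1)) (g (x + v • Pi.single j 1)) v :=
      by
  have h1 := h (x + v • Pi.single j 1)
  have h2 : HasDerivAt (fun w : ℝ => w - v) 1 v := (hasDerivAt_id v).sub_const v
  have h3 := HasDerivAt.scomp v (h := fun w : ℝ => w - v) (by simpa using h1) h2
  rw [one_smul] at h3
  refine h3.congr_of_eventuallyEq (Eventually.of_forall fun w => ?_)
  simp only [Function.comp_apply]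
  congr 1
  module

theorem hasPartial_createOp (μ : ℂ) (g : CF N) :
    HasPartial 0 (createOp μ g) ((Complex.I * μ) • createOp μ g) := by
  intro y
  obtain ⟨t, x, rfl⟩ := exists_eq_tcons y
  have e : ∀ v : ℝ, tcons t x + v • Pi.single 0 1 = tcons (t + v) x := by
    intro v
    ext j
    refine Fin.cases ?_ (fun k => ?_) j
    · simp
    · simp [(Fin.succ_ne_zero k)]
  simp only [e, createOp_tcons, ContinuousMap.smul_apply, smul_eq_mul]
  have h1 : HasDerivAt (fun v : ℝ => ((t + v : ℝ) : ℂ)) 1 0 := by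
    have := ((hasDerivAt_id (0 : ℝ)).const_add t).ofReal_comp
    simpa using this
  have h2 := ((h1.const_mul (Complex.I * μ)).cexp.mul_const (g x))
  refine h2.congr_deriv ?_
  simp only [add_zero]
  ring

/-- This is $\partial_{j+1}s_j^\gamma=s_j^\gamma\partial_j-\gamma$, a degenerate affine Hecke
relation. The term $-\gamma$ is the derivative of the upper limit of the integral. -/
theorem HasPartial.reflOp {p : AdjPair N} {f g : CF N} (h : HasPartial p.1.1 f g) :
    HasPartial p.1.2 (QNLS.reflOp γ p f) (QNLS.reflOp γ p g - (γ : ℂ) • f) := by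
  intro x
  have hne := p.ne
  set j := p.1.1 with hj
  set k := p.1.2 with hk
  set z := x ∘ p.swap with hz
  have e1 : ∀ v : ℝ, (x + v • Pi.single k 1) ∘ p.swap = z + v • Pi.single j 1 := by
    intro v
    ext l
    have : p.swap l = k ↔ l = j := by
      rw [AdjPair.swap, Equiv.swap_apply_eq_iff, ← hj, ← hk, Equiv.swap_apply_right]
    simp [hz, Pi.single_apply, this]
  -- Reversing the integration variable puts the whole dependence of the integrand on `v` into
  -- coordinate `j`, so that only the partial derivative of `f` in `j` is required.
  have e2 : ∀ v y : ℝ, shift j k (x + v • Pi.single k 1) (x j - x k - v - y) =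
      shift j k z (-y) + v • Pi.single j 1 := by
    intro v y
    ext l
    simp only [shift_apply, Pi.add_apply, Pi.smul_apply, Pi.single_apply, smul_eq_mul, hz,
      Function.comp_apply]
    rcases eq_or_ne l j with rfl | hlj
    · simp [hne, AdjPair.swap, ← hj, ← hk]; ring
    · rcases eq_or_ne l k with rfl | hlk
      · simp [hlj, AdjPair.swap, ← hj, ← hk]; ring
      · rw [AdjPair.swap, Equiv.swap_apply_of_ne_of_ne hlj hlk]
        simp [hlj, hlk]
  have e3 : ∀ v : ℝ, ∀ F : CF N, ∫ y in (0 : ℝ)..((x + v • Pi.single k 1 : Fin N → ℝ) j -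
      (x + v • Pi.single k 1 : Fin N → ℝ) k), F (shift j k (x + v • Pi.single k 1) y) =
      ∫ y in (0 : ℝ)..(x j - x k - v), F (shift j k z (-y) + v • Pi.single j 1) := by
    intro v F
    have e : (x + v • Pi.single k 1 : Fin N → ℝ) j - (x + v • Pi.single k 1 : Fin N → ℝ) k =
        x j - x k - v := by
      simp [hne]; ring
    have := intervalIntegral.integral_comp_sub_left (a := 0) (b := x j - x k - v)
      (fun y => F (shift j k (x + v • Pi.single k 1) y)) (x j - x k - v)
    rw [sub_self, sub_zero] at this
    rw [e, ← this]
    simp only [e2]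
  have hu : HasDerivAt (fun v : ℝ => x j - x k - v) (-1) 0 := by
    simpa using (hasDerivAt_id (0 : ℝ)).const_sub (x j - x k)
  have hd := hasDerivAt_integral_zero
    (K := fun v y => f (shift j k z (-y) + v • Pi.single j 1))
    (K' := fun v y => g (shift j k z (-y) + v • Pi.single j 1))
    (by simp only [Function.uncurry_def]; fun_prop) (by simp only [Function.uncurry_def]; fun_prop)
    (fun v y => h.hasDerivAt _ v) hu
  have hfirst := h z
  have hfun : (fun v : ℝ => QNLS.reflOp γ p f (x + v • Pi.single k 1)) =
      fun v => f (z + v • Pi.single j 1) +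
        (γ : ℂ) * ∫ y in (0 : ℝ)..(x j - x k - v), f (shift j k z (-y) + v • Pi.single j 1) := by
    ext v
    rw [← e3, ← e1]
    rfl
  rw [hfun]
  refine (hfirst.add (hd.const_mul (γ : ℂ))).congr_deriv ?_
  have h0 := e3 0 g
  simp only [zero_smul, add_zero, sub_zero] at h0
  -- At the upper limit the integrand is evaluated at `x` itself, which produces the summand `-γ f`.
  have e4 : shift j k z (-(x j - x k)) = x := by
    have := e2 0 (x j - x k)
    simp only [zero_smul, add_zero, sub_zero, sub_self] at this
    rw [← this]
    simp [shift]
  simp only [zero_smul, add_zero, sub_zero, e4, QNLS.reflOp, ContinuousMap.sub_apply,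
    LinearMap.add_apply, ContinuousMap.add_apply, LinearMap.smul_apply, ContinuousMap.smul_apply,
    permOp_apply, intOp_apply, smul_eq_mul, ← h0]
  simp only [neg_one_smul]
  ring

end Partial

/-! ### Insertion of a variable into a decreasing tuple -/

section Insertion

variable {N : ℕ} (γ : ℝ)

/-- The tuple `x` with `t` inserted at the place `m`. -/
def tins (m : Fin (N + 1)) (t : ℝ) (x : Fin N → ℝ) : Fin (N + 1) → ℝ := m.insertNth t x

theorem tins_same (m : Fin (N + 1)) (t : ℝ) (x : Fin N → ℝ) : tins m t x m = t := by
  simp [tins]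

theorem tins_succAbove (m : Fin (N + 1)) (t : ℝ) (x : Fin N → ℝ) (k : Fin N) :
    tins m t x (m.succAbove k) = x k := by
  simp [tins]

/-- The cycle which moves the variable at the place `m` to the first place. -/
def cycTo (m : Fin (N + 1)) : Equiv.Perm (Fin (N + 1)) := m.cycleRange⁻¹

theorem tins_comp_cycTo (m : Fin (N + 1)) (t : ℝ) (x : Fin N → ℝ) :
    tins m t x ∘ cycTo m = tcons t x :=
  Fin.insertNth_comp_cycleRange_symm m t x

theorem tcons_comp_cycTo_inv (m : Fin (N + 1)) (t : ℝ) (x : Fin N → ℝ) :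
    tcons t x ∘ ((cycTo m)⁻¹ : Equiv.Perm (Fin (N + 1))) = tins m t x := by
  rw [← tins_comp_cycTo m]
  ext j
  simp

theorem tins_eq_add (m : Fin (N + 1)) (t : ℝ) (x : Fin N → ℝ) :
    tins m t x = tins m 0 x + t • Pi.single m 1 := by
  ext j
  refine Fin.succAboveCases m ?_ (fun k => ?_) j
  · simp [tins_same]
  · simp [tins_succAbove, Fin.succAbove_ne]

theorem cycTo_zero : cycTo (0 : Fin (N + 1)) = 1 := by
  rw [cycTo, Fin.cycleRange_zero, inv_one]

/-- The pair `(i, i + 1)`. -/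
def stepPair (i : Fin N) : AdjPair (N + 1) := ⟨(i.castSucc, i.succ), rfl⟩

theorem cycTo_succ (i : Fin N) : cycTo i.succ = (stepPair i).swap * cycTo i.castSucc := by
  rw [cycTo, cycTo, inv_eq_iff_eq_inv, mul_inv_rev, inv_inv]
  ext j
  simp only [AdjPair.swap, stepPair, Equiv.swap_inv, Equiv.Perm.mul_apply]
  rcases lt_trichotomy j i.castSucc with h | h | h
  · rw [Equiv.swap_apply_of_ne_of_ne h.ne (h.trans Fin.castSucc_lt_succ).ne,
      Fin.coe_cycleRange_of_lt h, Fin.coe_cycleRange_of_lt (h.trans Fin.castSucc_lt_succ)]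
  · rw [h, Equiv.swap_apply_left, Fin.coe_cycleRange_of_lt Fin.castSucc_lt_succ,
      Fin.cycleRange_of_gt Fin.castSucc_lt_succ]
    simp
  · rcases (Fin.castSucc_lt_iff_succ_le.1 h).eq_or_lt with rfl | h'
    · rw [Equiv.swap_apply_right, Fin.cycleRange_self, Fin.cycleRange_self]
    · rw [Equiv.swap_apply_of_ne_of_ne h.ne' h'.ne', Fin.cycleRange_of_gt h,
        Fin.cycleRange_of_gt h']

theorem cycTo_succ_mul_swap (i : Fin N) :
    cycTo i.succ * Equiv.swap 0 i.succ = cycTo i.castSucc := by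
  have h0 : cycTo i.castSucc 0 = i.castSucc := Fin.cycleRange_symm_zero _
  have h1 : cycTo i.castSucc i.succ = i.succ := by
    rw [cycTo, Equiv.Perm.inv_eq_iff_eq, Fin.cycleRange_of_gt Fin.castSucc_lt_succ]
  rw [cycTo_succ, mul_assoc, Equiv.mul_swap_eq_swap_mul, h0, h1, ← mul_assoc]
  simp [AdjPair.swap, stepPair]

/-- The derivative is carried through the transpositions of the cycle one by one. Each contributes
$-\gamma$ times the cycle with that transposition omitted, and omitting it equals multiplying the
cycle by a transposition of the first variable (`cycTo_succ_mul_swap`). -/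
theorem HasPartial.reflHom_cycTo {f g : CF (N + 1)} (h : HasPartial 0 f g) (m : Fin (N + 1)) :
    HasPartial m (reflHom γ (N + 1) (cycTo m) f) (reflHom γ (N + 1) (cycTo m) g -
      (γ : ℂ) • ∑ k : Fin N with k.castSucc < m,
        reflHom γ (N + 1) (cycTo m * Equiv.swap 0 k.succ) f) := by
  induction m using Fin.induction with
  | zero => simpa [cycTo_zero] using h
  | succ i ih =>
    have h1 := HasPartial.reflOp γ (p := stepPair i) ih
    have hset : (Finset.univ.filter fun k : Fin N => k.castSucc < i.succ) =
        insert i (Finset.univ.filter fun k : Fin N => k.castSucc < i.castSucc) := by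
      ext k
      simp only [Finset.mem_filter, Finset.mem_univ, true_and, Finset.mem_insert, Fin.lt_def,
        Fin.ext_iff, Fin.val_castSucc, Fin.val_succ]
      omega
    rw [hset, Finset.sum_insert (by simp), cycTo_succ_mul_swap]
    rw [map_sub, map_smul, map_sum] at h1
    simp only [← reflHom_swap, ← Module.End.mul_apply, ← map_mul, ← mul_assoc, ← cycTo_succ] at h1
    have e : ∀ a b c : CF (N + 1), a - (γ : ℂ) • (b + c) = a - (γ : ℂ) • c - (γ : ℂ) • b := by
      intro a b c
      module
    rw [e]
    exact h1

theorem reflOp_apply_of_eq (p : AdjPair N) (f : CF N) {x : Fin N → ℝ} (h : x p.1.1 = x p.1.2) :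
    reflOp γ p f x = f x := by
  have e : x ∘ p.swap = x := by
    ext l
    simp only [Function.comp_apply, AdjPair.swap, Equiv.swap_apply_def]
    split_ifs with h1 h2
    · rw [h1, h]
    · rw [h2, h]
    · rfl
  rw [reflOp_apply, integralReflection, e, h]
  simp

theorem propagation_tcons_eq (f : CF (N + 1)) {z : Fin N → ℝ} (hz : StrictAnti z) {t : ℝ}
    {m : Fin (N + 1)} (h1 : ∀ k : Fin N, k.castSucc < m → t < z k)
    (h2 : ∀ k : Fin N, m ≤ k.castSucc → z k < t) :
    propagation γ f (tcons t z) = reflHom γ (N + 1) (cycTo m) f (tins m t z) := by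
  have h : StrictAnti (tcons t z ∘ ((cycTo m)⁻¹ : Equiv.Perm (Fin (N + 1)))) := by
    rw [tcons_comp_cycTo_inv]
    intro i j
    refine Fin.succAboveCases m ?_ (fun i => ?_) i <;> refine Fin.succAboveCases m ?_ (fun j =>
      ?_) j
    · exact fun h => absurd h (lt_irrefl _)
    · intro h
      rw [tins_same, tins_succAbove]
      exact h2 _ ((Fin.lt_succAbove_iff_le_castSucc _ _).1 h)
    · intro h
      rw [tins_same, tins_succAbove]
      exact h1 _ ((Fin.succAbove_lt_iff_castSucc_lt _ _).1 h)
    · intro h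
      rw [tins_succAbove, tins_succAbove]
      exact hz (Fin.succAbove_lt_succAbove_iff.1 h)
  rw [propagation_eq γ f _ h, inv_inv, tcons_comp_cycTo_inv]

theorem tcons_comp_swap_zero (t : ℝ) (x : Fin N → ℝ) (k : Fin N) :
    tcons t x ∘ Equiv.swap 0 k.succ = tcons (x k) (Function.update x k t) := by
  ext j
  refine Fin.cases ?_ (fun l => ?_) j
  · simp
  · by_cases h : l = k
    · subst h; simp
    · rw [Function.comp_apply, Equiv.swap_apply_of_ne_of_ne (Fin.succ_ne_zero l)
        (fun e => h (Fin.succ_injective _ e))]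
      simp [h]

/-- The integral equation satisfied by `P (B_μ g)` on a decreasing tuple `z`, for the first variable
between the coordinates `m - 1` and `m` of `z`. -/
theorem reflHom_cycTo_createOp (μ : ℂ) (g : CF N) {z : Fin N → ℝ} (hz : StrictAnti z)
    (m : Fin (N + 1)) : ∀ t : ℝ, (∀ k : Fin N, k.castSucc < m → t ≤ z k) →
      (∀ k : Fin N, m ≤ k.castSucc → z k ≤ t) →
      Complex.exp (-(Complex.I * μ) * t) * reflHom γ (N + 1) (cycTo m) (createOp μ g) (tins m t z) =
        g z + γ * ∑ k : Fin N with k.castSucc < m, ∫ y in t..z k,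
          Complex.exp (-(Complex.I * μ) * y) *
            propagation γ (createOp μ g) (tcons (z k) (Function.update z k y)) := by
  set f := createOp μ g with hf
  set G : Fin N → ℝ → ℂ := fun k y => Complex.exp (-(Complex.I * μ) * y) *
    propagation γ f (tcons (z k) (Function.update z k y)) with hG
  have hGint : ∀ k a b, IntervalIntegrable (G k) volume a b := by
    intro k a b
    refine (locBdd_propagation γ f).intervalIntegrable
      (c := fun y => tcons (z k) (Function.update z k y)) ?_ (by fun_prop) a b
    exact continuous_tcons continuous_const (continuous_const.update k continuous_id)
  induction m using Fin.induction with
  | zero =>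
    intro t _ _
    have e : tins 0 t z = tcons t z := by
      rw [← tcons_comp_cycTo_inv, cycTo_zero]; rfl
    rw [cycTo_zero, map_one, Module.End.one_apply, e, hf, createOp_tcons, ← mul_assoc,
      ← Complex.exp_add]
    simp
  | succ i ih =>
    intro t ht1 ht2
    have hti : t ≤ z i := ht1 i Fin.castSucc_lt_succ
    -- The induction hypothesis serves as initial value: it is used where `t` meets the coordinate
    -- `z i`.
    have hih := ih (z i) (fun k hk => (hz (Fin.castSucc_lt_castSucc_iff.1 hk)).le)
      (fun k hk => hz.antitone (Fin.castSucc_le_castSucc_iff.1 hk))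
    set m := i.succ with hm
    -- At `t = z i` the expressions for adjacent places agree, because the additional reflection
    -- acts trivially at points with equal coordinates.
    have hstart : reflHom γ (N + 1) (cycTo m) f (tins m (z i) z) =
        reflHom γ (N + 1) (cycTo i.castSucc) f (tins i.castSucc (z i) z) := by
      have e1 : tins m (z i) z ∘ (stepPair i).swap = tins i.castSucc (z i) z := by
        rw [← tcons_comp_cycTo_inv i.castSucc, ← tins_comp_cycTo m, hm, cycTo_succ]
        ext j; simp
      have e2 : tins m (z i) z (stepPair i).1.1 = tins m (z i) z (stepPair i).1.2 := by
        have h1 : (stepPair i).1.1 = i.succ.succAbove i := by simp [stepPair]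
        rw [h1, hm, tins_succAbove]
        exact (tins_same _ _ _).symm
      have e3 : tins m (z i) z ∘ (stepPair i).swap = tins m (z i) z := by
        ext l
        simp only [Function.comp_apply, AdjPair.swap, Equiv.swap_apply_def]
        split_ifs with h1 h2
        · rw [h1, e2]
        · rw [h2, e2]
        · rfl
      rw [← e1, e3, hm, cycTo_succ, map_mul, reflHom_swap, Module.End.mul_apply,
        reflOp_apply_of_eq γ _ _ e2]
    have hpart := HasPartial.reflHom_cycTo γ (hasPartial_createOp μ g) m
    rw [← hf] at hpart
    set D : ℝ → ℂ := fun y => Complex.exp (-(Complex.I * μ) * y) * ∑ k : Fin N with k.castSucc < m,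
      reflHom γ (N + 1) (cycTo m * Equiv.swap 0 k.succ) f (tins m y z) with hD
    -- The exponential factor removes the contribution of the derivative of `createOp μ g`; only the
    -- $\gamma$-terms remain.
    have hder : ∀ y : ℝ, HasDerivAt (fun t : ℝ => Complex.exp (-(Complex.I * μ) * t) *
        reflHom γ (N + 1) (cycTo m) f (tins m t z)) (-(γ * D y)) y := by
      intro y
      have h1 := hpart.hasDerivAt (tins m 0 z) y
      simp only [← tins_eq_add] at h1
      have h2 : HasDerivAt (fun t : ℝ => Complex.exp (-(Complex.I * μ) * t))
          (Complex.exp (-(Complex.I * μ) * y) * -(Complex.I * μ)) y := by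
        have := ((hasDerivAt_id y).ofReal_comp.const_mul (-(Complex.I * μ))).cexp
        simpa using this
      refine (h2.mul h1).congr_deriv ?_
      simp only [hD, ContinuousMap.sub_apply, ContinuousMap.smul_apply, map_smul,
        ContinuousMap.coe_sum, Finset.sum_apply, smul_eq_mul]
      ring
    have hDc : Continuous D := by
      have hc : Continuous fun y : ℝ => tins m y z := by
        rw [show (fun y : ℝ => tins m y z) = fun y : ℝ => tins m 0 z + y • Pi.single m 1 from
          funext fun y => tins_eq_add m y z]
        fun_prop
      exact Continuous.mul (by fun_prop) (continuous_finsetSum _ fun k _ =>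
        (ContinuousMap.continuous _).comp hc)
    have hftc := intervalIntegral.integral_eq_sub_of_hasDerivAt (a := t) (b := z i)
      (fun y _ => hder y) ((continuous_const.mul hDc).neg.intervalIntegrable _ _)
    have hset : (Finset.univ.filter fun k : Fin N => k.castSucc < i.succ) =
        insert i (Finset.univ.filter fun k : Fin N => k.castSucc < i.castSucc) := by
      ext k
      simp only [Finset.mem_filter, Finset.mem_univ, true_and, Finset.mem_insert, Fin.lt_def,
        Fin.ext_iff, Fin.val_castSucc, Fin.val_succ]
      omega
    -- For `t < y < z i` all coordinates are distinct, so each summand is the propagated function at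
    -- the tuple with `y` and `z k` exchanged; the endpoint is a null set.
    have hDG : ∫ y in t..z i, D y =
        ∑ k : Fin N with k.castSucc < m, ∫ y in t..z i, G k y := by
      rw [← intervalIntegral.integral_finsetSum fun k _ => hGint k _ _]
      refine intervalIntegral.integral_congr_ae ?_
      have hne : ∀ᵐ y : ℝ, y ≠ z i := by
        simp [ae_iff, measure_singleton]
      filter_upwards [hne] with y hy hyI
      rw [uIoc_of_le hti] at hyI
      have hyz : y < z i := lt_of_le_of_ne hyI.2 hy
      rw [hD]
      simp only [Finset.mul_sum]
      refine Finset.sum_congr rfl fun k hk => ?_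
      have hk' : k.castSucc < m := (Finset.mem_filter.1 hk).2
      have a1 : ∀ k : Fin N, k.castSucc < m → y < z k := fun k hk =>
        hyz.trans_le (hz.antitone (by
          rw [hm, Fin.lt_def, Fin.val_castSucc, Fin.val_succ] at hk
          exact Nat.lt_succ_iff.1 hk))
      have a2 : ∀ k : Fin N, m ≤ k.castSucc → z k < y := fun k hk => (ht2 k hk).trans_lt hyI.1
      have hinj : Function.Injective (tcons y z) := by
        refine injective_tcons.2 ⟨fun k => ?_, hz.injective⟩
        rcases lt_or_ge k.castSucc m with h | h
        · exact (a1 k h).ne'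
        · exact (a2 k h).ne
      rw [hG]
      simp only
      rw [← tcons_comp_swap_zero, ← propagation_reflHom γ f hinj, propagation_tcons_eq γ _ hz a1 a2,
        map_mul]
      rfl
    rw [intervalIntegral.integral_neg, intervalIntegral.integral_const_mul, hDG, hstart,
      hih] at hftc
    -- Cutting at `z i` separates the new interval from those of the induction hypothesis; the new
    -- label `k = i` has an empty second piece.
    have hsplit : ∀ k, ∫ y in t..z k, G k y = (∫ y in t..z i, G k y) + ∫ y in z i..z k, G k y :=
      fun k => (intervalIntegral.integral_add_adjacent_intervals (hGint k _ _) (hGint k _ _)).symm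
    have hsum : ∑ k : Fin N with k.castSucc < m, ∫ y in t..z k, G k y =
        (∑ k : Fin N with k.castSucc < m, ∫ y in t..z i, G k y) +
          ∑ k : Fin N with k.castSucc < i.castSucc, ∫ y in z i..z k, G k y := by
      simp only [hsplit]
      rw [Finset.sum_add_distrib]
      congr 1
      rw [hm, hset, Finset.sum_insert (by simp)]
      simp
    rw [hsum]
    linear_combination hftc

/-- The place of a real number in a decreasing tuple. -/
theorem exists_place {z : Fin N → ℝ} (hz : StrictAnti z) (t : ℝ) :
    ∃ m : Fin (N + 1), ∀ k : Fin N, k.castSucc < m ↔ t < z k := by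
  by_cases h : ∃ k, z k ≤ t
  · obtain ⟨k, hk⟩ := h
    obtain ⟨j, hj, hmin⟩ := Finset.exists_min_image (Finset.univ.filter fun k => z k ≤ t) id
      ⟨k, by simpa using hk⟩
    simp only [Finset.mem_filter, Finset.mem_univ, true_and, id] at hj hmin
    refine ⟨j.castSucc, fun k => ?_⟩
    rw [Fin.castSucc_lt_castSucc_iff]
    refine ⟨fun h => not_le.1 fun h' => absurd (hmin k h') (not_le.2 h), fun h => ?_⟩
    by_contra h'
    exact absurd ((hz.antitone (not_lt.1 h')).trans hj) (not_le.2 h)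
  · push Not at h
    exact ⟨Fin.last N, fun k => ⟨fun _ => h k, fun _ => Fin.castSucc_lt_last k⟩⟩

/-- The integral equation satisfied by `P (B_μ g)`. -/
theorem propagation_createOp_eq (μ : ℂ) (g : CF N) {t : ℝ} {x : Fin N → ℝ}
    (hx : Function.Injective (tcons t x)) :
    propagation γ (createOp μ g) (tcons t x) = Complex.exp (Complex.I * μ * t) *
      (propagation γ g x + γ * ∑ k : Fin N with t < x k, ∫ y in t..x k,
        Complex.exp (-(Complex.I * μ) * y) *
          propagation γ (createOp μ g) (tcons (x k) (Function.update x k y))) := by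
  have hx' := (injective_tcons.1 hx).2
  obtain ⟨τ, hτ⟩ := exists_strictAnti hx'
  obtain ⟨m, hm⟩ := exists_place hτ t
  have h2 : ∀ k : Fin N, m ≤ k.castSucc → (x ∘ τ) k < t := fun k hk =>
    lt_of_le_of_ne (not_lt.1 fun h => absurd ((hm k).2 h) (not_lt.2 hk))
      ((injective_tcons.1 hx).1 _)
  set z := x ∘ τ with hz
  have hzx : z ∘ (τ⁻¹ : Equiv.Perm (Fin N)) = x := by ext j; simp [hz]
  -- Replacing `g` by its deformed image under `τ⁻¹` reduces to the decreasing tuple `z`; the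
  -- propagated functions are then related by `propagation_reflHom`.
  have key := reflHom_cycTo_createOp γ μ (reflHom γ N τ⁻¹ g) hτ m t
    (fun k hk => ((hm k).1 hk).le) (fun k hk => (h2 k hk).le)
  have hP : ∀ (s : ℝ) (w : Fin N → ℝ), Function.Injective (tcons s w) →
      propagation γ (createOp μ (reflHom γ N τ⁻¹ g)) (tcons s w) =
        propagation γ (createOp μ g) (tcons s (w ∘ (τ⁻¹ : Equiv.Perm (Fin N)))) := by
    intro s w hw
    rw [← reflHom_createOp, propagation_reflHom γ _ hw, tcons_comp_liftFirst]
  have hinj : Function.Injective (tcons t z) := by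
    rw [hz, ← tcons_comp_liftFirst]
    exact hx.comp (Equiv.injective _)
  rw [← propagation_tcons_eq γ _ hτ (fun k hk => (hm k).1 hk) h2, hP t z hinj, hzx,
    ← propagation_eq γ g τ hτ] at key
  have hsum : ∑ k : Fin N with k.castSucc < m, ∫ y in t..z k, Complex.exp (-(Complex.I * μ) * y) *
        propagation γ (createOp μ (reflHom γ N τ⁻¹ g)) (tcons (z k) (Function.update z k y)) =
      ∑ k : Fin N with t < x k, ∫ y in t..x k, Complex.exp (-(Complex.I * μ) * y) *
          propagation γ (createOp μ g) (tcons (x k) (Function.update x k y)) := by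
    rw [Finset.sum_filter, Finset.sum_filter]
    refine Fintype.sum_equiv τ _ _ fun k => ?_
    simp only [hm]
    change (if t < z k then _ else _) = if t < z k then _ else _
    congr 1
    refine intervalIntegral.integral_congr_ae ?_
    have hne : ∀ᵐ y : ℝ, ∀ j, z j ≠ y := by
      rw [ae_all_iff]
      intro j
      have : ∀ᵐ y : ℝ, y ≠ z j := by simp [ae_iff, measure_singleton]
      filter_upwards [this] with y hy using hy.symm
    filter_upwards [hne] with y hy _
    rw [hP]
    · congr 3
      rw [Function.update_comp_equiv, hzx]
      rfl
    · rw [← tcons_comp_swap_zero]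
      exact (injective_tcons.2 ⟨hy, hτ.injective⟩).comp (Equiv.injective _)
  rw [hsum] at key
  rw [← key, ← mul_assoc, ← Complex.exp_add]
  simp

end Insertion

/-! ### Chain integrals as iterated integrals -/

section Chain

variable {N n : ℕ}

theorem LocBdd.comp {f : (Fin N → ℝ) → ℂ} (hf : LocBdd f) {c : (Fin n → ℝ) → Fin N → ℝ}
    (hc : Continuous c) : LocBdd fun y => f (c y) where
  measurable := hf.measurable.comp hc.measurable
  bound R := by
    obtain ⟨R', hR⟩ := exists_abs_le_of_isCompact
      (isCompact_univ_pi fun _ : Fin n => isCompact_Icc (a := -R) (b := R)) hc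
    obtain ⟨C, hC⟩ := hf.bound R'
    exact ⟨C, fun y hy => hC _ (hR y fun k _ => abs_le.1 (hy k))⟩

theorem LocBdd.mul {f g : (Fin N → ℝ) → ℂ} (hf : LocBdd f) (hg : LocBdd g) :
    LocBdd fun y => f y * g y where
  measurable := hf.measurable.mul hg.measurable
  bound R := by
    obtain ⟨C, hC⟩ := hf.bound R
    obtain ⟨D, hD⟩ := hg.bound R
    refine ⟨C * D, fun y hy => ?_⟩
    rw [norm_mul]
    exact mul_le_mul (hC y hy) (hD y hy) (norm_nonneg _) ((norm_nonneg _).trans (hC y hy))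

theorem LocBdd.integrableOn_pi_Ioc {f : (Fin N → ℝ) → ℂ} (hf : LocBdd f) (a b : Fin N → ℝ) :
    IntegrableOn f (univ.pi fun m => Ioc (a m) (b m)) := by
  obtain ⟨C, hC⟩ := hf.bound (∑ m, (|a m| + |b m|))
  refine Measure.integrableOn_of_bounded (M := C) ?_ hf.measurable.aestronglyMeasurable ?_
  · rw [Real.volume_pi_Ioc]
    exact ENNReal.prod_ne_top fun _ _ => ENNReal.ofReal_ne_top
  · refine (ae_restrict_iff' (MeasurableSet.univ_pi fun _ => measurableSet_Ioc)).2
      (Eventually.of_forall fun y hy => hC y fun k => ?_)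
    have h1 : |a k| + |b k| ≤ ∑ m, (|a m| + |b m|) :=
      Finset.single_le_sum (f := fun m => |a m| + |b m|) (fun _ _ => by positivity)
        (Finset.mem_univ k)
    have h2 := hy k (mem_univ k)
    rw [abs_le]
    have h3 := neg_abs_le (a k)
    have h4 := le_abs_self (b k)
    have h5 := abs_nonneg (a k)
    have h6 := abs_nonneg (b k)
    constructor <;> linarith [h2.1, h2.2]

theorem setIntegral_pi_insertNth (i : Fin (n + 1)) (S : Fin (n + 1) → Set ℝ)
    {F : (Fin (n + 1) → ℝ) → ℂ} (hF : IntegrableOn F (univ.pi S)) :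
    ∫ y in univ.pi S, F y =
        ∫ s in S i, ∫ y in univ.pi fun m => S (i.succAbove m), F (i.insertNth s y) ∧
      IntegrableOn (fun s => ∫ y in univ.pi fun m => S (i.succAbove m), F (i.insertNth s y))
        (S i) := by
  set e := MeasurableEquiv.piFinSuccAbove (fun _ : Fin (n + 1) => ℝ) i with he
  have hmp : MeasurePreserving e.symm :=
    (volume_preserving_piFinSuccAbove (fun _ : Fin (n + 1) => ℝ) i).symm
  have hpre : e.symm ⁻¹' (univ.pi S) = S i ×ˢ univ.pi fun m => S (i.succAbove m) := by
    ext z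
    simp [e, Set.mem_pi, i.forall_iff_succAbove, MeasurableEquiv.piFinSuccAbove_symm_apply,
      Fin.insertNthEquiv]
  have hint : IntegrableOn (F ∘ e.symm) (S i ×ˢ univ.pi fun m => S (i.succAbove m))
      (volume.prod volume) := by
    rw [← hpre]
    exact (hmp.integrableOn_comp_preimage e.symm.measurableEmbedding).2 hF
  constructor
  · rw [← hmp.setIntegral_preimage_emb e.symm.measurableEmbedding, hpre]
    exact setIntegral_prod _ hint
  · rw [IntegrableOn, ← Measure.prod_restrict] at hint
    exact hint.integral_prod_left

theorem strictAnti_tsnoc {p : Fin (n + 1) → ℝ} {t : ℝ} :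
    StrictAnti (tsnoc p t) ↔ StrictAnti p ∧ t < p (Fin.last n) := by
  refine ⟨fun h => ⟨fun a b hab => ?_, ?_⟩, fun ⟨h1, h2⟩ => Fin.strictAnti_iff_succ_lt.2 fun i =>
    ?_⟩
  · simpa using h (Fin.castSucc_lt_castSucc_iff.2 hab)
  · simpa using h (Fin.castSucc_lt_last (Fin.last n))
  · refine Fin.lastCases ?_ (fun i => ?_) i
    · simpa using h2
    · rw [Fin.succ_castSucc, tsnoc_castSucc, tsnoc_castSucc]
      exact h1 Fin.castSucc_lt_succ

/-- Splitting off the last integral of a chain integral. -/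
theorem chainIntegral_tsnoc (μ : ℂ) (p : Fin (n + 1) → ℝ) {t : ℝ} (ht : t < p (Fin.last n))
    {g : (Fin (n + 1) → ℝ) → ℂ} (hg : LocBdd g) :
    chainIntegral μ (tsnoc p t) g = Complex.exp (Complex.I * μ * t) *
        ∫ s in t..p (Fin.last n), Complex.exp (-(Complex.I * μ) * s) *
          chainIntegral μ p (fun y => g (tsnoc y s)) ∧
      IntervalIntegrable (fun s : ℝ => Complex.exp (-(Complex.I * μ) * s) *
        chainIntegral μ p (fun y => g (tsnoc y s))) volume t (p (Fin.last n)) := by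
  by_cases h : StrictAnti p
  · have h' : StrictAnti (tsnoc p t) := strictAnti_tsnoc.2 ⟨h, ht⟩
    simp only [chainIntegral, if_pos h, if_pos h']
    set F : (Fin (n + 1) → ℝ) → ℂ := fun y =>
      Complex.exp (Complex.I * μ * ((∑ m, tsnoc p t m : ℝ) - (∑ m, y m : ℝ))) * g y with hFdef
    have hF : LocBdd F := (locBdd_of_continuous (by fun_prop)).mul hg
    have key := setIntegral_pi_insertNth (Fin.last n)
      (fun m : Fin (n + 1) => Ioc (tsnoc p t m.succ) (tsnoc p t m.castSucc))
      (hF.integrableOn_pi_Ioc _ _)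
    -- The exponent splits: the new lowest point `t` and the last integration variable `s`
    -- contribute exactly the factor for `t - s`.
    have hin : ∀ s : ℝ, ∫ y in univ.pi fun m : Fin n =>
        Ioc (tsnoc p t ((Fin.last n).succAbove m).succ)
          (tsnoc p t ((Fin.last n).succAbove m).castSucc), F ((Fin.last n).insertNth s y) =
        Complex.exp (Complex.I * μ * t) * (Complex.exp (-(Complex.I * μ) * s) *
          ∫ y in univ.pi fun m : Fin n => Ioc (p m.succ) (p m.castSucc),
            Complex.exp (Complex.I * μ * ((∑ m, p m : ℝ) - (∑ m, y m : ℝ))) * g (tsnoc y s)) := by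
      intro s
      simp only [Fin.succAbove_last, Fin.succ_castSucc, tsnoc_castSucc]
      rw [← integral_const_mul, ← integral_const_mul]
      congr 1
      ext y
      have e : (Fin.last n).insertNth s y = tsnoc y s := Fin.insertNth_last' s y
      rw [e, hFdef]
      simp only
      rw [← mul_assoc, ← mul_assoc, ← Complex.exp_add, ← Complex.exp_add,
        Fin.sum_univ_castSucc (tsnoc p t), Fin.sum_univ_castSucc (tsnoc y s)]
      simp only [tsnoc_castSucc, tsnoc_last]
      congr 2
      push_cast
      ring
    simp only [hin] at key
    simp only [Fin.succ_last, tsnoc_last, tsnoc_castSucc] at key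
    rw [intervalIntegral.integral_of_le ht.le, ← integral_const_mul]
    refine ⟨by simpa only [tsnoc_castSucc] using key.1, ?_⟩
    rw [intervalIntegrable_iff_integrableOn_Ioc_of_le ht.le]
    have h2 := key.2.const_mul (Complex.exp (-(Complex.I * μ * t)))
    refine h2.congr (Eventually.of_forall fun s => ?_)
    simp only
    rw [← mul_assoc, ← Complex.exp_add]
    simp
  · have h' : ¬ StrictAnti (tsnoc p t) := fun h' => h (strictAnti_tsnoc.1 h').1
    simp [chainIntegral, if_neg h, if_neg h']

end Chain

/-! ### The integral equation of the creation operator -/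

section Creation

variable {N n : ℕ}

/-- The contribution of the tuple `i` to the creation operator, as a function of the new variable
`t` and the old variables `x`. -/
def creationTerm (μ : ℂ) (f : (Fin N → ℝ) → ℂ) (i : Fin n ↪ Fin N) (t : ℝ) (x : Fin N → ℝ) : ℂ :=
  chainIntegral μ (tsnoc (x ∘ i) t) fun y => f (Function.extend i y x)

theorem creation_plus (γ : ℝ) (μ : ℂ) (f : (Fin N → ℝ) → ℂ) (t : ℝ) (x : Fin N → ℝ) :
    creation γ μ .plus f (tcons t x) =
      ∑ n ∈ Finset.range (N + 1), (γ : ℂ) ^ n * ∑ i : Fin n ↪ Fin N, creationTerm μ f i t x := rfl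

theorem continuous_extend (i : Fin n ↪ Fin N) (x : Fin N → ℝ) :
    Continuous fun y : Fin n → ℝ => Function.extend i y x := by
  refine continuous_pi fun k => ?_
  by_cases hk : ∃ m, i m = k
  · obtain ⟨m, rfl⟩ := hk
    simp only [i.injective.extend_apply]
    exact continuous_apply m
  · simp only [Function.extend_apply' _ _ _ hk]
    exact continuous_const

theorem creationTerm_zero (μ : ℂ) (f : (Fin N → ℝ) → ℂ) (i : Fin 0 ↪ Fin N) (t : ℝ)
    (x : Fin N → ℝ) : creationTerm μ f i t x = Complex.exp (Complex.I * μ * t) * f x := by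
  have h : StrictAnti (tsnoc (x ∘ i) t) := fun a b hab => by
    rw [Fin.lt_def] at hab
    omega
  have hx : ∀ y : Fin 0 → ℝ, Function.extend i y x = x := fun y => by
    ext k
    exact Function.extend_apply' _ _ _ (by rintro ⟨m, _⟩; exact m.elim0)
  rw [creationTerm, chainIntegral, if_pos h]
  simp only [hx, Finset.univ_eq_empty, Finset.sum_empty, Fin.sum_univ_castSucc, tsnoc_last]
  have e : (univ.pi fun m : Fin 0 => Ioc (tsnoc (x ∘ i) t m.succ) (tsnoc (x ∘ i) t m.castSucc)) =
      univ := by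
    ext y; simp
  rw [e, Measure.restrict_univ, integral_const]
  simp [Measure.real, volume_pi]

/-- The chain would have to decrease from `y` to `x k`. This vanishing allows summation over all
pairs of a tuple and a label, including labels already in the tuple. -/
theorem creationTerm_update_eq_zero (μ : ℂ) (f : (Fin N → ℝ) → ℂ) (j : Fin n ↪ Fin N) {k : Fin N}
    (hk : k ∈ range j) (x : Fin N → ℝ) {y : ℝ} (hy : y ≤ x k) :
    creationTerm μ f j (x k) (Function.update x k y) = 0 := by
  obtain ⟨m, rfl⟩ := hk
  refine if_neg fun h => ?_
  have := h (Fin.castSucc_lt_last m)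
  simp only [tsnoc_last, tsnoc_castSucc, Function.comp_apply, Function.update_self] at this
  exact absurd hy (not_le.2 this)

/-- In the inner chain $x_{i_n}$ becomes the lowest point, while the integration variable `y` takes
its place among the old variables. This is the recursion behind the integral equation. -/
theorem creationTerm_succ (μ : ℂ) {f : (Fin N → ℝ) → ℂ} (hf : LocBdd f) (i : Fin (n + 1) ↪ Fin N)
    {t : ℝ} {x : Fin N → ℝ} (ht : t < x (i (Fin.last n))) :
    creationTerm μ f i t x = Complex.exp (Complex.I * μ * t) *
        ∫ y in t..x (i (Fin.last n)), Complex.exp (-(Complex.I * μ) * y) *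
          creationTerm μ f (Fin.Embedding.init i) (x (i (Fin.last n)))
            (Function.update x (i (Fin.last n)) y) ∧
      IntervalIntegrable (fun y : ℝ => Complex.exp (-(Complex.I * μ) * y) *
          creationTerm μ f (Fin.Embedding.init i) (x (i (Fin.last n)))
            (Function.update x (i (Fin.last n)) y)) volume t (x (i (Fin.last n))) := by
  have key := chainIntegral_tsnoc μ (x ∘ i) ht (hf.comp (continuous_extend i x))
  have e : ∀ y : ℝ, chainIntegral μ (x ∘ i) (fun w => f (Function.extend i (tsnoc w y) x)) =
      creationTerm μ f (Fin.Embedding.init i) (x (i (Fin.last n)))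
            (Function.update x (i (Fin.last n)) y) := by
    intro y
    rw [creationTerm]
    congr 1
    · ext m
      refine Fin.lastCases ?_ (fun m => ?_) m
      · simp
      · have : i m.castSucc ≠ i (Fin.last n) := fun h =>
          (Fin.castSucc_lt_last m).ne (i.injective h)
        rw [tsnoc_castSucc]
        exact (Function.update_of_ne this _ _).symm
    · ext w
      congr 1
      ext k
      by_cases hk : ∃ m, i m = k
      · obtain ⟨m, rfl⟩ := hk
        rw [i.injective.extend_apply]
        refine Fin.lastCases ?_ (fun m => ?_) m
        · rw [Function.extend_apply']
          · simp
          · rintro ⟨m, hm⟩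
            exact (Fin.castSucc_lt_last m).ne (i.injective hm)
        · have : i m.castSucc = Fin.Embedding.init i m := rfl
          rw [this, (Fin.Embedding.init i).injective.extend_apply, tsnoc_castSucc]
      · rw [Function.extend_apply' _ _ _ hk, Function.extend_apply', Function.update_of_ne]
        · exact fun h => hk ⟨_, h.symm⟩
        · rintro ⟨m, hm⟩
          exact hk ⟨_, hm⟩
  simp only [e] at key
  exact key

theorem creationTerm_succ_eq_zero (μ : ℂ) (f : (Fin N → ℝ) → ℂ) (i : Fin (n + 1) ↪ Fin N)
    {t : ℝ} {x : Fin N → ℝ} (ht : ¬ t < x (i (Fin.last n))) : creationTerm μ f i t x = 0 :=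
  if_neg fun h => ht (by simpa using h (Fin.castSucc_lt_last (Fin.last n)))

theorem exists_init_eq (j : Fin n ↪ Fin N) {k : Fin N} (hk : k ∉ range j) :
    ∃ i : Fin (n + 1) ↪ Fin N, i (Fin.last n) = k ∧ Fin.Embedding.init i = j :=
  ⟨Fin.Embedding.snoc j hk, Fin.Embedding.snoc_last, Fin.Embedding.init_snoc j hk⟩

theorem creationTerm_intervalIntegrable (μ : ℂ) {f : (Fin N → ℝ) → ℂ} (hf : LocBdd f)
    (j : Fin n ↪ Fin N) (k : Fin N) {t : ℝ} {x : Fin N → ℝ} (ht : t < x k) :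
    IntervalIntegrable (fun y : ℝ => Complex.exp (-(Complex.I * μ) * y) *
      creationTerm μ f j (x k) (Function.update x k y)) volume t (x k) := by
  by_cases hk : k ∈ range j
  · have : IntervalIntegrable (fun _ : ℝ => (0 : ℂ)) volume t (x k) := by simp
    refine this.congr fun y hy => ?_
    rw [uIoc_of_le ht.le] at hy
    rw [creationTerm_update_eq_zero μ f j hk x hy.2, mul_zero]
  · obtain ⟨i, rfl, rfl⟩ := exists_init_eq j hk
    exact (creationTerm_succ μ hf i ht).2

/-- The same equation as in `propagation_createOp_eq`. An $(n+1)$-tuple is an $n$-tuple together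
with a last label, and the integral belonging to the last label is the one split off. -/
theorem creation_tcons_eq (γ : ℝ) (μ : ℂ) {f : (Fin N → ℝ) → ℂ} (hf : LocBdd f) (t : ℝ)
    (x : Fin N → ℝ) :
    creation γ μ .plus f (tcons t x) = Complex.exp (Complex.I * μ * t) *
      (f x + γ * ∑ k : Fin N with t < x k, ∫ y in t..x k, Complex.exp (-(Complex.I * μ) * y) *
        creation γ μ .plus f (tcons (x k) (Function.update x k y))) := by
  set D : ∀ n : ℕ, (Fin n ↪ Fin N) → Fin N → ℂ := fun n j k =>
    if t < x k then ∫ y in t..x k, Complex.exp (-(Complex.I * μ) * y) *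
      creationTerm μ f j (x k) (Function.update x k y) else 0 with hD
  have h1 : ∑ k : Fin N with t < x k, ∫ y in t..x k, Complex.exp (-(Complex.I * μ) * y) *
        creation γ μ .plus f (tcons (x k) (Function.update x k y)) =
      ∑ n ∈ Finset.range (N + 1), (γ : ℂ) ^ n * ∑ z : (Fin n ↪ Fin N) × Fin N, D n z.1 z.2 := by
    have e : ∀ k ∈ Finset.univ.filter (fun k : Fin N => t < x k), ∫ y in t..x k,
        Complex.exp (-(Complex.I * μ) * y) *
          creation γ μ .plus f (tcons (x k) (Function.update x k y)) =
        ∑ n ∈ Finset.range (N + 1), (γ : ℂ) ^ n * ∑ j : Fin n ↪ Fin N, D n j k := by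
      intro k hk
      have hk' : t < x k := (Finset.mem_filter.1 hk).2
      simp only [creation_plus, hD, if_pos hk']
      have e1 : ∀ n : ℕ, (γ : ℂ) ^ n * ∑ j : Fin n ↪ Fin N, ∫ y in t..x k,
          Complex.exp (-(Complex.I * μ) * y) *
            creationTerm μ f j (x k) (Function.update x k y) =
          ∫ y in t..x k, (γ : ℂ) ^ n * ∑ j : Fin n ↪ Fin N, Complex.exp (-(Complex.I * μ) * y) *
            creationTerm μ f j (x k) (Function.update x k y) := fun n => by
        rw [intervalIntegral.integral_const_mul, intervalIntegral.integral_finsetSum fun j _ =>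
          creationTerm_intervalIntegrable μ hf j k (x := x) hk']
      simp only [e1]
      rw [← intervalIntegral.integral_finsetSum]
      · refine intervalIntegral.integral_congr fun y _ => ?_
        simp only [Finset.mul_sum]
        refine Finset.sum_congr rfl fun n _ => Finset.sum_congr rfl fun j _ => ?_
        ring
      · intro n _
        refine IntervalIntegrable.const_mul ?_ _
        have := IntervalIntegrable.sum Finset.univ fun (j : Fin n ↪ Fin N) _ =>
          creationTerm_intervalIntegrable μ hf j k (x := x) hk'
        refine this.congr fun y _ => ?_
        simp
    rw [Finset.sum_congr rfl e, Finset.sum_comm]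
    refine Finset.sum_congr rfl fun n _ => ?_
    rw [← Finset.mul_sum, Fintype.sum_prod_type_right, Finset.sum_filter]
    congr 1
    refine Finset.sum_congr rfl fun k _ => ?_
    split_ifs with hk
    · rfl
    · simp [hD, hk]
  have h2 : ∀ n, Complex.exp (Complex.I * μ * t) * ∑ z : (Fin n ↪ Fin N) × Fin N, D n z.1 z.2 =
      ∑ i : Fin (n + 1) ↪ Fin N, creationTerm μ f i t x := by
    intro n
    rw [Finset.mul_sum]
    -- Pairs not coming from an $(n+1)$-tuple are those whose label already occurs in the tuple, and
    -- they contribute zero.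
    refine (Fintype.sum_of_injective
      (fun i : Fin (n + 1) ↪ Fin N => (Fin.Embedding.init i, i (Fin.last n))) ?_ _ _ ?_ ?_).symm
    · intro i i' h
      simp only [Prod.mk.injEq] at h
      ext m
      refine Fin.lastCases ?_ (fun m => ?_) m
      · rw [h.2]
      · exact congrArg Fin.val (DFunLike.congr_fun h.1 m)
    · rintro ⟨j, k⟩ hz
      have hk : k ∈ range j := by
        by_contra hk
        obtain ⟨i, h1, h2⟩ := exists_init_eq j hk
        exact hz ⟨i, by rw [← h1, ← h2]⟩
      simp only [hD]
      split_ifs with ht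
      · rw [intervalIntegral.integral_congr_ae (g := fun _ => 0), intervalIntegral.integral_zero,
          mul_zero]
        refine Eventually.of_forall fun y hy => ?_
        rw [uIoc_of_le ht.le] at hy
        rw [creationTerm_update_eq_zero μ f j hk x hy.2, mul_zero]
      · simp
    · intro i
      simp only [hD]
      split_ifs with ht
      · exact (creationTerm_succ μ hf i ht).1
      · rw [creationTerm_succ_eq_zero μ f i ht, mul_zero]
  -- An empty summand `n = N + 1` is added, so that removing `n = 0` and shifting leaves the range
  -- `N + 1`.
  have h3 : creation γ μ .plus f (tcons t x) =
      ∑ n ∈ Finset.range (N + 2), (γ : ℂ) ^ n * ∑ i : Fin n ↪ Fin N, creationTerm μ f i t x := by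
    rw [creation_plus, Finset.sum_range_succ _ (N + 1)]
    have : IsEmpty (Fin (N + 1) ↪ Fin N) := ⟨fun i => by
      simpa using Fintype.card_le_of_embedding i⟩
    simp
  have h4 : ∑ i : Fin 0 ↪ Fin N, creationTerm μ f i t x = Complex.exp (Complex.I * μ * t) * f x :=
    by
    simp [creationTerm_zero]
  rw [h3, Finset.sum_range_succ', h1, pow_zero, one_mul, h4, mul_add, add_comm]
  congr 1
  rw [Finset.mul_sum, Finset.mul_sum]
  refine Finset.sum_congr rfl fun n _ => ?_
  rw [← h2, pow_succ]
  ring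

/-- The creation operator on propagated functions. -/
theorem creation_propagation (γ : ℝ) (μ : ℂ) (g : CF N) {t : ℝ} {x : Fin N → ℝ}
    (hx : Function.Injective (tcons t x)) :
    creation γ μ .plus (propagation γ g) (tcons t x) =
      propagation γ (createOp μ g) (tcons t x) := by
  -- Induction on the number of coordinates above the first variable. Passing from `(t, x)` to `(x
  -- k, x with y at k)` with `y ≤ x k` drops `k` and adds no other label.
  obtain ⟨c, hc⟩ : ∃ c, (Finset.univ.filter fun k => t < x k).card = c := ⟨_, rfl⟩
  induction c using Nat.strong_induction_on generalizing t x with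
  | _ c ih =>
    rw [creation_tcons_eq γ μ (locBdd_propagation γ g), propagation_createOp_eq γ μ g hx]
    congr 3
    refine Finset.sum_congr rfl fun k hk => ?_
    have hk' : t < x k := (Finset.mem_filter.1 hk).2
    refine intervalIntegral.integral_congr_ae ?_
    have hne : ∀ᵐ y : ℝ, ∀ j, x j ≠ y := by
      rw [ae_all_iff]
      intro j
      have : ∀ᵐ y : ℝ, y ≠ x j := by simp [ae_iff, measure_singleton]
      filter_upwards [this] with y hy using hy.symm
    filter_upwards [hne] with y hy hyI
    rw [uIoc_of_le hk'.le] at hyI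
    congr 1
    refine ih _ ?_ ?_ rfl
    · rw [← hc]
      refine Finset.card_lt_card (Finset.ssubset_iff_of_subset ?_ |>.2 ⟨k, hk, ?_⟩)
      · intro j hj
        simp only [Finset.mem_filter, Finset.mem_univ, true_and] at hj ⊢
        rcases eq_or_ne j k with rfl | h
        · exact hk'
        · rw [Function.update_of_ne h] at hj
          exact hk'.trans hj
      · simp only [Finset.mem_filter, Finset.mem_univ, true_and, Function.update_self, not_lt]
        exact hyI.2
    · rw [← tcons_comp_swap_zero]
      exact (injective_tcons.2 ⟨hy, (injective_tcons.1 hx).2⟩).comp (Equiv.injective _)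

end Creation

/-! ### The operators for `ε = +` on propagated functions -/

section Regular

variable {N n : ℕ} {xp xm : ℝ}

/-- Points in the interior of the cube with distinct coordinates. -/
def Regular (xp xm : ℝ) (x : Fin N → ℝ) : Prop :=
  Function.Injective x ∧ ∀ k, xp < x k ∧ x k < xm

theorem ae_ne_apply {j k : Fin N} (h : j ≠ k) : ∀ᵐ x : Fin N → ℝ, x j ≠ x k := by
  set L : (Fin N → ℝ) →ₗ[ℝ] ℝ := LinearMap.proj (R := ℝ) (φ := fun _ : Fin N => ℝ) j -
    LinearMap.proj k with hL
  have h0 := Measure.addHaar_submodule (volume : Measure (Fin N → ℝ)) (LinearMap.ker L) (by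
    intro htop
    have : Pi.single j 1 ∈ LinearMap.ker L := by rw [htop]; trivial
    simp [hL, h.symm] at this)
  rw [ae_iff]
  convert h0 using 2
  ext x
  simp [hL, sub_eq_zero]

theorem ae_regular (xp xm : ℝ) (N : ℕ) : ∀ᵐ x ∂(cube xp xm N), Regular xp xm x := by
  have h1 : ∀ᵐ x : Fin N → ℝ, ∀ j k, j ≠ k → x j ≠ x k := by
    simp only [ae_all_iff]
    exact fun j k h => ae_ne_apply h
  have h2 : ∀ a : ℝ, ∀ᵐ x : Fin N → ℝ, ∀ k, x k ≠ a := by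
    intro a
    rw [ae_all_iff]
    intro k
    rw [volume_pi]
    exact Measure.ae_eval_ne (μ := fun _ : Fin N => (volume : Measure ℝ)) k a
  filter_upwards [cube_ae_mem xp xm N, ae_restrict_of_ae h1, ae_restrict_of_ae (h2 xp),
    ae_restrict_of_ae (h2 xm)] with x hx h1 h2 h3
  refine ⟨fun j k h => ?_, fun k => ⟨lt_of_le_of_ne (hx k).1 (h2 k).symm,
    lt_of_le_of_ne (hx k).2 (h3 k)⟩⟩
  by_contra hjk
  exact h1 j k hjk h

theorem propagation_sub (γ : ℝ) (f g : CF N) (x : Fin N → ℝ) :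
    propagation γ (f - g : CF N) x = propagation γ f x - propagation γ g x := by
  simp only [propagation_apply]
  simp

theorem propagation_smul (γ : ℝ) (c : ℂ) (g : CF N) (x : Fin N → ℝ) :
    propagation γ (c • g : CF N) x = c * propagation γ g x := by
  simp only [propagation_apply]
  simp

theorem propagation_add (γ : ℝ) (f g : CF N) (x : Fin N → ℝ) :
    propagation γ (f + g : CF N) x = propagation γ f x + propagation γ g x := by
  simp only [propagation_apply]
  simp

theorem creation_propagation_ae (xp xm γ : ℝ) (μ : ℂ) (g : CF N) :
    creation γ μ .plus (propagation γ g) =ᵐ[cube xp xm (N + 1)]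
      propagation γ (createOp μ g) := by
  filter_upwards [ae_regular xp xm (N + 1)] with x hx
  obtain ⟨t, x, rfl⟩ := exists_eq_tcons x
  exact creation_propagation γ μ g hx.1

theorem preserving_propagation (γ : ℝ) (μ : ℂ) (g : CF N) {x : Fin N → ℝ}
    (hx : Regular xp xm x) :
    preserving xp xm γ μ .plus (propagation γ g) x = propagation γ (presOp γ μ xp g) x := by
  have hinj : Function.Injective (tcons xp x) := injective_tcons.2 ⟨fun k => (hx.2 k).1.ne', hx.1⟩
  rw [← propagation_createOp_tcons γ μ g hx.1 fun k => (hx.2 k).1, ← creation_propagation γ μ g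
    hinj]
  rfl

theorem preserving_propagation_ae (xp xm γ : ℝ) (μ : ℂ) (g : CF N) :
    preserving xp xm γ μ .plus (propagation γ g) =ᵐ[cube xp xm N]
      propagation γ (presOp γ μ xp g) := by
  filter_upwards [ae_regular xp xm N] with x hx
  exact preserving_propagation γ μ g hx

/-- The tuple `i`, as a tuple of labels in a larger set. -/
def castEmb (j : Fin n ↪ Fin N) : Fin n ↪ Fin (N + 1) := j.trans Fin.castSuccEmb

theorem last_notMem_range_castEmb (j : Fin n ↪ Fin N) : Fin.last N ∉ range (castEmb j) := by
  rintro ⟨m, hm⟩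
  exact (Fin.castSucc_lt_last (j m)).ne hm

/-- The tuple `i` preceded by the last label. -/
def consLast (j : Fin n ↪ Fin N) : Fin (n + 1) ↪ Fin (N + 1) :=
  Fin.Embedding.cons (castEmb j) (last_notMem_range_castEmb j)

theorem exists_castEmb_eq {i : Fin n ↪ Fin (N + 1)} (h : Fin.last N ∉ range i) :
    ∃ j, castEmb j = i := by
  have h' : ∀ m, i m ≠ Fin.last N := fun m hm => h ⟨m, hm⟩
  refine ⟨⟨fun m => (i m).castPred (h' m), fun a b hab => i.injective ?_⟩, ?_⟩
  · simpa using hab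
  · ext m
    rfl

theorem exists_consLast_eq {i : Fin (n + 1) ↪ Fin (N + 1)} (h : i 0 = Fin.last N) :
    ∃ j, consLast j = i := by
  have h' : Fin.last N ∉ range (Fin.Embedding.tail i) := by
    rintro ⟨m, hm⟩
    exact Fin.succ_ne_zero m (i.injective (hm.trans h.symm))
  obtain ⟨j, hj⟩ := exists_castEmb_eq h'
  refine ⟨j, ?_⟩
  ext m
  refine Fin.cases ?_ (fun m => ?_) m
  · rw [h]; rfl
  · change ((castEmb j m : Fin (N + 1)) : ℕ) = _
    rw [hj]; rfl

theorem creationTerm_castEmb (μ : ℂ) (f : (Fin (N + 1) → ℝ) → ℂ) (j : Fin n ↪ Fin N) (s t : ℝ)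
    (x : Fin N → ℝ) : creationTerm μ f (castEmb j) t (tsnoc x s) =
      creationTerm μ (fun z => f (tsnoc z s)) j t x := by
  rw [creationTerm, creationTerm]
  congr 1
  · congr 1
    ext m
    exact tsnoc_castSucc x s (j m)
  · ext y
    congr 1
    ext k
    refine Fin.lastCases ?_ (fun k => ?_) k
    · rw [Function.extend_apply' _ _ _ fun h => last_notMem_range_castEmb j h]
      simp
    · rw [tsnoc_castSucc]
      by_cases hk : ∃ m, j m = k
      · obtain ⟨m, rfl⟩ := hk
        rw [j.injective.extend_apply]
        exact (castEmb j).injective.extend_apply _ _ m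
      · rw [Function.extend_apply' _ _ _ hk, Function.extend_apply', tsnoc_castSucc]
        rintro ⟨m, hm⟩
        exact hk ⟨m, Fin.castSucc_injective N hm⟩

theorem creationTerm_consLast (μ : ℂ) (f : (Fin (N + 1) → ℝ) → ℂ) (j : Fin n ↪ Fin N)
    (x : Fin N → ℝ) : creationTerm μ f (consLast j) xp (tsnoc x xm) =
      annihilationElem xp xm μ j .plus f x := by
  rw [creationTerm, annihilationElem]
  congr 1
  · change _ = tcons xm (tsnoc (x ∘ j) xp)
    rw [tcons_tsnoc]
    congr 1
    ext m
    refine Fin.cases ?_ (fun m => ?_) m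
    · exact tsnoc_last x xm
    · exact tsnoc_castSucc x xm (j m)
  · ext y
    congr 1
    change _ = tsnoc _ _
    ext k
    refine Fin.lastCases ?_ (fun k => ?_) k
    · rw [tsnoc_last]
      exact (consLast j).injective.extend_apply _ _ 0
    · rw [tsnoc_castSucc]
      by_cases hk : ∃ m, j m = k
      · obtain ⟨m, rfl⟩ := hk
        rw [j.injective.extend_apply]
        exact (consLast j).injective.extend_apply _ _ m.succ
      · rw [Function.extend_apply' _ _ _ hk, Function.extend_apply', tsnoc_castSucc]
        rintro ⟨m, hm⟩
        revert hm
        refine Fin.cases ?_ (fun m => ?_) m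
        · exact fun hm => (Fin.castSucc_lt_last k).ne' hm
        · exact fun hm => hk ⟨m, Fin.castSucc_injective N hm⟩

/-- With the last coordinate at the right end point, its label can occur in a decreasing chain only
as the first one. Tuples avoiding it give the terms of `preserving`, tuples beginning with it those
of `annihilation`. -/
theorem sum_creationTerm_tsnoc (μ : ℂ) (f : (Fin (N + 1) → ℝ) → ℂ) {x : Fin N → ℝ}
    (hx : ∀ k, x k ≤ xm) (n : ℕ) :
    ∑ i : Fin (n + 1) ↪ Fin (N + 1), creationTerm μ f i xp (tsnoc x xm) =
      ∑ j : Fin (n + 1) ↪ Fin N, creationTerm μ (fun z => f (tsnoc z xm)) j xp x +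
        ∑ j : Fin n ↪ Fin N, annihilationElem xp xm μ j .plus f x := by
  refine Eq.trans ?_ (Fintype.sum_sum_type (Sum.elim
    (fun j : Fin (n + 1) ↪ Fin N => creationTerm μ (fun z => f (tsnoc z xm)) j xp x)
    (fun j : Fin n ↪ Fin N => annihilationElem xp xm μ j .plus f x)))
  refine (Fintype.sum_of_injective (Sum.elim castEmb consLast) ?_ _ _ ?_ ?_).symm
  · refine Function.Injective.sumElim ?_ ?_ ?_
    · intro j j' h
      ext m
      exact (congrArg Fin.val (DFunLike.congr_fun h m) :)
    · intro j j' h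
      ext m
      exact (congrArg Fin.val (DFunLike.congr_fun h m.succ) :)
    · intro j j' h
      exact last_notMem_range_castEmb j ⟨0, by rw [h]; rfl⟩
  · intro i hi
    by_cases h : Fin.last N ∈ range i
    · obtain ⟨m, hm⟩ := h
      rcases Fin.eq_zero_or_eq_succ m with rfl | ⟨m, rfl⟩
      · obtain ⟨j, rfl⟩ := exists_consLast_eq hm
        exact absurd ⟨Sum.inr j, rfl⟩ hi
      -- In a later place of the chain this label would require an earlier coordinate larger than
      -- `xm`.
      · refine if_neg fun ha => ?_
        have h1 := ha (show (0 : Fin (n + 1)).castSucc < m.succ.castSucc from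
          Fin.castSucc_lt_castSucc_iff.2 (Fin.succ_pos m))
        rw [tsnoc_castSucc, tsnoc_castSucc, Function.comp_apply, Function.comp_apply, hm,
          tsnoc_last] at h1
        refine absurd h1 (not_lt.2 ?_)
        refine Fin.lastCases ?_ (fun k => ?_) (i 0)
        · rw [tsnoc_last]
        · rw [tsnoc_castSucc]; exact hx k
    · obtain ⟨j, rfl⟩ := exists_castEmb_eq h
      exact absurd ⟨Sum.inl j, rfl⟩ hi
  · rintro (j | j)
    · exact (creationTerm_castEmb μ f j xm xp x).symm
    · exact (creationTerm_consLast μ f j x).symm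

/-- The annihilation operator in terms of the creation operator. -/
theorem creation_tcons_tsnoc (γ : ℝ) (μ : ℂ) (f : (Fin (N + 1) → ℝ) → ℂ) {x : Fin N → ℝ}
    (hx : ∀ k, x k ≤ xm) :
    creation γ μ .plus f (tcons xp (tsnoc x xm)) =
      preserving xp xm γ μ .plus (fun z => f (tsnoc z xm)) x +
        annihilation xp xm γ μ .plus f x := by
  change _ = creation γ μ .plus (fun z => f (tsnoc z xm)) (tcons xp x) + _
  have he : IsEmpty (Fin (N + 1) ↪ Fin N) := ⟨fun i => by
    simpa using Fintype.card_le_of_embedding i⟩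
  have h : creation γ μ .plus (fun z => f (tsnoc z xm)) (tcons xp x) =
      ∑ n ∈ Finset.range (N + 2), (γ : ℂ) ^ n *
        ∑ j : Fin n ↪ Fin N, creationTerm μ (fun z => f (tsnoc z xm)) j xp x := by
    rw [creation_plus, Finset.sum_range_succ _ (N + 1)]
    simp
  rw [h, creation_plus, annihilation, Finset.sum_range_succ' _ (N + 1),
    Finset.sum_range_succ' _ (N + 1)]
  simp only [sum_creationTerm_tsnoc μ f hx, mul_add, Finset.sum_add_distrib]
  have h0 : ∑ i : Fin 0 ↪ Fin (N + 1), creationTerm μ f i xp (tsnoc x xm) =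
      ∑ j : Fin 0 ↪ Fin N, creationTerm μ (fun z => f (tsnoc z xm)) j xp x := by
    simp [creationTerm_zero]
  rw [h0]
  ring

/-- At $(x^+,x,x^-)$ the function $b_\mu Pg$ gives `presOp` followed by `evalOp`; its decomposition
into $a$ and $c$ subtracts the opposite order. -/
theorem annihilation_propagation_ae {xp xm : ℝ} (hJ : xp < xm) (γ : ℝ) (μ : ℂ) (g : CF (N + 1)) :
    annihilation xp xm γ μ .plus (propagation γ g) =ᵐ[cube xp xm N]
      propagation γ (anniOp γ μ xp xm g) := by
  have h1 : (fun z : Fin N → ℝ => propagation γ g (tsnoc z xm)) =ᵐ[cube xp xm N]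
      propagation γ (evalOp γ xm g) := by
    filter_upwards [ae_regular xp xm N] with x hx
    exact propagation_tsnoc_evalOp γ g hx.1 fun k => (hx.2 k).2
  have h2 := ((isL2Operator_preserving hJ γ μ .plus N).congr _ _ h1).trans
    (preserving_propagation_ae xp xm γ μ (evalOp γ xm g))
  filter_upwards [ae_regular xp xm N, h2] with x hx h2
  have h3 := creation_tcons_tsnoc (xp := xp) γ μ (propagation γ g) fun k => (hx.2 k).2.le
  have hinj : Function.Injective (tsnoc x xm) := injective_tsnoc.2 ⟨fun k => (hx.2 k).2.ne, hx.1⟩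
  have hlt : ∀ k, xp < tsnoc x xm k := fun k => by
    refine Fin.lastCases ?_ (fun k => ?_) k
    · simpa using hJ
    · simpa using (hx.2 k).1
  rw [creation_propagation γ μ g (injective_tcons.2 ⟨fun k => (hlt k).ne', hinj⟩),
    propagation_createOp_tcons γ μ g hinj hlt,
    propagation_tsnoc_evalOp γ _ hx.1 fun k => (hx.2 k).2, h2] at h3
  rw [eq_sub_of_add_eq' h3.symm, ← propagation_sub]
  rfl

end Regular

/-! ### The reflection exchanging the two signs -/

section Reflection

variable {N n : ℕ} {xp xm : ℝ}

/-- The reflection `(x₁, …, x_N) ↦ (-x_N, …, -x₁)`. -/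
def flipPt (x : Fin N → ℝ) : Fin N → ℝ := fun k => -x k.rev

theorem flipPt_flipPt (x : Fin N → ℝ) : flipPt (flipPt x) = x := by
  ext k; simp [flipPt]

theorem continuous_flipPt : Continuous (flipPt : (Fin N → ℝ) → Fin N → ℝ) :=
  continuous_pi fun k => (continuous_apply k.rev).neg

/-- The reflection, as a measurable equivalence. -/
def flipEquiv (N : ℕ) : (Fin N → ℝ) ≃ᵐ (Fin N → ℝ) where
  toFun := flipPt
  invFun := flipPt
  left_inv := flipPt_flipPt
  right_inv := flipPt_flipPt
  measurable_toFun := continuous_flipPt.measurable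
  measurable_invFun := continuous_flipPt.measurable

theorem measurePreserving_flip (N : ℕ) : MeasurePreserving (flipEquiv N) volume volume := by
  have h1 := volume_measurePreserving_piCongrLeft (fun _ : Fin N => ℝ) (Fin.revPerm (n := N))
  have h2 := (Measure.measurePreserving_neg (volume : Measure (Fin N → ℝ))).comp h1
  convert h2 using 1
  ext x k
  have := MeasurableEquiv.piCongrLeft_apply_apply (β := fun _ : Fin N => ℝ) (Fin.revPerm (n := N))
    x k.rev
  simp only [Fin.revPerm_apply, Fin.rev_rev] at this
  simp [flipEquiv, flipPt, this]

theorem strictAnti_flipPt {p : Fin N → ℝ} : StrictAnti (flipPt p) ↔ StrictAnti p := by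
  have h : ∀ p : Fin N → ℝ, StrictAnti p → StrictAnti (flipPt p) := fun p hp a b hab =>
    neg_lt_neg (hp (Fin.rev_lt_rev.2 hab))
  exact ⟨fun h' => flipPt_flipPt p ▸ h _ h', h p⟩

theorem sum_flipPt (x : Fin N → ℝ) : ∑ m, flipPt x m = -∑ m, x m := by
  simp only [flipPt, Finset.sum_neg_distrib]
  rw [← Equiv.sum_comp (Fin.revPerm (n := N)) x]
  rfl

/-- The reflection negates and reverses the points, so it preserves decreasing chains; the sign
change of both sums in the exponent is absorbed by `-μ`. -/
theorem chainIntegral_flip (μ : ℂ) (p : Fin (n + 1) → ℝ) (g : (Fin n → ℝ) → ℂ) :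
    chainIntegral μ p g = chainIntegral (-μ) (flipPt p) fun y => g (flipPt y) := by
  by_cases h : StrictAnti p
  · rw [chainIntegral, chainIntegral, if_pos h, if_pos (strictAnti_flipPt.2 h),
      ← (measurePreserving_flip n).setIntegral_preimage_emb (flipEquiv n).measurableEmbedding]
    -- Negation exchanges the open and closed ends of the intervals, which matters only on a null
    -- set.
    have hset : (flipEquiv n ⁻¹' univ.pi fun m : Fin n => Ioc (p m.succ) (p m.castSucc)) =ᵐ[volume]
        univ.pi fun m : Fin n => Ioc (flipPt p m.succ) (flipPt p m.castSucc) := by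
      have e : (flipEquiv n ⁻¹' univ.pi fun m : Fin n => Ioc (p m.succ) (p m.castSucc)) =
          univ.pi fun m : Fin n => Ico (flipPt p m.succ) (flipPt p m.castSucc) := by
        ext y
        simp only [mem_preimage, Set.mem_pi, mem_univ, true_imp_iff]
        rw [← (Fin.revPerm (n := n)).forall_congr_right]
        refine forall_congr' fun m => ?_
        simp only [flipEquiv, MeasurableEquiv.coe_mk, Equiv.coe_fn_mk, flipPt, mem_Ioc, mem_Ico,
          Fin.revPerm_apply, Fin.rev_rev, Fin.rev_succ, Fin.rev_castSucc]
        constructor <;> rintro ⟨h1, h2⟩ <;> constructor <;> linarith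
      rw [e]
      exact Measure.univ_pi_Ico_ae_eq_Icc.trans Measure.univ_pi_Ioc_ae_eq_Icc.symm
    rw [setIntegral_congr_set hset]
    congr 1
    ext y
    have e1 : flipEquiv n y = flipPt y := rfl
    rw [e1, sum_flipPt, sum_flipPt]
    congr 2
    push_cast
    ring
  · rw [chainIntegral, chainIntegral, if_neg h, if_neg fun h' => h (strictAnti_flipPt.1 h')]

/-- The reflection of tuples of labels. -/
def flipEmb : (Fin n ↪ Fin N) ≃ (Fin n ↪ Fin N) :=
  Equiv.embeddingCongr Fin.revPerm Fin.revPerm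

theorem flipEmb_apply (i : Fin n ↪ Fin N) (m : Fin n) : flipEmb i m = (i m.rev).rev := rfl

theorem flipPt_extend (i : Fin n ↪ Fin N) (y : Fin n → ℝ) (x : Fin N → ℝ) :
    flipPt (Function.extend (flipEmb i) y x) = Function.extend i (flipPt y) (flipPt x) := by
  ext k
  by_cases hk : ∃ m, i m = k
  · obtain ⟨m, rfl⟩ := hk
    have e : (i m).rev = flipEmb i m.rev := by rw [flipEmb_apply, Fin.rev_rev]
    rw [i.injective.extend_apply, flipPt, e, (flipEmb i).injective.extend_apply, flipPt]
  · rw [Function.extend_apply' _ _ _ hk, flipPt, Function.extend_apply', flipPt]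
    rintro ⟨m, hm⟩
    exact hk ⟨m.rev, Fin.rev_injective hm⟩

theorem flipPt_tcons (t : ℝ) (x : Fin N → ℝ) : flipPt (tcons t x) = tsnoc (flipPt x) (-t) := by
  ext k
  refine Fin.lastCases ?_ (fun k => ?_) k
  · simp [flipPt]
  · simp [flipPt, Fin.rev_castSucc]

theorem flipPt_tsnoc (t : ℝ) (x : Fin N → ℝ) : flipPt (tsnoc x t) = tcons (-t) (flipPt x) := by
  rw [← flipPt_flipPt (tcons (-t) (flipPt x)), flipPt_tcons, neg_neg, flipPt_flipPt]

theorem creation_minus (γ : ℝ) (μ : ℂ) (f : (Fin N → ℝ) → ℂ) (x : Fin (N + 1) → ℝ) :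
    creation γ μ .minus f x = creation γ (-μ) .plus (fun z => f (flipPt z)) (flipPt x) := by
  obtain ⟨x, t, rfl⟩ := exists_eq_tsnoc x
  rw [flipPt_tsnoc, creation_plus]
  refine Finset.sum_congr rfl fun n _ => ?_
  congr 1
  refine Fintype.sum_equiv flipEmb _ _ fun i => ?_
  rw [creationElem, chainIntegral_flip, creationTerm]
  congr 1
  · rw [tsnoc_last]
    change flipPt (tcons t fun m => tsnoc x t (i m).castSucc) = _
    rw [flipPt_tcons]
    congr 1
    ext m
    simp [flipPt, flipEmb_apply]
  · ext y
    rw [flipPt_extend, flipPt_flipPt]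
    simp only [tsnoc_castSucc]

theorem preserving_minus (γ : ℝ) (μ : ℂ) (f : (Fin N → ℝ) → ℂ) (x : Fin N → ℝ) :
    preserving xp xm γ μ .minus f x =
      preserving (-xm) (-xp) γ (-μ) .plus (fun z => f (flipPt z)) (flipPt x) := by
  change creation γ μ .minus f (tsnoc x xm) = creation γ (-μ) .plus _ (tcons (-xm) (flipPt x))
  rw [creation_minus, flipPt_tsnoc]

theorem annihilation_minus (γ : ℝ) (μ : ℂ) (f : (Fin (N + 1) → ℝ) → ℂ) (x : Fin N → ℝ) :
    annihilation xp xm γ μ .minus f x =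
      annihilation (-xm) (-xp) γ (-μ) .plus (fun z => f (flipPt z)) (flipPt x) := by
  refine Finset.sum_congr rfl fun n _ => ?_
  congr 1
  refine Fintype.sum_equiv flipEmb _ _ fun i => ?_
  rw [annihilationElem, annihilationElem]
  refine (chainIntegral_flip _ _ _).trans ?_
  congr 1
  · change flipPt (tcons xm (tsnoc (x ∘ i) xp)) = tcons (-xp) (tsnoc (flipPt x ∘ flipEmb i) (-xm))
    rw [flipPt_tcons, flipPt_tsnoc, ← tcons_tsnoc]
    congr 2
    ext m
    simp [flipPt, flipEmb_apply]
  · ext y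
    change f (tcons _ _) = f (flipPt (tsnoc _ _))
    rw [flipPt_tsnoc, flipPt_extend, flipPt_flipPt]
    congr 2
    · simp [flipPt]
    · congr 1
      ext m
      simp [flipPt, Fin.rev_castSucc]

/-- The reflection on continuous functions. -/
def flipOp : CF N →ₗ[ℂ] CF N where
  toFun f := ⟨fun x => f (flipPt x), f.continuous.comp continuous_flipPt⟩
  map_add' _ _ := rfl
  map_smul' _ _ := rfl

theorem flipOp_apply (f : CF N) (x : Fin N → ℝ) : flipOp f x = f (flipPt x) := rfl

theorem flipOp_flipOp (f : CF N) : flipOp (flipOp f) = f := by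
  ext x
  rw [flipOp_apply, flipOp_apply, flipPt_flipPt]

/-- The reflection of permutations. -/
def flipPerm : Equiv.Perm (Fin N) →* Equiv.Perm (Fin N) := (MulAut.conj Fin.revPerm).toMonoidHom

theorem flipPerm_apply (v : Equiv.Perm (Fin N)) (k : Fin N) : flipPerm v k = (v k.rev).rev := rfl

theorem flipPerm_flipPerm (v : Equiv.Perm (Fin N)) : flipPerm (flipPerm v) = v := by
  ext k
  simp [flipPerm_apply]

/-- The reflection of pairs of adjacent labels. -/
def AdjPair.flip (p : AdjPair N) : AdjPair N :=
  ⟨(p.1.2.rev, p.1.1.rev), by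
    have h := p.2
    have h1 := p.1.1.2
    have h2 := p.1.2.2
    simp only [Fin.val_rev]
    omega⟩

theorem flipPerm_swap (p : AdjPair N) : flipPerm p.swap = p.flip.swap := by
  ext k
  rw [flipPerm_apply, AdjPair.swap, AdjPair.swap, AdjPair.flip]
  simp only [Equiv.swap_apply_def, Fin.rev_eq_iff]
  split_ifs <;> simp_all

theorem flipPt_comp (v : Equiv.Perm (Fin N)) (x : Fin N → ℝ) :
    flipPt (x ∘ v) = flipPt x ∘ flipPerm v := by
  ext k
  simp [flipPt, flipPerm_apply]

theorem flipOp_reflOp (γ : ℝ) (p : AdjPair N) (f : CF N) :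
    flipOp (reflOp γ p f) = reflOp γ p.flip (flipOp f) := by
  ext x
  rw [flipOp_apply, reflOp_apply, reflOp_apply, integralReflection, integralReflection]
  have hsh : ∀ y : ℝ, flipPt (x - y • (Pi.single p.flip.1.1 1 - Pi.single p.flip.1.2 1)) =
      flipPt x - y • (Pi.single p.1.1 1 - Pi.single p.1.2 1) := by
    intro y
    ext k
    simp only [flipPt, AdjPair.flip, Pi.sub_apply, Pi.smul_apply, Pi.single_apply, smul_eq_mul,
      Fin.rev_inj]
    ring
  have hlen : flipPt x p.1.1 - flipPt x p.1.2 = x p.flip.1.1 - x p.flip.1.2 := by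
    simp only [flipPt, AdjPair.flip]
    ring
  simp only [flipOp_apply, hsh, hlen]
  rw [flipPt_comp, ← flipPerm_swap, flipPerm_flipPerm]

theorem flipOp_reflHom (γ : ℝ) (v : Equiv.Perm (Fin N)) : ∀ f : CF N,
    flipOp (reflHom γ N v f) = reflHom γ N (flipPerm v) (flipOp f) := by
  induction v using perm_induction with
  | h1 => intro f; simp
  | hmul p v ih =>
    intro f
    rw [map_mul, map_mul, map_mul, Module.End.mul_apply, Module.End.mul_apply, reflHom_swap,
      flipOp_reflOp, ih, flipPerm_swap, reflHom_swap]

/-- The reflection maps decreasing tuples to decreasing ones and permutes the generators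
$s_j^\gamma$ among themselves. -/
theorem propagation_flipOp (γ : ℝ) (g : CF N) {x : Fin N → ℝ} (hx : Function.Injective x) :
    propagation γ (flipOp g) x = propagation γ g (flipPt x) := by
  obtain ⟨τ, hτ⟩ := exists_strictAnti hx
  have h : StrictAnti (flipPt x ∘ flipPerm τ) := by
    rw [← flipPt_comp]; exact strictAnti_flipPt.2 hτ
  rw [propagation_eq γ g _ h, propagation_eq γ _ τ hτ, ← flipPt_comp, ← map_inv, ← flipOp_apply,
    flipOp_reflHom, flipPerm_flipPerm]

theorem flipEquiv_preimage : flipEquiv N ⁻¹' (univ.pi fun _ => Icc (-xm) (-xp)) =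
    univ.pi fun _ => Icc xp xm := by
  ext y
  simp only [mem_preimage, Set.mem_pi, mem_univ, true_imp_iff]
  rw [← (Fin.revPerm (n := N)).forall_congr_right]
  refine forall_congr' fun m => ?_
  simp only [flipEquiv, MeasurableEquiv.coe_mk, Equiv.coe_fn_mk, flipPt, mem_Icc,
    Fin.revPerm_apply, Fin.rev_rev]
  constructor <;> rintro ⟨h1, h2⟩ <;> constructor <;> linarith

theorem quasiMeasurePreserving_flipPt : Measure.QuasiMeasurePreserving flipPt (cube xp xm N)
    (cube (-xm) (-xp) N) := by
  have h := (measurePreserving_flip N).restrict_preimage_emb (flipEquiv N).measurableEmbedding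
    (univ.pi fun _ => Icc (-xm) (-xp))
  rw [flipEquiv_preimage] at h
  exact h.quasiMeasurePreserving

/-- Transfer of a formula on propagated functions from `ε = +` to `ε = -`. -/
theorem flip_transfer {M : ℕ} (γ : ℝ) {T : ((Fin N → ℝ) → ℂ) → (Fin M → ℝ) → ℂ}
    (hT : IsL2Operator (cube (-xm) (-xp) N) (cube (-xm) (-xp) M) T) {S : CF N → CF M}
    (h : ∀ g : CF N, T (propagation γ g) =ᵐ[cube (-xm) (-xp) M] propagation γ (S g)) (g : CF N) :
    (fun x => T (fun z => propagation γ g (flipPt z)) (flipPt x)) =ᵐ[cube xp xm M]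
      propagation γ (flipOp (S (flipOp g))) := by
  have h1 : (fun z => propagation γ g (flipPt z)) =ᵐ[cube (-xm) (-xp) N]
      propagation γ (flipOp g) := by
    filter_upwards [ae_regular (-xm) (-xp) N] with z hz
    exact (propagation_flipOp γ g hz.1).symm
  have h2 := (hT.congr _ _ h1).trans (h (flipOp g))
  filter_upwards [quasiMeasurePreserving_flipPt.ae h2, ae_regular xp xm M] with x hx hr
  rw [hx, propagation_flipOp γ _ hr.1]

end Reflection

/-! ### The operators on propagated functions -/

section Operators

variable {N : ℕ}

/-- The operator on continuous functions corresponding to `b^ε_μ`. -/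
def creOp (ε : Sgn) (μ : ℂ) : CF N →ₗ[ℂ] CF (N + 1) :=
  match ε with
  | .plus => createOp μ
  | .minus => flipOp ∘ₗ createOp (-μ) ∘ₗ flipOp

/-- The operator on continuous functions corresponding to `a^ε_μ`. -/
def preOp (xp xm γ : ℝ) (ε : Sgn) (μ : ℂ) : CF N →ₗ[ℂ] CF N :=
  match ε with
  | .plus => presOp γ μ xp
  | .minus => flipOp ∘ₗ presOp γ (-μ) (-xm) ∘ₗ flipOp

/-- The operator on continuous functions corresponding to `c^ε_μ`. -/
def annOp (xp xm γ : ℝ) (ε : Sgn) (μ : ℂ) : CF (N + 1) →ₗ[ℂ] CF N :=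
  match ε with
  | .plus => anniOp γ μ xp xm
  | .minus => flipOp ∘ₗ anniOp γ (-μ) (-xm) (-xp) ∘ₗ flipOp

theorem creation_propagation_ae_eq (xp xm γ : ℝ) (ε : Sgn) (μ : ℂ) (g : CF N) :
    creation γ μ ε (propagation γ g) =ᵐ[cube xp xm (N + 1)] propagation γ (creOp ε μ g) := by
  cases ε
  · exact creation_propagation_ae xp xm γ μ g
  · have h := flip_transfer (xp := xp) (xm := xm) γ
      (isL2Operator_creation (-xm) (-xp) γ (-μ) .plus N) (S := createOp (-μ))
      (creation_propagation_ae (-xm) (-xp) γ (-μ)) g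
    simp only [← creation_minus] at h
    exact h

theorem preserving_propagation_ae_eq {xp xm : ℝ} (hJ : xp < xm) (γ : ℝ) (ε : Sgn) (μ : ℂ)
    (g : CF N) : preserving xp xm γ μ ε (propagation γ g) =ᵐ[cube xp xm N]
      propagation γ (preOp xp xm γ ε μ g) := by
  cases ε
  · exact preserving_propagation_ae xp xm γ μ g
  · have h := flip_transfer (xp := xp) (xm := xm) γ
      (isL2Operator_preserving (neg_lt_neg hJ) γ (-μ) .plus N) (S := presOp γ (-μ) (-xm))
      (preserving_propagation_ae (-xm) (-xp) γ (-μ)) g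
    simp only [← preserving_minus] at h
    exact h

theorem annihilation_propagation_ae_eq {xp xm : ℝ} (hJ : xp < xm) (γ : ℝ) (ε : Sgn) (μ : ℂ)
    (g : CF (N + 1)) : annihilation xp xm γ μ ε (propagation γ g) =ᵐ[cube xp xm N]
      propagation γ (annOp xp xm γ ε μ g) := by
  cases ε
  · exact annihilation_propagation_ae hJ γ μ g
  · have h := flip_transfer (xp := xp) (xm := xm) γ
      (isL2Operator_annihilation (neg_lt_neg hJ) γ (-μ) .plus N)
      (S := anniOp γ (-μ) (-xm) (-xp))
      (annihilation_propagation_ae (neg_lt_neg hJ) γ (-μ)) g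
    simp only [← annihilation_minus] at h
    exact h

/-- For $\epsilon=-$ the relation with parameters $-\mu,-\nu$ is conjugated by the reflection; the
sign change of $\mu-\nu$ is the sign of $\epsilon i\gamma$. -/
theorem preOp_creOp (xp xm γ : ℝ) (ε : Sgn) {μ ν : ℂ} (h : μ ≠ ν) (g : CF N) :
    preOp xp xm γ ε μ (creOp ε ν g) =
      ((μ - ν + ε.val * Complex.I * γ) / (μ - ν)) • creOp ε ν (preOp xp xm γ ε μ g) -
        ((ε.val * Complex.I * γ) / (μ - ν)) • creOp ε μ (preOp xp xm γ ε ν g) := by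
  have h0 : μ - ν ≠ 0 := sub_ne_zero.2 h
  cases ε
  · simpa [preOp, creOp, Sgn.val] using presOp_createOp γ h xp g
  · have h1 := congrArg flipOp
      (presOp_createOp γ (neg_injective.ne h) (-xm) (flipOp g))
    simp only [preOp, creOp, Sgn.val, LinearMap.comp_apply, flipOp_flipOp]
    rw [h1, map_sub, map_smul, map_smul]
    have h2 : -μ - -ν ≠ 0 := sub_ne_zero.2 (neg_injective.ne h)
    congr 2 <;> (rw [div_eq_div_iff h2 h0]; ring)

theorem annOp_preOp (xp xm γ : ℝ) (ε : Sgn) {μ ν : ℂ} (h : μ ≠ ν) (g : CF (N + 1)) :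
    annOp xp xm γ ε μ (preOp xp xm γ ε ν g) =
      ((μ - ν - ε.val * Complex.I * γ) / (μ - ν)) • preOp xp xm γ ε ν (annOp xp xm γ ε μ g) +
        ((ε.val * Complex.I * γ) / (μ - ν)) • preOp xp xm γ ε μ (annOp xp xm γ ε ν g) := by
  have h0 : μ - ν ≠ 0 := sub_ne_zero.2 h
  cases ε
  · simpa [preOp, annOp, Sgn.val] using anniOp_presOp γ h xp xm g
  · have h1 := congrArg flipOp
      (anniOp_presOp γ (neg_injective.ne h) (-xm) (-xp) (flipOp g))
    simp only [preOp, annOp, Sgn.val, LinearMap.comp_apply, flipOp_flipOp]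
    rw [h1, map_add, map_smul, map_smul]
    have h2 : -μ - -ν ≠ 0 := sub_ne_zero.2 (neg_injective.ne h)
    congr 2 <;> (rw [div_eq_div_iff h2 h0]; ring)

end Operators

/-! ### Density of the wavefunctions among the propagated functions -/

section Density

variable {N : ℕ} {xp xm : ℝ}

/-- The cube `J^N`. -/
abbrev cubeSet (xp xm : ℝ) (N : ℕ) : Set (Fin N → ℝ) := univ.pi fun _ => Icc xp xm

theorem memLp_propagation (xp xm γ : ℝ) (g : CF N) : MemLp (propagation γ g) 2 (cube xp xm N) := by
  have h := locBdd_propagation γ g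
  obtain ⟨C, hC⟩ := h.bound (|xp| + |xm|)
  refine MemLp.of_bound h.measurable.aestronglyMeasurable C ?_
  filter_upwards [cube_ae_mem xp xm N] with x hx
  refine hC x fun k => abs_le.2 ?_
  have h1 := neg_abs_le xp
  have h2 := le_abs_self xm
  have h3 := abs_nonneg xp
  have h4 := abs_nonneg xm
  constructor <;> linarith [(hx k).1, (hx k).2]

/-- The restriction of `P g` to `J^N`, as an element of `L²(J^N)`. -/
def propL2 (xp xm γ : ℝ) : CF N →ₗ[ℂ] H xp xm N where
  toFun g := (memLp_propagation xp xm γ g).toLp (propagation γ g)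
  map_add' f g := by
    rw [← MemLp.toLp_add]
    exact MemLp.toLp_congr _ _ (Eventually.of_forall fun x => propagation_add γ f g x)
  map_smul' c g := by
    rw [RingHom.id_apply, ← MemLp.toLp_const_smul]
    exact MemLp.toLp_congr _ _ (Eventually.of_forall fun x => propagation_smul γ c g x)

theorem propL2_coeFn (xp xm γ : ℝ) (g : CF N) :
    propL2 xp xm γ g =ᵐ[cube xp xm N] propagation γ g :=
  MemLp.coeFn_toLp (memLp_propagation xp xm γ g)

/-- The plane wave, as a continuous function. -/
def planeWaveCF (lam : Fin N → ℂ) : CF N := ⟨planeWave lam, continuous_planeWave lam⟩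

theorem comp_perm_mem_cubeSet {x : Fin N → ℝ} (hx : x ∈ cubeSet xp xm N)
    (v : Equiv.Perm (Fin N)) : x ∘ v ∈ cubeSet xp xm N := fun k _ => hx (v k) (mem_univ _)

/-- The integral runs over the segment joining `x` to its reflection, which stays in the cube and
has parameter length at most `xm - xp`. -/
theorem norm_reflOp_le (γ : ℝ) (p : AdjPair N) {f : CF N} {C : ℝ}
    (hf : ∀ x ∈ cubeSet xp xm N, ‖f x‖ ≤ C) {x : Fin N → ℝ} (hx : x ∈ cubeSet xp xm N) :
    ‖reflOp γ p f x‖ ≤ (1 + |γ| * (xm - xp)) * C := by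
  have hC : 0 ≤ C := (norm_nonneg _).trans (hf x hx)
  have h1 := hx p.1.1 (mem_univ _)
  have h2 := hx p.1.2 (mem_univ _)
  have hint : ‖∫ y in (0 : ℝ)..(x p.1.1 - x p.1.2),
      f (x - y • (Pi.single p.1.1 1 - Pi.single p.1.2 1))‖ ≤ C * |x p.1.1 - x p.1.2 - 0| := by
    refine intervalIntegral.norm_integral_le_of_norm_le_const fun y hy => hf _ fun k _ => ?_
    have hy' := uIoc_subset_uIcc hy
    rw [mem_uIcc] at hy'
    have hk := hx k (mem_univ _)
    have hne := p.ne
    rcases eq_or_ne k p.1.1 with rfl | h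
    · simp only [Pi.sub_apply, Pi.smul_apply, Pi.single_eq_same, Pi.single_eq_of_ne hne,
        smul_eq_mul]
      rcases hy' with h | h <;> constructor <;> linarith [h.1, h.2, h1.1, h1.2, h2.1, h2.2]
    · rcases eq_or_ne k p.1.2 with rfl | h'
      · simp only [Pi.sub_apply, Pi.smul_apply, Pi.single_eq_same, Pi.single_eq_of_ne hne.symm,
          smul_eq_mul]
        rcases hy' with h | h <;> constructor <;> linarith [h.1, h.2, h1.1, h1.2, h2.1, h2.2]
      · simpa [Pi.single_eq_of_ne h, Pi.single_eq_of_ne h'] using hk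
  have habs : |x p.1.1 - x p.1.2 - 0| ≤ xm - xp := by
    rw [sub_zero, abs_le]
    constructor <;> linarith [h1.1, h1.2, h2.1, h2.2]
  rw [reflOp_apply, integralReflection]
  refine (norm_add_le _ _).trans ?_
  rw [norm_mul, Complex.norm_real, Real.norm_eq_abs]
  have h3 := hf _ (comp_perm_mem_cubeSet hx p.swap)
  have h4 := mul_le_mul_of_nonneg_left (hint.trans (mul_le_mul_of_nonneg_left habs hC))
    (abs_nonneg γ)
  linarith

theorem norm_reflHom_le (xp xm γ : ℝ) (v : Equiv.Perm (Fin N)) :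
    ∃ D : ℝ, ∀ (f : CF N) (C : ℝ), (∀ x ∈ cubeSet xp xm N, ‖f x‖ ≤ C) →
      ∀ x ∈ cubeSet xp xm N, ‖reflHom γ N v f x‖ ≤ D * C := by
  induction v using perm_induction with
  | h1 => exact ⟨1, fun f C hf x hx => by simpa using hf x hx⟩
  | hmul p v ih =>
    obtain ⟨D, hD⟩ := ih
    refine ⟨(1 + |γ| * (xm - xp)) * D, fun f C hf x hx => ?_⟩
    rw [map_mul, Module.End.mul_apply, reflHom_swap, mul_assoc]
    exact norm_reflOp_le γ p (hD f C hf) hx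

theorem norm_propagation_le (xp xm γ : ℝ) (N : ℕ) :
    ∃ D : ℝ, 0 ≤ D ∧ ∀ (f : CF N) (C : ℝ), (∀ x ∈ cubeSet xp xm N, ‖f x‖ ≤ C) →
      ∀ x ∈ cubeSet xp xm N, ‖propagation γ f x‖ ≤ D * C := by
  choose D hD using norm_reflHom_le (N := N) xp xm γ
  refine ⟨∑ v, |D v|, Finset.sum_nonneg fun _ _ => abs_nonneg _, fun f C hf x hx => ?_⟩
  have hC : 0 ≤ C := (norm_nonneg _).trans (hf x hx)
  rw [propagation_apply]
  refine (hD _ f C hf _ (comp_perm_mem_cubeSet hx _)).trans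
    (mul_le_mul_of_nonneg_right ((le_abs_self _).trans ?_) hC)
  exact Finset.single_le_sum (f := fun v => |D v|) (fun _ _ => abs_nonneg _) (Finset.mem_univ _)

/-- The restriction of a plane wave to the cube. -/
def planeWaveK (xp xm : ℝ) (lam : Fin N → ℂ) : C(cubeSet xp xm N, ℂ) :=
  (planeWaveCF lam).restrict (cubeSet xp xm N)

/-- The star algebra generated by the plane waves on the cube. -/
def planeWaveSubalgebra (xp xm : ℝ) (N : ℕ) : StarSubalgebra ℂ C(cubeSet xp xm N, ℂ) where
  toSubalgebra := Algebra.adjoin ℂ (range (planeWaveK (N := N) xp xm))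
  star_mem' := by
    change Algebra.adjoin ℂ (range (planeWaveK xp xm)) ≤
      star (Algebra.adjoin ℂ (range (planeWaveK xp xm)))
    refine Algebra.adjoin_le ?_
    rintro _ ⟨lam, rfl⟩
    have e : star (planeWaveK xp xm lam) =
        planeWaveK xp xm fun j => -(starRingEnd ℂ) (lam j) := by
      ext x
      simp only [planeWaveK, planeWaveCF, planeWave, ContinuousMap.restrict_apply,
        ContinuousMap.coe_mk, ContinuousMap.star_apply]
      rw [Complex.star_def, ← Complex.exp_conj]
      simp [map_sum]
    change star (planeWaveK xp xm lam) ∈ Algebra.adjoin ℂ (range (planeWaveK (N := N) xp xm))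
    rw [e]
    exact Algebra.subset_adjoin ⟨_, rfl⟩

theorem planeWaveSubalgebra_coe (xp xm : ℝ) (N : ℕ) :
    Subalgebra.toSubmodule (planeWaveSubalgebra xp xm N).toSubalgebra =
      Submodule.span ℂ (range (planeWaveK (N := N) xp xm)) := by
  apply Algebra.adjoin_eq_span_of_subset
  refine Subset.trans ?_ Submodule.subset_span
  intro x hx
  refine Submonoid.closure_induction (fun _ => id) ⟨0, ?_⟩ ?_ hx
  · ext z
    simp [planeWaveK, planeWaveCF, planeWave]
  · rintro _ _ _ _ ⟨l, rfl⟩ ⟨l', rfl⟩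
    refine ⟨l + l', ?_⟩
    ext z
    simp only [planeWaveK, planeWaveCF, planeWave, ContinuousMap.restrict_apply,
      ContinuousMap.coe_mk, ContinuousMap.mul_apply, ← Complex.exp_add, Pi.add_apply, add_mul,
      Finset.sum_add_distrib, mul_add]

/-- Stone-Weierstrass: plane waves are closed under products ($\lambda+\lambda'$) and conjugation
($-\bar\lambda$), and $\lambda=-ie_k$ gives $e^{x_k}$, which separates points. -/
theorem span_planeWaveK_dense (xp xm : ℝ) (N : ℕ) :
    (Submodule.span ℂ (range (planeWaveK (N := N) xp xm))).topologicalClosure = ⊤ := by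
  have : CompactSpace (cubeSet xp xm N) :=
    isCompact_iff_compactSpace.1 (isCompact_univ_pi fun _ => isCompact_Icc)
  have h := ContinuousMap.starSubalgebra_topologicalClosure_eq_top_of_separatesPoints
    (planeWaveSubalgebra xp xm N) (by
      rintro ⟨x, hx⟩ ⟨y, hy⟩ hxy
      obtain ⟨k, hk⟩ : ∃ k, x k ≠ y k := by
        by_contra hcon
        push Not at hcon
        exact hxy (Subtype.ext (funext hcon))
      refine ⟨_, ⟨planeWaveK xp xm (Pi.single k (-Complex.I)), Algebra.subset_adjoin ⟨_, rfl⟩,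
        rfl⟩, ?_⟩
      have e : ∀ z : cubeSet xp xm N, planeWaveK xp xm (Pi.single k (-Complex.I)) z =
          ((Real.exp ((z : Fin N → ℝ) k) : ℝ) : ℂ) := by
        intro z
        simp only [planeWaveK, planeWaveCF, planeWave, ContinuousMap.restrict_apply,
          ContinuousMap.coe_mk]
        rw [Finset.sum_eq_single k (fun j _ hj => by simp [hj]) (by simp), Complex.ofReal_exp,
          Pi.single_eq_same, ← mul_assoc]
        simp
      change planeWaveK xp xm (Pi.single k (-Complex.I)) _ ≠
        planeWaveK xp xm (Pi.single k (-Complex.I)) _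
      rw [e, e]
      exact fun h => hk (Real.exp_injective (Complex.ofReal_injective h)))
  rw [← planeWaveSubalgebra_coe]
  exact congrArg (Subalgebra.toSubmodule <| StarSubalgebra.toSubalgebra ·) h

/-- The counterparts of $b,a,c$ need not map plane waves to combinations of plane waves, so
membership is required for every continuous `g`. It is approximated uniformly on the cube by
combinations of plane waves, and propagation is bounded in the sup norm there. -/
theorem propL2_mem_zbar (xp xm γ : ℝ) (g : CF N) : propL2 xp xm γ g ∈ zbar xp xm γ N := by
  have : CompactSpace (cubeSet xp xm N) :=
    isCompact_iff_compactSpace.1 (isCompact_univ_pi fun _ => isCompact_Icc)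
  obtain ⟨D, hD0, hD⟩ := norm_propagation_le xp xm γ N
  set V : ℝ := (measureUnivNNReal (cube xp xm N) : ℝ) ^ (2 : ℝ≥0∞).toReal⁻¹ with hV
  have hV0 : 0 ≤ V := Real.rpow_nonneg (NNReal.coe_nonneg _) _
  refine Metric.mem_closure_iff.2 fun δ hδ => ?_
  have hg : g.restrict (cubeSet xp xm N) ∈
      (Submodule.span ℂ (range (planeWaveK (N := N) xp xm))).topologicalClosure := by
    rw [span_planeWaveK_dense]; trivial
  -- `D` bounds propagation in the sup norm and `V` compares the sup norm with the $L^2$-norm; the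
  -- added `1` makes the denominator positive and the final inequality strict.
  obtain ⟨h, hh, hdist⟩ := Metric.mem_closure_iff.1 hg (δ / (V * D + 1)) (by positivity)
  set res : CF N →ₗ[ℂ] C(cubeSet xp xm N, ℂ) :=
    { toFun := fun f => f.restrict (cubeSet xp xm N)
      map_add' := fun _ _ => rfl
      map_smul' := fun _ _ => rfl } with hres
  have hrange : range (planeWaveK (N := N) xp xm) = res '' range (planeWaveCF (N := N)) := by
    rw [← range_comp]; rfl
  rw [hrange, Submodule.span_image] at hh
  obtain ⟨F, hF, rfl⟩ := hh
  refine ⟨propL2 xp xm γ F, ?_, ?_⟩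
  · have hr : (range fun lam : Fin N → ℂ => psiL2 xp xm γ lam) =
        propL2 xp xm γ '' range (planeWaveCF (N := N)) := by
      rw [← range_comp]; rfl
    rw [hr, Submodule.span_image]
    exact ⟨F, hF, rfl⟩
  · have hsup : ∀ x ∈ cubeSet xp xm N, ‖(g - F) x‖ ≤ δ / (V * D + 1) := fun x hx =>
      (ContinuousMap.norm_coe_le_norm
        (g.restrict (cubeSet xp xm N) - F.restrict (cubeSet xp xm N)) ⟨x, hx⟩).trans
        (by rw [← dist_eq_norm]; exact hdist.le)
    have hb := hD (g - F) _ hsup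
    rw [dist_eq_norm, ← map_sub]
    have h1 : ‖propL2 xp xm γ (g - F)‖ ≤ V * (D * (δ / (V * D + 1))) := by
      refine Lp.norm_le_of_ae_bound (by positivity) ?_
      filter_upwards [propL2_coeFn xp xm γ (g - F), cube_ae_mem xp xm N] with x hx hxm
      rw [hx]
      exact hb x fun k _ => hxm k
    refine h1.trans_lt ?_
    have h2 : V * (D * (δ / (V * D + 1))) = (V * D) / (V * D + 1) * δ := by
      field_simp
    rw [h2]
    have h3 : (V * D) / (V * D + 1) < 1 := by
      rw [div_lt_one (by positivity)]; linarith
    nlinarith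

theorem toCLM_propL2 {M : ℕ} {γ : ℝ} {T : ((Fin N → ℝ) → ℂ) → (Fin M → ℝ) → ℂ}
    (hT : IsL2Operator (cube xp xm N) (cube xp xm M) T) {g : CF N} {g' : CF M}
    (h : T (propagation γ g) =ᵐ[cube xp xm M] propagation γ g') :
    hT.toCLM (propL2 xp xm γ g) = propL2 xp xm γ g' :=
  Lp.ext ((hT.toCLM_coeFn _).trans ((hT.congr _ _ (propL2_coeFn xp xm γ g)).trans
    (h.trans (propL2_coeFn xp xm γ g').symm)))

theorem map_zbar_le {M : ℕ} {γ : ℝ} (T : H xp xm N →L[ℂ] H xp xm M) {S : CF N → CF M}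
    (h : ∀ g, T (propL2 xp xm γ g) = propL2 xp xm γ (S g)) :
    ∀ f ∈ zbar xp xm γ N, T f ∈ zbar xp xm γ M := by
  have hle : zbar xp xm γ N ≤ (zbar xp xm γ M).comap T.toLinearMap := by
    refine Submodule.topologicalClosure_minimal _ (Submodule.span_le.2 ?_) ?_
    · rintro _ ⟨lam, rfl⟩
      change T (propL2 xp xm γ (planeWaveCF lam)) ∈ zbar xp xm γ M
      rw [h]
      exact propL2_mem_zbar xp xm γ _
    · exact (Submodule.isClosed_topologicalClosure _).preimage T.continuous
  exact hle

theorem eqOn_zbar {M : ℕ} {γ : ℝ} {T U : H xp xm N →L[ℂ] H xp xm M}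
    (h : ∀ g, T (propL2 xp xm γ g) = U (propL2 xp xm γ g)) :
    ∀ f ∈ zbar xp xm γ N, T f = U f := by
  refine ContinuousLinearMap.eqOn_closure_span ?_
  rintro _ ⟨lam, rfl⟩
  exact h (planeWaveCF lam)

end Density

/-! ### The operators and the relations on `zbar` -/

section Relations

variable {xp xm : ℝ} (hJ : xp < xm) (γ : ℝ) (N : ℕ) (ε : Sgn)

theorem bOp_propL2 (xp xm γ : ℝ) (N : ℕ) (ε : Sgn) (μ : ℂ) (g : CF N) :
    bOp xp xm γ N ε μ (propL2 xp xm γ g) = propL2 xp xm γ (creOp ε μ g) :=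
  toCLM_propL2 _ (creation_propagation_ae_eq xp xm γ ε μ g)

theorem aOp_propL2 (μ : ℂ) (g : CF N) :
    aOp hJ γ N ε μ (propL2 xp xm γ g) = propL2 xp xm γ (preOp xp xm γ ε μ g) :=
  toCLM_propL2 _ (preserving_propagation_ae_eq hJ γ ε μ g)

theorem cOp_propL2 (μ : ℂ) (g : CF (N + 1)) :
    cOp hJ γ N ε μ (propL2 xp xm γ g) = propL2 xp xm γ (annOp xp xm γ ε μ g) :=
  toCLM_propL2 _ (annihilation_propagation_ae_eq hJ γ ε μ g)

theorem aOp_bOp {μ ν : ℂ} (h : μ ≠ ν) : ∀ f ∈ zbar xp xm γ N,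
    aOp hJ γ (N + 1) ε μ (bOp xp xm γ N ε ν f) =
      ((μ - ν + ε.val * Complex.I * γ) / (μ - ν)) • bOp xp xm γ N ε ν (aOp hJ γ N ε μ f) -
        ((ε.val * Complex.I * γ) / (μ - ν)) • bOp xp xm γ N ε μ (aOp hJ γ N ε ν f) := by
  refine eqOn_zbar (T := aOp hJ γ (N + 1) ε μ ∘L bOp xp xm γ N ε ν)
    (U := ((μ - ν + ε.val * Complex.I * γ) / (μ - ν)) • (bOp xp xm γ N ε ν ∘L aOp hJ γ N ε μ) -
      ((ε.val * Complex.I * γ) / (μ - ν)) • (bOp xp xm γ N ε μ ∘L aOp hJ γ N ε ν)) fun g => ?_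
  simp only [ContinuousLinearMap.comp_apply, sub_apply,
    smul_apply, bOp_propL2, aOp_propL2, preOp_creOp xp xm γ ε h, map_sub,
    map_smul]

theorem cOp_aOp {μ ν : ℂ} (h : μ ≠ ν) : ∀ f ∈ zbar xp xm γ (N + 1),
    cOp hJ γ N ε μ (aOp hJ γ (N + 1) ε ν f) =
      ((μ - ν - ε.val * Complex.I * γ) / (μ - ν)) • aOp hJ γ N ε ν (cOp hJ γ N ε μ f) +
        ((ε.val * Complex.I * γ) / (μ - ν)) • aOp hJ γ N ε μ (cOp hJ γ N ε ν f) := by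
  refine eqOn_zbar (T := cOp hJ γ N ε μ ∘L aOp hJ γ (N + 1) ε ν)
    (U := ((μ - ν - ε.val * Complex.I * γ) / (μ - ν)) • (aOp hJ γ N ε ν ∘L cOp hJ γ N ε μ) +
      ((ε.val * Complex.I * γ) / (μ - ν)) • (aOp hJ γ N ε μ ∘L cOp hJ γ N ε ν)) fun g => ?_
  simp only [ContinuousLinearMap.comp_apply, add_apply,
    smul_apply, cOp_propL2, aOp_propL2, annOp_preOp xp xm γ ε h, map_add,
    map_smul]

end Relations

/-! ### Continuity in the spectral parameter -/

section Continuity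

variable {N n : ℕ}

open Classical in
/-- The chain integral of the absolute value, for `μ = 0`. -/
def chainAbs (p : Fin (n + 1) → ℝ) (g : (Fin n → ℝ) → ℂ) : ℝ :=
  if StrictAnti p then ∫ y in univ.pi (fun m : Fin n => Ioc (p m.succ) (p m.castSucc)), ‖g y‖ else 0

theorem chainAbs_nonneg (p : Fin (n + 1) → ℝ) (g : (Fin n → ℝ) → ℂ) : 0 ≤ chainAbs p g := by
  unfold chainAbs
  split_ifs
  · exact integral_nonneg fun _ => norm_nonneg _
  · exact le_rfl

theorem chainIntegral_zero_norm (p : Fin (n + 1) → ℝ) (g : (Fin n → ℝ) → ℂ) :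
    chainIntegral 0 p (fun y => ((‖g y‖ : ℝ) : ℂ)) = chainAbs p g := by
  unfold chainIntegral chainAbs
  split_ifs
  · refine Eq.trans (integral_congr_ae (Eventually.of_forall fun y => ?_)) integral_ofReal
    simp
  · simp

theorem norm_exp_sub_exp_le {κ μ : ℂ} {s L : ℝ} (hs : |s| ≤ L) (hκ : ‖κ - μ‖ * L ≤ 1) :
    ‖Complex.exp (Complex.I * κ * s) - Complex.exp (Complex.I * μ * s)‖ ≤
      Real.exp (‖μ‖ * L) * (2 * L) * ‖κ - μ‖ := by
  have e : Complex.exp (Complex.I * κ * s) - Complex.exp (Complex.I * μ * s) =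
      Complex.exp (Complex.I * μ * s) * (Complex.exp (Complex.I * (κ - μ) * s) - 1) := by
    rw [mul_sub, ← Complex.exp_add, mul_one]
    congr 2
    ring
  have h1 : ‖Complex.I * (κ - μ) * s‖ ≤ ‖κ - μ‖ * L := by
    rw [norm_mul, norm_mul, Complex.norm_I, one_mul, Complex.norm_real, Real.norm_eq_abs]
    exact mul_le_mul_of_nonneg_left hs (norm_nonneg _)
  have h2 : ‖Complex.exp (Complex.I * μ * s)‖ ≤ Real.exp (‖μ‖ * L) := by
    refine (Complex.norm_exp_le_exp_norm _).trans (Real.exp_le_exp.2 ?_)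
    rw [norm_mul, norm_mul, Complex.norm_I, one_mul, Complex.norm_real, Real.norm_eq_abs]
    exact mul_le_mul_of_nonneg_left hs (norm_nonneg _)
  have h3 := (Complex.norm_exp_sub_one_le (h1.trans hκ)).trans
    (mul_le_mul_of_nonneg_left h1 zero_le_two)
  rw [e, norm_mul]
  refine (mul_le_mul h2 h3 (norm_nonneg _) (Real.exp_pos _).le).trans (le_of_eq ?_)
  ring

/-- Only the exponential depends on the parameter, and its argument involves $n+1$ points and $n$
variables of modulus at most `R`, hence the length $(2n+1)R$. -/
theorem norm_chainIntegral_sub_le {κ μ : ℂ} {p : Fin (n + 1) → ℝ} {R L : ℝ}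
    (hp : ∀ m, |p m| ≤ R) (hL : (2 * n + 1) * R ≤ L) (hκ : ‖κ - μ‖ * L ≤ 1)
    (g : (Fin n → ℝ) → ℂ) :
    ‖chainIntegral κ p g - chainIntegral μ p g‖ ≤
      Real.exp (‖μ‖ * L) * (2 * L) * ‖κ - μ‖ * chainAbs p g := by
  unfold chainIntegral chainAbs
  split_ifs with h
  · set B : Set (Fin n → ℝ) := univ.pi fun m : Fin n => Ioc (p m.succ) (p m.castSucc) with hB
    have hBm : MeasurableSet B := MeasurableSet.univ_pi fun _ => measurableSet_Ioc
    have hs : ∀ y ∈ B, |∑ m, p m - ∑ m, y m| ≤ L := by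
      intro y hy
      refine le_trans ?_ hL
      refine (abs_sub _ _).trans ?_
      have h1 : |∑ m, p m| ≤ (n + 1) * R := by
        refine (Finset.abs_sum_le_sum_abs _ _).trans ?_
        refine (Finset.sum_le_card_nsmul _ _ R fun m _ => hp m).trans ?_
        simp
      have h2 : |∑ m, y m| ≤ n * R := by
        refine (Finset.abs_sum_le_sum_abs _ _).trans ?_
        refine (Finset.sum_le_card_nsmul _ _ R fun m _ => ?_).trans ?_
        · have h3 := hy m (mem_univ m)
          have h4 := abs_le.1 (hp m.succ)
          have h5 := abs_le.1 (hp m.castSucc)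
          exact abs_le.2 ⟨h4.1.trans h3.1.le, h3.2.trans h5.2⟩
        · simp
      linarith
    set E : ℂ → (Fin n → ℝ) → ℂ := fun κ y =>
      Complex.exp (Complex.I * κ * ((∑ m, p m : ℝ) - (∑ m, y m : ℝ))) with hE
    have hEc : ∀ κ, Continuous (E κ) := fun κ => by simp only [hE]; fun_prop
    have hEb : ∀ κ, ∃ C, ∀ y ∈ B, ‖E κ y‖ ≤ C := by
      intro κ
      refine ⟨Real.exp (‖κ‖ * L), fun y hy => ?_⟩
      refine (Complex.norm_exp_le_exp_norm _).trans (Real.exp_le_exp.2 ?_)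
      rw [norm_mul, norm_mul, Complex.norm_I, one_mul, ← Complex.ofReal_sub, Complex.norm_real,
        Real.norm_eq_abs]
      exact mul_le_mul_of_nonneg_left (hs y hy) (norm_nonneg _)
    have hmul : ∀ (κ : ℂ) (f : (Fin n → ℝ) → ℂ), IntegrableOn f B →
        IntegrableOn (fun y => E κ y * f y) B := by
      intro κ f hf
      obtain ⟨C, hC⟩ := hEb κ
      refine Integrable.bdd_mul (c := C) hf (hEc κ).aestronglyMeasurable ?_
      exact (ae_restrict_iff' hBm).2 (Eventually.of_forall hC)
    by_cases hg : IntegrableOn g B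
    · rw [← integral_sub (hmul κ g hg) (hmul μ g hg), ← integral_const_mul]
      refine norm_integral_le_of_norm_le (hg.norm.const_mul _) ?_
      refine (ae_restrict_iff' hBm).2 (Eventually.of_forall fun y hy => ?_)
      rw [← sub_mul, norm_mul]
      refine mul_le_mul_of_nonneg_right ?_ (norm_nonneg _)
      have h1 := norm_exp_sub_exp_le (hs y hy) hκ
      rw [Complex.ofReal_sub] at h1
      exact h1
    -- The exponential and its inverse are bounded on the box, so if `g` is not integrable, neither
    -- is any of the integrands; both integrals then have the default value zero.
    · have h0 : ∀ κ, ¬ IntegrableOn (fun y => E κ y * g y) B := by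
        intro κ hκ
        refine hg ((hmul (-κ) _ hκ).congr (Eventually.of_forall fun y => ?_))
        simp only [hE]
        rw [← mul_assoc, ← Complex.exp_add]
        simp
      rw [integral_undef (h0 κ), integral_undef (h0 μ), sub_zero, norm_zero]
      have hL0 : 0 ≤ L := by
        refine le_trans ?_ hL
        have := (abs_nonneg _).trans (hp 0)
        positivity
      have : 0 ≤ ∫ y in B, ‖g y‖ := integral_nonneg fun _ => norm_nonneg _
      positivity
  · simp

theorem exists_creationElem_eq (i : Fin n ↪ Fin N) (ε : Sgn) {x : Fin (N + 1) → ℝ} {R : ℝ}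
    (hx : ∀ k, |x k| ≤ R) : ∃ (p : Fin (n + 1) → ℝ) (c : (Fin n → ℝ) → Fin N → ℝ),
      (∀ m, |p m| ≤ R) ∧ ∀ (μ : ℂ) (f : (Fin N → ℝ) → ℂ),
        creationElem μ i ε f x = chainIntegral μ p fun y => f (c y) := by
  cases ε
  · refine ⟨_, _, fun m => ?_, fun μ f => rfl⟩
    refine Fin.lastCases ?_ (fun m => ?_) m
    · simpa using hx 0
    · simpa using hx _
  · refine ⟨_, _, fun m => ?_, fun μ f => rfl⟩
    refine Fin.cases ?_ (fun m => ?_) m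
    · simpa using hx _
    · simpa using hx _

/-- The variation in the parameter is dominated by the same operator with `|γ|` and parameter `0`,
applied to the absolute value of `f`. Boundedness of this one operator on $L^2$ yields strong
continuity. -/
theorem norm_creation_sub_le (γ : ℝ) {κ μ : ℂ} (ε : Sgn) (f : (Fin N → ℝ) → ℂ)
    {x : Fin (N + 1) → ℝ} {R : ℝ} (hx : ∀ k, |x k| ≤ R)
    (hκ : ‖κ - μ‖ * ((2 * N + 1) * R) ≤ 1) :
    ‖creation γ κ ε f x - creation γ μ ε f x‖ ≤
      Real.exp (‖μ‖ * ((2 * N + 1) * R)) * (2 * ((2 * N + 1) * R)) * ‖κ - μ‖ *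
        ‖creation |γ| 0 ε (fun z => ((‖f z‖ : ℝ) : ℂ)) x‖ := by
  have hR : 0 ≤ R := (abs_nonneg _).trans (hx 0)
  set L : ℝ := (2 * N + 1) * R with hL
  set δ : ℝ := Real.exp (‖μ‖ * L) * (2 * L) * ‖κ - μ‖ with hδ
  have key : ∀ n ∈ Finset.range (N + 1), ∀ i : Fin n ↪ Fin N, ∃ r : ℝ, 0 ≤ r ∧
      creationElem 0 i ε (fun z => ((‖f z‖ : ℝ) : ℂ)) x = r ∧
      ‖creationElem κ i ε f x - creationElem μ i ε f x‖ ≤ δ * r := by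
    intro n hn i
    obtain ⟨p, c, hp, hc⟩ := exists_creationElem_eq i ε hx
    refine ⟨chainAbs p fun y => f (c y), chainAbs_nonneg _ _, ?_, ?_⟩
    · rw [hc]
      exact chainIntegral_zero_norm p fun y => f (c y)
    · rw [hc, hc]
      refine norm_chainIntegral_sub_le hp ?_ hκ _
      have : (n : ℝ) ≤ N := by
        exact_mod_cast Nat.lt_succ_iff.1 (Finset.mem_range.1 hn)
      rw [hL]
      gcongr
  choose! r hr0 hr hrd using key
  have e1 : creation |γ| 0 ε (fun z => ((‖f z‖ : ℝ) : ℂ)) x =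
      ((∑ n ∈ Finset.range (N + 1), |γ| ^ n * ∑ i : Fin n ↪ Fin N, r n i : ℝ) : ℂ) := by
    unfold creation
    push_cast
    refine Finset.sum_congr rfl fun n hn => ?_
    congr 1
    exact Finset.sum_congr rfl fun i _ => hr n hn i
  rw [e1, Complex.norm_real, Real.norm_of_nonneg (Finset.sum_nonneg fun n hn =>
    mul_nonneg (pow_nonneg (abs_nonneg _) _) (Finset.sum_nonneg fun i _ => hr0 n hn i))]
  unfold creation
  rw [← Finset.sum_sub_distrib, Finset.mul_sum]
  refine norm_sum_le_of_le _ fun n hn => ?_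
  rw [← mul_sub, norm_mul, norm_pow, Complex.norm_real, Real.norm_eq_abs, ← Finset.sum_sub_distrib,
    mul_left_comm]
  refine mul_le_mul_of_nonneg_left ?_ (pow_nonneg (abs_nonneg _) _)
  rw [Finset.mul_sum]
  exact norm_sum_le_of_le _ fun i _ => hrd n hn i

theorem abs_le_of_mem_Icc {xp xm t : ℝ} (ht : t ∈ Icc xp xm) : |t| ≤ |xp| + |xm| := by
  have h1 := neg_abs_le xp
  have h2 := le_abs_self xm
  have h3 := abs_nonneg xp
  have h4 := abs_nonneg xm
  exact abs_le.2 ⟨by linarith [ht.1], by linarith [ht.2]⟩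

/-- A family of integral operators which depends continuously on a parameter. -/
theorem tendsto_toCLM {xp xm : ℝ} {M : ℕ} {T : ℂ → ((Fin N → ℝ) → ℂ) → (Fin M → ℝ) → ℂ}
    (hT : ∀ κ, IsL2Operator (cube xp xm N) (cube xp xm M) (T κ))
    {A : ((Fin N → ℝ) → ℂ) → (Fin M → ℝ) → ℂ}
    (hA : IsL2Operator (cube xp xm N) (cube xp xm M) A) {μ : ℂ} {L D : ℝ}
    (h : ∀ κ : ℂ, ‖κ - μ‖ * L ≤ 1 → ∀ f : (Fin N → ℝ) → ℂ, ∀ᵐ x ∂(cube xp xm M),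
      ‖T κ f x - T μ f x‖ ≤ D * ‖κ - μ‖ * ‖A (fun z => ((‖f z‖ : ℝ) : ℂ)) x‖)
    (f : H xp xm N) :
    Tendsto (fun κ => (hT κ).toCLM f) (𝓝 μ) (𝓝 ((hT μ).toCLM f)) := by
  have hf : MemLp (fun z => ((‖f z‖ : ℝ) : ℂ)) 2 (cube xp xm N) := (Lp.memLp f).norm.ofReal
  set F : H xp xm N := hf.toLp _ with hF
  have h0 : Tendsto (fun κ : ℂ => ‖κ - μ‖) (𝓝 μ) (𝓝 0) := by
    have : Continuous fun κ : ℂ => ‖κ - μ‖ := by fun_prop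
    simpa using this.tendsto μ
  rw [tendsto_iff_norm_sub_tendsto_zero]
  refine squeeze_zero' (Eventually.of_forall fun _ => norm_nonneg _) (g := fun κ =>
    D * ‖κ - μ‖ * ‖hA.toCLM F‖) ?_ ?_
  · have hev : ∀ᶠ κ in 𝓝 μ, ‖κ - μ‖ * L < 1 := by
      have := h0.mul_const L
      rw [zero_mul] at this
      exact this.eventually_lt_const one_pos
    filter_upwards [hev] with κ hκ
    refine Lp.norm_le_mul_norm_of_ae_le_mul ?_
    filter_upwards [h κ hκ.le f, Lp.coeFn_sub ((hT κ).toCLM f) ((hT μ).toCLM f),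
      (hT κ).toCLM_coeFn f, (hT μ).toCLM_coeFn f, hA.toCLM_coeFn F,
      hA.congr _ _ hf.coeFn_toLp] with x h1 h2 h3 h4 h5 h6
    rw [h2, Pi.sub_apply, h3, h4, h5, h6]
    exact h1
  · have := (h0.const_mul D).mul_const ‖hA.toCLM F‖
    simpa using this

theorem tendsto_bOp (xp xm γ : ℝ) (N : ℕ) (ε : Sgn) (μ : ℂ) (f : H xp xm N) :
    Tendsto (fun κ => bOp xp xm γ N ε κ f) (𝓝 μ) (𝓝 (bOp xp xm γ N ε μ f)) := by
  refine tendsto_toCLM (fun κ => isL2Operator_creation xp xm γ κ ε N)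
    (isL2Operator_creation xp xm |γ| 0 ε N) (L := (2 * N + 1) * (|xp| + |xm|))
    (D := Real.exp (‖μ‖ * ((2 * N + 1) * (|xp| + |xm|))) * (2 * ((2 * N + 1) * (|xp| + |xm|))))
    (fun κ hκ f => ?_) f
  filter_upwards [cube_ae_mem xp xm (N + 1)] with x hx
  exact norm_creation_sub_le γ ε f (fun k => abs_le_of_mem_Icc (hx k)) hκ

theorem tendsto_aOp {xp xm : ℝ} (hJ : xp < xm) (γ : ℝ) (N : ℕ) (ε : Sgn) (μ : ℂ)
    (f : H xp xm N) :
    Tendsto (fun κ => aOp hJ γ N ε κ f) (𝓝 μ) (𝓝 (aOp hJ γ N ε μ f)) := by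
  refine tendsto_toCLM (fun κ => isL2Operator_preserving hJ γ κ ε N)
    (isL2Operator_preserving hJ |γ| 0 ε N) (L := (2 * N + 1) * (|xp| + |xm|))
    (D := Real.exp (‖μ‖ * ((2 * N + 1) * (|xp| + |xm|))) * (2 * ((2 * N + 1) * (|xp| + |xm|))))
    (fun κ hκ f => ?_) f
  filter_upwards [cube_ae_mem xp xm N] with x hx
  refine norm_creation_sub_le γ ε f (fun k => abs_le_of_mem_Icc ?_) hκ
  cases ε
  · refine Fin.cases ?_ (fun k => ?_) k
    · exact left_mem_Icc.2 hJ.le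
    · exact hx k
  · refine Fin.lastCases ?_ (fun k => ?_) k
    · change tsnoc x xm (Fin.last N) ∈ _
      rw [tsnoc_last]
      exact right_mem_Icc.2 hJ.le
    · change tsnoc x xm k.castSucc ∈ _
      rw [tsnoc_castSucc]
      exact hx k

end Continuity

end QNLS

end

/-! ### The main theorem. -/

theorem mainTheorem3 (γ : ℝ) {xp xm : ℝ} (hJ : xp < xm) (N : ℕ) (ε : QNLS.Sgn) (μ ν : ℂ) :
    -- the operators map between the spaces `zbar`
    (∀ f ∈ QNLS.zbar xp xm γ N, QNLS.bOp xp xm γ N ε μ f ∈ QNLS.zbar xp xm γ (N + 1)) ∧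
    (∀ f ∈ QNLS.zbar xp xm γ N, QNLS.aOp hJ γ N ε μ f ∈ QNLS.zbar xp xm γ N) ∧
    (∀ f ∈ QNLS.zbar xp xm γ (N + 1), QNLS.cOp hJ γ N ε μ f ∈ QNLS.zbar xp xm γ N) ∧
    -- the relations for `μ ≠ ν`
    (μ ≠ ν →
      (∀ f ∈ QNLS.zbar xp xm γ N,
        QNLS.aOp hJ γ (N + 1) ε μ (QNLS.bOp xp xm γ N ε ν f) =
          ((μ - ν + ε.val * Complex.I * γ) / (μ - ν)) •
              QNLS.bOp xp xm γ N ε ν (QNLS.aOp hJ γ N ε μ f) -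
            ((ε.val * Complex.I * γ) / (μ - ν)) •
              QNLS.bOp xp xm γ N ε μ (QNLS.aOp hJ γ N ε ν f)) ∧
      (∀ f ∈ QNLS.zbar xp xm γ (N + 1),
        QNLS.cOp hJ γ N ε μ (QNLS.aOp hJ γ (N + 1) ε ν f) =
          ((μ - ν - ε.val * Complex.I * γ) / (μ - ν)) •
              QNLS.aOp hJ γ N ε ν (QNLS.cOp hJ γ N ε μ f) +
            ((ε.val * Complex.I * γ) / (μ - ν)) •
              QNLS.aOp hJ γ N ε μ (QNLS.cOp hJ γ N ε ν f))) ∧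
    -- the relations for `μ = ν`, whose right-hand sides are limits
    (∀ f ∈ QNLS.zbar xp xm γ N,
      Tendsto (fun κ : ℂ =>
          ((μ - κ + ε.val * Complex.I * γ) / (μ - κ)) •
              QNLS.bOp xp xm γ N ε κ (QNLS.aOp hJ γ N ε μ f) -
            ((ε.val * Complex.I * γ) / (μ - κ)) •
              QNLS.bOp xp xm γ N ε μ (QNLS.aOp hJ γ N ε κ f))
        (𝓝[≠] μ) (𝓝 (QNLS.aOp hJ γ (N + 1) ε μ (QNLS.bOp xp xm γ N ε μ f)))) ∧
    (∀ f ∈ QNLS.zbar xp xm γ (N + 1),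
      Tendsto (fun κ : ℂ =>
          ((μ - κ - ε.val * Complex.I * γ) / (μ - κ)) •
              QNLS.aOp hJ γ N ε κ (QNLS.cOp hJ γ N ε μ f) +
            ((ε.val * Complex.I * γ) / (μ - κ)) •
              QNLS.aOp hJ γ N ε μ (QNLS.cOp hJ γ N ε κ f))
        (𝓝[≠] μ) (𝓝 (QNLS.cOp hJ γ N ε μ (QNLS.aOp hJ γ (N + 1) ε μ f)))) := by
  refine ⟨QNLS.map_zbar_le _ (QNLS.bOp_propL2 xp xm γ N ε μ),
    QNLS.map_zbar_le _ (QNLS.aOp_propL2 hJ γ N ε μ),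
    QNLS.map_zbar_le _ (QNLS.cOp_propL2 hJ γ N ε μ),
    fun h => ⟨QNLS.aOp_bOp hJ γ N ε h, QNLS.cOp_aOp hJ γ N ε h⟩, fun f hf => ?_, fun f hf => ?_⟩
  -- No cancellation of the pole is computed: for `κ ≠ μ` the expression equals $a_\mu b_\kappa f$,
  -- which converges by continuity of $a_\mu$ and strong continuity of $b_\kappa$.
  · refine Tendsto.congr' ?_ (((QNLS.aOp hJ γ (N + 1) ε μ).continuous.tendsto _).comp
      ((QNLS.tendsto_bOp xp xm γ N ε μ f).mono_left nhdsWithin_le_nhds))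
    filter_upwards [self_mem_nhdsWithin] with κ hκ
    exact QNLS.aOp_bOp hJ γ N ε (Ne.symm hκ) f hf
  -- In the same way the expression is $c_\mu a_\kappa f$, with $a_\kappa$ strongly continuous.
  · refine Tendsto.congr' ?_ (((QNLS.cOp hJ γ N ε μ).continuous.tendsto _).comp
      ((QNLS.tendsto_aOp hJ γ (N + 1) ε μ f).mono_left nhdsWithin_le_nhds))
    filter_upwards [self_mem_nhdsWithin] with κ hκ
    exact QNLS.cOp_aOp hJ γ N ε (Ne.symm hκ) f hf
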